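/- Let $k$ be a field of characteristic zero. Let $\mathfrak{lie}_n=\prod_{m\ge1}\mathfrak{lie}^m(x_1,\dots,x_n)$ be the degree-completed free Lie algebra over $k$, and write $x,y$ (and $z$) for the generators if $n=2$ (or $3$). Let $\mathrm{Ass}_n$ be the degree-completed free associative algebra, $\mathrm{Ass}_n^+$ its part without constant term, $\mathfrak{tr}_n=\mathrm{Ass}_n^+/\langle ab-ba;\ a,b\in \mathrm{Ass}_n\rangle$, and $\mathrm{Tr}:\mathrm{Ass}_n\to\mathfrak{tr}_n$ the natural projection. Let $\partial_i$ be the operators on $\mathrm{Ass}_n$ with $a=a_0+\sum_i(\partial_i a)x_i$, $a_0\in k$. For $a_1,\dots,a_n\in\mathfrak{lie}_n$ denote by $(a_1,\dots,a_n)$ the derivation $x_i\mapsto[x_i,a_i]$ of $\mathfrak{lie}_n$. Such derivations are called tangential, and each of them comes from exactly one tuple that is normalized, i.e. such that for every $i$ the coefficient of $x_i$ in $a_i$ vanishes. A tangential derivation $u$ is special if $u(x_1+\dots+x_n)=0$, and its divergence is $\mathrm{div}(u)=\sum_i\mathrm{Tr}(x_i\,\partial_i a_i)\in\mathfrak{tr}_n$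 for the normalized tuple of $u$. Define $\delta:\mathfrak{tr}_2\to\mathfrak{tr}_3$ by $(\delta f)(x,y,z)=f(y,z)-f(x+y,z)+f(x,y+z)-f(x,y)$, and let $\widehat{\mathfrak{kv}}_2$ be the set of special derivations $u$ of $\mathfrak{lie}_2$ with $\delta(\mathrm{div}(u))=0$. Let $\mathfrak{t}_4$ be the Lie algebra with generators $t^{i,j}=t^{j,i}$, $1\le i\ne j\le4$, and relations $[t^{i,j},t^{p,q}]=0$ for $\{i,j\}\cap\{p,q\}=\emptyset$ and $[t^{i,j}+t^{i,l},t^{j,l}]=0$ for distinct $i,j,l$. Let $\mathfrak{grt}$ be the set of all $\psi\in\mathfrak{lie}_2$ such that $\psi(x,y)=-\psi(y,x)$; $\psi(x,y)+\psi(y,z)+\psi(z,x)=0$ for $z=-x-y$; and, in the degree completion of $\mathfrak{t}_4$, $$\psi(t^{1,2},t^{2,3}+t^{2,4})+\psi(t^{1,3}+t^{2,3},t^{3,4})=\psi(t^{2,3},t^{3,4})+\psi(t^{1,2}+t^{1,3},t^{2,4}+t^{3,4})+\psi(t^{1,2},t^{2,3}).$$ Then $\mathfrak{grt}$ is a Lie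 algebra under the Ihara bracket $$[\psi_1,\psi_2]_{\mathrm{Ih}}=(0,\psi_1)(\psi_2)-(0,\psi_2)(\psi_1)+[\psi_1,\psi_2],$$ $\widehat{\mathfrak{kv}}_2$ is a Lie algebra under the commutator of derivations, and $$\nu:\psi\mapsto\big(\psi(-x-y,x),\,\psi(-x-y,y)\big)$$ is an injective Lie algebra homomorphism from $\mathfrak{grt}$ to $\widehat{\mathfrak{kv}}_2$. -/

import Mathlib

/-!
Free Lie algebras (degree completed), tangential derivations, the divergence, the extended
Kashiwara-Vergne Lie algebra and the Grothendieck-Teichmueller Lie algebra.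
-/

namespace KashiwaraVergne

open Finset

noncomputable section

universe u v w

/-! ### Sums over triples of natural numbers with a given sum -/

theorem sum_swap {M : Type*} [AddCommMonoid M] (f : ℕ × ℕ → M) (n : ℕ) :
    ∑ p ∈ antidiagonal n, f p.swap = ∑ p ∈ antidiagonal n, f p :=
  Finset.Nat.sum_antidiagonal_swap

theorem sum_triple {M : Type*} [AddCommMonoid M] (F : ℕ → ℕ → ℕ → M) (n : ℕ) :
    (∑ p ∈ antidiagonal n, ∑ q ∈ antidiagonal p.1, F q.1 q.2 p.2) =
      ∑ p ∈ antidiagonal n, ∑ q ∈ antidiagonal p.2, F p.1 q.1 q.2 := by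
  rw [Finset.sum_sigma', Finset.sum_sigma']
  refine Finset.sum_nbij' (fun x => ⟨(x.2.1, x.2.2 + x.1.2), (x.2.2, x.1.2)⟩)
    (fun x => ⟨(x.1.1 + x.2.1, x.2.2), (x.1.1, x.2.1)⟩) ?_ ?_ ?_ ?_ ?_
  · rintro ⟨⟨a, b⟩, ⟨c, d⟩⟩ h
    simp only [mem_sigma, HasAntidiagonal.mem_antidiagonal] at h ⊢
    obtain ⟨h₁, h₂⟩ := h
    exact ⟨by omega, trivial⟩
  · rintro ⟨⟨a, b⟩, ⟨c, d⟩⟩ h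
    simp only [mem_sigma, HasAntidiagonal.mem_antidiagonal] at h ⊢
    obtain ⟨h₁, h₂⟩ := h
    exact ⟨by omega, trivial⟩
  · rintro ⟨⟨a, b⟩, ⟨c, d⟩⟩ h
    simp only [mem_sigma, HasAntidiagonal.mem_antidiagonal] at h
    obtain ⟨-, rfl⟩ := h
    rfl
  · rintro ⟨⟨a, b⟩, ⟨c, d⟩⟩ h
    simp only [mem_sigma, HasAntidiagonal.mem_antidiagonal] at h
    obtain ⟨-, rfl⟩ := h
    rfl
  · rintro ⟨⟨a, b⟩, ⟨c, d⟩⟩ h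
    rfl

theorem sum_triple_left_comm {M : Type*} [AddCommMonoid M] (F : ℕ → ℕ → ℕ → M) (n : ℕ) :
    (∑ p ∈ antidiagonal n, ∑ q ∈ antidiagonal p.2, F p.1 q.1 q.2) =
      ∑ p ∈ antidiagonal n, ∑ q ∈ antidiagonal p.2, F q.1 p.1 q.2 := by
  rw [← sum_triple F, ← sum_triple (fun a b c => F b a c)]
  refine Finset.sum_congr rfl fun p _ => ?_
  rw [← sum_swap]
  rfl

/-! ### Series with coefficients in a Lie algebra, with the convolution bracket -/

/-- Sequences `(f 0, f 1, f 2, …)` of elements of `L`, thought of as formal sums `∑ f m`, where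
`f m` sits in degree `m`. -/
def LieSeries (L : Type v) : Type v := ℕ → L

namespace LieSeries

/-- The formal sum `∑ f m`. -/
def mk {L : Type v} (f : ℕ → L) : LieSeries L := f

instance {L : Type v} : FunLike (LieSeries L) ℕ L where
  coe f := f
  coe_injective _ _ h := h

@[ext] theorem ext {L : Type v} {f g : LieSeries L} (h : ∀ m, f m = g m) : f = g := funext h

@[simp] theorem mk_apply {L : Type v} (f : ℕ → L) (m : ℕ) : mk f m = f m := rfl

variable {k : Type u} [CommRing k] {L : Type v} [LieRing L] [LieAlgebra k L]

instance : AddCommGroup (LieSeries L) := inferInstanceAs (AddCommGroup (ℕ → L))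

instance : Module k (LieSeries L) := inferInstanceAs (Module k (ℕ → L))

@[simp] theorem zero_apply (m : ℕ) : (0 : LieSeries L) m = 0 := rfl

@[simp] theorem add_apply (f g : LieSeries L) (m : ℕ) : (f + g) m = f m + g m := rfl

@[simp] theorem neg_apply (f : LieSeries L) (m : ℕ) : (-f) m = -f m := rfl

@[simp] theorem sub_apply (f g : LieSeries L) (m : ℕ) : (f - g) m = f m - g m := rfl

@[simp] theorem smul_apply (c : k) (f : LieSeries L) (m : ℕ) : (c • f) m = c • f m := rfl

/-- The bracket of formal sums: `[f, g]_m = ∑_{i+j=m} [f_i, g_j]`. -/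
instance : Bracket (LieSeries L) (LieSeries L) where
  bracket f g := mk fun m => ∑ p ∈ antidiagonal m, ⁅f p.1, g p.2⁆

theorem lie_apply (f g : LieSeries L) (m : ℕ) :
    ⁅f, g⁆ m = ∑ p ∈ antidiagonal m, ⁅f p.1, g p.2⁆ := rfl

theorem lie_swap (f g : LieSeries L) : ⁅f, g⁆ = -⁅g, f⁆ := by
  ext m
  rw [neg_apply, lie_apply, lie_apply, ← sum_swap, ← Finset.sum_neg_distrib]
  exact Finset.sum_congr rfl fun p _ => (lie_skew _ _).symm

instance : LieRing (LieSeries L) where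
  add_lie f g h := by
    ext m; simp only [lie_apply, add_apply, add_lie, Finset.sum_add_distrib]
  lie_add f g h := by
    ext m; simp only [lie_apply, add_apply, lie_add, Finset.sum_add_distrib]
  lie_self f := by
    ext m
    rw [lie_apply, zero_apply]
    refine Finset.sum_involution (fun p _ => p.swap) ?_ ?_ ?_ ?_
    · intro p _
      exact (add_eq_zero_iff_eq_neg).2 (lie_skew _ _).symm
    · rintro ⟨a, b⟩ _ h e
      simp only [Prod.swap_prod_mk, Prod.mk.injEq] at e
      obtain ⟨rfl, -⟩ := e
      exact h (lie_self _)
    · intro p hp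
      simpa [add_comm] using hp
    · intro p _
      simp
  leibniz_lie f g h := by
    ext m
    simp only [lie_apply, add_apply, lie_sum, sum_lie]
    rw [sum_triple (fun a b c => ⁅⁅f a, g b⁆, h c⁆) m,
      sum_triple_left_comm (fun a b c => ⁅g a, ⁅f b, h c⁆⁆) m, ← Finset.sum_add_distrib]
    refine Finset.sum_congr rfl fun p _ => ?_
    rw [← Finset.sum_add_distrib]
    exact Finset.sum_congr rfl fun q _ => leibniz_lie _ _ _

instance : LieAlgebra k (LieSeries L) where
  lie_smul c f g := by
    ext m; simp only [lie_apply, smul_apply, lie_smul, Finset.smul_sum]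

end LieSeries

/-! ### Degree completion of a Lie algebra with respect to a set of generators -/

section Completion

variable (k : Type u) [CommRing k] {L : Type v} [LieRing L] [LieAlgebra k L] (S : Set L)

/-- Lie words with `m` letters from `S`. -/
inductive IsLieWord {L : Type v} [LieRing L] (S : Set L) : ℕ → L → Prop
  | letter {s : L} (hs : s ∈ S) : IsLieWord S 1 s
  | bracket {p q : ℕ} {a b : L} (ha : IsLieWord S p a) (hb : IsLieWord S q b) :
      IsLieWord S (p + q) ⁅a, b⁆

/-- The span of the Lie words with `m` letters from `S`. -/
def lieDeg (m : ℕ) : Submodule k L := Submodule.span k {a | IsLieWord S m a}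

variable {S} in
theorem lie_mem_lieDeg {p q : ℕ} {a b : L} (ha : a ∈ lieDeg k S p) (hb : b ∈ lieDeg k S q) :
    ⁅a, b⁆ ∈ lieDeg k S (p + q) := by
  induction ha using Submodule.span_induction with
  | mem a ha =>
    induction hb using Submodule.span_induction with
    | mem b hb => exact Submodule.subset_span (IsLieWord.bracket ha hb)
    | zero => simp
    | add x y _ _ hx hy => rw [lie_add]; exact add_mem hx hy
    | smul c x _ hx => rw [lie_smul]; exact Submodule.smul_mem _ _ hx
  | zero => simp
  | add x y _ _ hx hy => rw [add_lie]; exact add_mem hx hy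
  | smul c x _ hx => rw [smul_lie]; exact Submodule.smul_mem _ _ hx

/-- The degree completion `∏_m L^m`, where `L^m` is the span of the Lie words with `m` letters
from `S` (so `L^0 = 0`). -/
def lieHat : LieSubalgebra k (LieSeries L) where
  carrier := {f | ∀ m, f m ∈ lieDeg k S m}
  add_mem' hf hg m := add_mem (hf m) (hg m)
  zero_mem' _ := zero_mem _
  smul_mem' c _ hf m := Submodule.smul_mem _ c (hf m)
  lie_mem' {f g} hf hg m := by
    rw [LieSeries.lie_apply]
    refine Submodule.sum_mem _ fun p hp => ?_
    rw [← HasAntidiagonal.mem_antidiagonal.1 hp]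
    exact lie_mem_lieDeg k (hf _) (hg _)

variable {k S}

theorem lieHat_ext {f g : lieHat k S} (h : ∀ m, f.1 m = g.1 m) : f = g :=
  Subtype.ext (LieSeries.ext h)

/-- An element of degree one, as an element of the completion. -/
def ofDegOne : lieDeg k S 1 →ₗ[k] lieHat k S where
  toFun a := ⟨LieSeries.mk (Pi.single 1 (a : L)), fun m => by
    by_cases h : m = 1
    · subst h; simp
    · simp [Pi.single_eq_of_ne h]⟩
  map_add' a b := lieHat_ext fun m => congrFun (Pi.single_add (f := fun _ : ℕ => L) 1 _ _) m
  map_smul' c a := lieHat_ext fun m => congrFun (Pi.single_smul (f := fun _ : ℕ => L) 1 c _) m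

end Completion

/-! ### The completed free Lie algebra -/

section Free

variable (k : Type u) [CommRing k] (n : ℕ)

/-- The set of generators `x_1, …, x_n` of the free Lie algebra. -/
def letters : Set (FreeLieAlgebra k (Fin n)) := Set.range (FreeLieAlgebra.of k)

/-- The degree completed free Lie algebra `lie_n = ∏_m lie^m(x_1, …, x_n)`. -/
abbrev lie : LieSubalgebra k (LieSeries (FreeLieAlgebra k (Fin n))) := lieHat k (letters k n)

variable {n}

/-- The generator `x_i`, in the degree one part of the free Lie algebra. -/
def X (i : Fin n) : lieDeg k (letters k n) 1 :=
  ⟨FreeLieAlgebra.of k i, Submodule.subset_span (IsLieWord.letter ⟨i, rfl⟩)⟩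

/-- The generator `x_i` of `lie_n`. -/
def gen (i : Fin n) : lie k n := ofDegOne (X k i)

variable {k}

theorem free_induction {P : ℕ → FreeLieAlgebra k (Fin n) → Prop}
    (of : ∀ i, P 1 (FreeLieAlgebra.of k i))
    (lie : ∀ p q a b, a ∈ lieDeg k (letters k n) p → b ∈ lieDeg k (letters k n) q →
      P p a → P q b → P (p + q) ⁅a, b⁆)
    (zero : ∀ m, P m 0) (add : ∀ m a b, P m a → P m b → P m (a + b))
    (smul : ∀ m (c : k) a, P m a → P m (c • a))
    {m : ℕ} {a : FreeLieAlgebra k (Fin n)} (ha : a ∈ lieDeg k (letters k n) m) : P m a := by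
  induction ha using Submodule.span_induction with
  | mem a ha =>
    induction (show IsLieWord _ _ _ from ha) with
    | letter hs => obtain ⟨i, rfl⟩ := hs; exact of i
    | bracket h₁ h₂ i₁ i₂ =>
      exact lie _ _ _ _ (Submodule.subset_span h₁) (Submodule.subset_span h₂) (i₁ h₁) (i₂ h₂)
  | zero => exact zero _
  | add x y _ _ hx hy => exact add _ _ _ hx hy
  | smul c x _ hx => exact smul _ _ _ hx

variable {L : Type v} [LieRing L] [LieAlgebra k L] {S : Set L}

theorem lift_mem_lieDeg (c : Fin n → lieDeg k S 1) {m : ℕ} {a : FreeLieAlgebra k (Fin n)}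
    (ha : a ∈ lieDeg k (letters k n) m) :
    FreeLieAlgebra.lift k (fun i => (c i : L)) a ∈ lieDeg k S m := by
  refine free_induction (P := fun m a => FreeLieAlgebra.lift k (fun i => (c i : L)) a ∈
    lieDeg k S m) ?_ ?_ ?_ ?_ ?_ ha
  · intro i; rw [FreeLieAlgebra.lift_of_apply]; exact (c i).2
  · intro p q a b _ _ h₁ h₂; rw [LieHom.map_lie]; exact lie_mem_lieDeg k h₁ h₂
  · intro m; rw [map_zero]; exact zero_mem _
  · intro m a b h₁ h₂; rw [map_add]; exact add_mem h₁ h₂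
  · intro m c a h; rw [map_smul]; exact Submodule.smul_mem _ _ h

/-- Substitution `ψ(x_1, …, x_n) ↦ ψ(c_1, …, c_n)` of elements `c_i` of degree one, with values
in the degree completion of the target. -/
def subst (c : Fin n → lieDeg k S 1) : lie k n →ₗ⁅k⁆ lieHat k S where
  toFun f := ⟨LieSeries.mk fun m => FreeLieAlgebra.lift k (fun i => (c i : L)) (f.1 m),
    fun m => lift_mem_lieDeg c (f.2 m)⟩
  map_add' f g := lieHat_ext fun m => map_add (FreeLieAlgebra.lift k _) (f.1 m) (g.1 m)
  map_smul' t f := lieHat_ext fun m => map_smul (FreeLieAlgebra.lift k _) t (f.1 m)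
  map_lie' {f g} := lieHat_ext fun m => by
    change FreeLieAlgebra.lift k _ (∑ p ∈ antidiagonal m, ⁅f.1 p.1, g.1 p.2⁆) =
      ∑ p ∈ antidiagonal m, ⁅FreeLieAlgebra.lift k _ (f.1 p.1), FreeLieAlgebra.lift k _ (g.1 p.2)⁆
    rw [map_sum]
    exact Finset.sum_congr rfl fun p _ => LieHom.map_lie _ _ _

/-! ### Derivations of the free Lie algebra with given values on the generators -/

theorem lieSpan_letters : LieSubalgebra.lieSpan k _ (letters k n) = ⊤ := by
  rw [eq_top_iff]
  intro a _
  let K := LieSubalgebra.lieSpan k (FreeLieAlgebra k (Fin n)) (letters k n)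
  let φ : FreeLieAlgebra k (Fin n) →ₗ⁅k⁆ K :=
    FreeLieAlgebra.lift k fun i => ⟨FreeLieAlgebra.of k i, LieSubalgebra.subset_lieSpan ⟨i, rfl⟩⟩
  have h : K.incl.comp φ = LieHom.id := by
    ext i
    simp [φ]
  have h' := LieHom.congr_fun h a
  have : ((φ a : K) : FreeLieAlgebra k (Fin n)) = a := h'
  rw [← this]
  exact (φ a).2

theorem free_der_ext {D E : LieDerivation k (FreeLieAlgebra k (Fin n)) (FreeLieAlgebra k (Fin n))}
    (h : ∀ i, D (FreeLieAlgebra.of k i) = E (FreeLieAlgebra.of k i)) : D = E :=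
  LieDerivation.ext_of_lieSpan_eq_top (letters k n) lieSpan_letters (by
    rintro _ ⟨i, rfl⟩; exact h i)

theorem free_der_sum {ι : Type*} (s : Finset ι)
    (D : ι → LieDerivation k (FreeLieAlgebra k (Fin n)) (FreeLieAlgebra k (Fin n)))
    (f : FreeLieAlgebra k (Fin n)) : (∑ j ∈ s, D j) f = ∑ j ∈ s, D j f := by
  classical
  induction s using Finset.induction_on with
  | empty => simp
  | insert j s hj ih => rw [sum_insert hj, sum_insert hj, LieDerivation.add_apply, ih]

/-- The homomorphism `x_i ↦ x_i + ε c_i` to series in `ε`. -/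
def freeDerAux (c : Fin n → FreeLieAlgebra k (Fin n)) :
    FreeLieAlgebra k (Fin n) →ₗ⁅k⁆ LieSeries (FreeLieAlgebra k (Fin n)) :=
  FreeLieAlgebra.lift k fun i =>
    LieSeries.mk fun m => if m = 0 then FreeLieAlgebra.of k i else if m = 1 then c i else 0

theorem freeDerAux_zero (c : Fin n → FreeLieAlgebra k (Fin n)) (a : FreeLieAlgebra k (Fin n)) :
    freeDerAux c a 0 = a := by
  let φ : FreeLieAlgebra k (Fin n) →ₗ⁅k⁆ FreeLieAlgebra k (Fin n) :=
    { toFun := fun a => freeDerAux c a 0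
      map_add' := fun a b => by rw [map_add]; rfl
      map_smul' := fun t a => by rw [map_smul]; rfl
      map_lie' := fun {a b} => by
        rw [LieHom.map_lie, LieSeries.lie_apply]
        simp }
  have h : φ = LieHom.id := by
    ext i
    change freeDerAux c (FreeLieAlgebra.of k i) 0 = _
    rw [freeDerAux, FreeLieAlgebra.lift_of_apply]
    rfl
  exact LieHom.congr_fun h a

/-- The derivation of the free Lie algebra with `x_i ↦ c_i`. -/
def freeDer (c : Fin n → FreeLieAlgebra k (Fin n)) :
    LieDerivation k (FreeLieAlgebra k (Fin n)) (FreeLieAlgebra k (Fin n)) where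
  toFun a := freeDerAux c a 1
  map_add' a b := by rw [map_add]; rfl
  map_smul' t a := by rw [map_smul]; rfl
  leibniz' a b := by
    change freeDerAux c ⁅a, b⁆ 1 = ⁅a, freeDerAux c b 1⁆ - ⁅b, freeDerAux c a 1⁆
    rw [LieHom.map_lie, LieSeries.lie_apply, Finset.Nat.antidiagonal_succ]
    simp [freeDerAux_zero, sub_eq_add_neg]

@[simp] theorem freeDer_of (c : Fin n → FreeLieAlgebra k (Fin n)) (i : Fin n) :
    freeDer c (FreeLieAlgebra.of k i) = c i := by
  change freeDerAux c (FreeLieAlgebra.of k i) 1 = _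
  rw [freeDerAux, FreeLieAlgebra.lift_of_apply]
  rfl

theorem freeDer_mem {c : Fin n → FreeLieAlgebra k (Fin n)} {d : ℕ}
    (hc : ∀ i, c i ∈ lieDeg k (letters k n) (d + 1)) {m : ℕ} {a : FreeLieAlgebra k (Fin n)}
    (ha : a ∈ lieDeg k (letters k n) m) : freeDer c a ∈ lieDeg k (letters k n) (d + m) := by
  refine free_induction (P := fun m a => freeDer c a ∈ lieDeg k (letters k n) (d + m))
    ?_ ?_ ?_ ?_ ?_ ha
  · intro i; rw [freeDer_of]; exact hc i
  · intro p q a b ha hb h₁ h₂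
    rw [LieDerivation.apply_lie_eq_add]
    refine add_mem ?_ ?_
    · have := lie_mem_lieDeg k ha h₂
      rwa [show p + (d + q) = d + (p + q) by ring] at this
    · have := lie_mem_lieDeg k h₁ hb
      rwa [show d + p + q = d + (p + q) by ring] at this
  · intro m; rw [map_zero]; exact zero_mem _
  · intro m a b h₁ h₂; rw [map_add]; exact add_mem h₁ h₂
  · intro m c a h; rw [map_smul]; exact Submodule.smul_mem _ _ h

/-! ### Tangential derivations -/

/-- The part of degree `d` of the tangential derivation `x_i ↦ [x_i, a_i]`. -/
def tderPart (a : Fin n → lie k n) (d : ℕ) :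
    LieDerivation k (FreeLieAlgebra k (Fin n)) (FreeLieAlgebra k (Fin n)) :=
  freeDer fun i => ⁅FreeLieAlgebra.of k i, (a i).1 d⁆

theorem tderPart_of (a : Fin n → lie k n) (d : ℕ) (i : Fin n) :
    tderPart a d (FreeLieAlgebra.of k i) = ⁅FreeLieAlgebra.of k i, (a i).1 d⁆ := freeDer_of _ _

theorem tderPart_mem (a : Fin n → lie k n) (d : ℕ) {m : ℕ} {f : FreeLieAlgebra k (Fin n)}
    (hf : f ∈ lieDeg k (letters k n) m) : tderPart a d f ∈ lieDeg k (letters k n) (d + m) :=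
  freeDer_mem (fun i => by
    rw [add_comm]; exact lie_mem_lieDeg k (X k i).2 ((a i).2 d)) hf

/-- The Lie algebra `der_n` of derivations of `lie_n`. -/
abbrev Der (k : Type u) [CommRing k] (n : ℕ) : Type u := LieDerivation k (lie k n) (lie k n)

/-- The tangential derivation `u = (a_1, …, a_n)` of `lie_n`, `u(x_i) = [x_i, a_i]`. -/
def tderOf (a : Fin n → lie k n) : Der k n where
  toFun f := ⟨LieSeries.mk fun m => ∑ p ∈ antidiagonal m, tderPart a p.1 (f.1 p.2),
    fun m => Submodule.sum_mem _ fun p hp => by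
    rw [← HasAntidiagonal.mem_antidiagonal.1 hp]
    exact tderPart_mem a _ (f.2 _)⟩
  map_add' f g := lieHat_ext fun m => by
    change ∑ p ∈ antidiagonal m, tderPart a p.1 (f.1 p.2 + g.1 p.2) =
      (∑ p ∈ antidiagonal m, tderPart a p.1 (f.1 p.2)) +
        ∑ p ∈ antidiagonal m, tderPart a p.1 (g.1 p.2)
    simp only [map_add, Finset.sum_add_distrib]
  map_smul' t f := lieHat_ext fun m => by
    change ∑ p ∈ antidiagonal m, tderPart a p.1 (t • f.1 p.2) =
      t • ∑ p ∈ antidiagonal m, tderPart a p.1 (f.1 p.2)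
    simp only [map_smul, Finset.smul_sum]
  leibniz' f g := lieHat_ext fun m => by
    change ∑ p ∈ antidiagonal m, tderPart a p.1 (∑ q ∈ antidiagonal p.2, ⁅f.1 q.1, g.1 q.2⁆) =
      (∑ p ∈ antidiagonal m, ⁅f.1 p.1, ∑ q ∈ antidiagonal p.2, tderPart a q.1 (g.1 q.2)⁆) -
        ∑ p ∈ antidiagonal m, ⁅g.1 p.1, ∑ q ∈ antidiagonal p.2, tderPart a q.1 (f.1 q.2)⁆
    simp only [map_sum, LieDerivation.apply_lie_eq_sub, lie_sum, Finset.sum_sub_distrib]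
    congr 1
    · exact sum_triple_left_comm (fun a' b c => ⁅f.1 b, tderPart a a' (g.1 c)⁆) m
    · rw [← sum_triple_left_comm (fun a' b c => ⁅g.1 b, tderPart a a' (f.1 c)⁆) m]
      refine Finset.sum_congr rfl fun p _ => ?_
      rw [← sum_swap]
      rfl

theorem tderOf_apply (a : Fin n → lie k n) (f : lie k n) (m : ℕ) :
    (tderOf a f).1 m = ∑ p ∈ antidiagonal m, tderPart a p.1 (f.1 p.2) := rfl

theorem tderPart_add (a b : Fin n → lie k n) (d : ℕ) :
    tderPart (a + b) d = tderPart a d + tderPart b d :=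
  free_der_ext fun i => by
    rw [LieDerivation.add_apply, tderPart_of, tderPart_of, tderPart_of, ← lie_add]; rfl

theorem tderPart_smul (t : k) (a : Fin n → lie k n) (d : ℕ) :
    tderPart (t • a) d = t • tderPart a d :=
  free_der_ext fun i => by
    rw [LieDerivation.smul_apply, tderPart_of, tderPart_of, ← lie_smul]; rfl

/-- The linear map sending a tuple `(a_1, …, a_n)` to the tangential derivation
`x_i ↦ [x_i, a_i]` of `lie_n`. -/
def tder : (Fin n → lie k n) →ₗ[k] Der k n where
  toFun := tderOf
  map_add' a b := LieDerivation.ext fun f => lieHat_ext fun m => by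
    change (tderOf (a + b) f).1 m = (tderOf a f).1 m + (tderOf b f).1 m
    simp only [tderOf_apply, tderPart_add, LieDerivation.add_apply, Finset.sum_add_distrib]
  map_smul' t a := LieDerivation.ext fun f => lieHat_ext fun m => by
    change (tderOf (t • a) f).1 m = t • (tderOf a f).1 m
    simp only [tderOf_apply, tderPart_smul, LieDerivation.smul_apply, Finset.smul_sum]

theorem tder_apply (a : Fin n → lie k n) (f : lie k n) (m : ℕ) :
    (tder a f).1 m = ∑ p ∈ antidiagonal m, tderPart a p.1 (f.1 p.2) := rfl

theorem tder_gen (a : Fin n → lie k n) (i : Fin n) : tder a (gen k i) = ⁅gen k i, a i⁆ :=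
  lieHat_ext fun m => by
    change ∑ p ∈ antidiagonal m, tderPart a p.1 ((gen k i).1 p.2) =
      ∑ p ∈ antidiagonal m, ⁅(gen k i).1 p.1, (a i).1 p.2⁆
    rw [← sum_swap]
    refine Finset.sum_congr rfl fun p _ => ?_
    change tderPart a p.2 ((Pi.single 1 (FreeLieAlgebra.of k i) : ℕ → _) p.1) =
      ⁅(Pi.single 1 (FreeLieAlgebra.of k i) : ℕ → FreeLieAlgebra k (Fin n)) p.1, (a i).1 p.2⁆
    by_cases h : p.1 = 1
    · rw [h, Pi.single_eq_same, tderPart_of]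
    · rw [Pi.single_eq_of_ne h, map_zero, zero_lie]

/-- The commutator of tangential derivations in terms of tuples. -/
theorem lie_tder (a b : Fin n → lie k n) :
    ⁅tder a, tder b⁆ = tder fun i => tder a (b i) - tder b (a i) + ⁅a i, b i⁆ := by
  have key : ∀ d, tderPart (fun i => tder a (b i) - tder b (a i) + ⁅a i, b i⁆) d =
      ∑ p ∈ antidiagonal d, ⁅tderPart a p.1, tderPart b p.2⁆ := by
    intro d
    refine free_der_ext fun i => ?_
    rw [tderPart_of]
    rw [free_der_sum]
    have h₂ : (tder b (a i)).1 d = ∑ p ∈ antidiagonal d, tderPart b p.2 ((a i).1 p.1) := by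
      rw [tder_apply, ← sum_swap]; rfl
    change ⁅_, (tder a (b i)).1 d - (tder b (a i)).1 d + ⁅(a i).1, (b i).1⁆ d⁆ = _
    rw [h₂, tder_apply, LieSeries.lie_apply, ← Finset.sum_sub_distrib, ← Finset.sum_add_distrib,
      lie_sum]
    refine Finset.sum_congr rfl fun p _ => ?_
    rw [LieDerivation.lie_apply, tderPart_of, tderPart_of, LieDerivation.apply_lie_eq_add,
      LieDerivation.apply_lie_eq_add, tderPart_of, tderPart_of, lie_add, lie_sub,
      leibniz_lie (FreeLieAlgebra.of k i) ((a i).1 p.1),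
      ← lie_skew ⁅FreeLieAlgebra.of k i, (b i).1 p.2⁆ ((a i).1 p.1)]
    abel
  refine LieDerivation.ext fun f => lieHat_ext fun m => ?_
  rw [tder_apply, LieDerivation.lie_apply]
  change (tder a (tder b f)).1 m - (tder b (tder a f)).1 m = _
  simp only [key, tder_apply, map_sum]
  rw [sum_triple_left_comm (fun p q r => tderPart b p (tderPart a q (f.1 r))) m,
    ← sum_triple (fun p q r => tderPart a p (tderPart b q (f.1 r))) m,
    ← sum_triple (fun p q r => tderPart b q (tderPart a p (f.1 r))) m, ← Finset.sum_sub_distrib]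
  refine Finset.sum_congr rfl fun p _ => ?_
  rw [free_der_sum, ← Finset.sum_sub_distrib]
  exact Finset.sum_congr rfl fun q _ => (LieDerivation.lie_apply _ _ _).symm

end Free

/-! ### The Ihara bracket -/

section Ihara

variable (k : Type u) [CommRing k]

/-- The vector space `lie_2`, as the carrier of the Ihara bracket. -/
def Ihara : Type u := lie k 2

instance : AddCommGroup (Ihara k) := inferInstanceAs (AddCommGroup (lie k 2))

instance : Module k (Ihara k) := inferInstanceAs (Module k (lie k 2))

variable {k}

/-- The identity map, from the Lie algebra with the Ihara bracket to the vector space `lie_2`. -/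
def Ihara.toLie : Ihara k ≃ₗ[k] lie k 2 := LinearEquiv.refl k (lie k 2)

/-- The tangential derivation `(0, ψ)` of `lie_2`: `x ↦ 0`, `y ↦ [y, ψ]`. -/
def iharaDer (ψ : lie k 2) : Der k 2 := tder ![0, ψ]

/-- The Ihara bracket `[ψ, φ]_Ih = (0, ψ)(φ) - (0, φ)(ψ) + [ψ, φ]`. -/
def iharaBracket (ψ φ : lie k 2) : lie k 2 := iharaDer ψ φ - iharaDer φ ψ + ⁅ψ, φ⁆

theorem iharaDer_add (ψ φ : lie k 2) : iharaDer (ψ + φ) = iharaDer ψ + iharaDer φ := by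
  rw [iharaDer, iharaDer, iharaDer, ← map_add]
  simp

theorem iharaDer_smul (t : k) (ψ : lie k 2) : iharaDer (t • ψ) = t • iharaDer ψ := by
  rw [iharaDer, iharaDer, ← map_smul]
  simp

theorem iharaDer_bracket (ψ φ : lie k 2) :
    iharaDer (iharaBracket ψ φ) = ⁅iharaDer ψ, iharaDer φ⁆ := by
  rw [iharaDer, iharaDer, iharaDer, lie_tder]
  congr 1
  ext1 i
  fin_cases i
  · simp
  · rfl

instance : Bracket (Ihara k) (Ihara k) := ⟨fun ψ φ => (iharaBracket (k := k) ψ φ : lie k 2)⟩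

theorem Ihara.toLie_lie (ψ φ : Ihara k) :
    Ihara.toLie ⁅ψ, φ⁆ = iharaBracket (Ihara.toLie ψ) (Ihara.toLie φ) := rfl

instance : LieRing (Ihara k) where
  add_lie (f g h : lie k 2) := by
    change iharaBracket (f + g) h = iharaBracket f h + iharaBracket g h
    simp only [iharaBracket, iharaDer_add, LieDerivation.add_apply, map_add, add_lie]
    abel
  lie_add (f g h : lie k 2) := by
    change iharaBracket f (g + h) = iharaBracket f g + iharaBracket f h
    simp only [iharaBracket, iharaDer_add, LieDerivation.add_apply, map_add, lie_add]
    abel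
  lie_self (f : lie k 2) := by
    change iharaBracket f f = 0
    simp [iharaBracket]
  leibniz_lie (f g h : lie k 2) := by
    change iharaBracket f (iharaBracket g h) =
      iharaBracket (iharaBracket f g) h + iharaBracket g (iharaBracket f h)
    have e₁ := LieDerivation.congr_fun (iharaDer_bracket g h) f
    have e₂ := LieDerivation.congr_fun (iharaDer_bracket f g) h
    have e₃ := LieDerivation.congr_fun (iharaDer_bracket f h) g
    have e : ∀ a b : lie k 2, iharaBracket a b = iharaDer a b - iharaDer b a + ⁅a, b⁆ :=
      fun _ _ => rfl
    rw [e f (iharaBracket g h), e (iharaBracket f g) h, e g (iharaBracket f h), e₁, e₂, e₃]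
    simp only [iharaBracket, LieDerivation.lie_apply, map_add, map_sub,
      LieDerivation.apply_lie_eq_add, lie_add, lie_sub, add_lie, sub_lie]
    rw [leibniz_lie f g h, ← lie_skew (iharaDer h f) g, ← lie_skew (iharaDer g f) h]
    abel

instance : LieAlgebra k (Ihara k) where
  lie_smul t (f g : lie k 2) := by
    change iharaBracket f (t • g) = t • iharaBracket f g
    simp only [iharaBracket, iharaDer_smul, LieDerivation.smul_apply, map_smul, lie_smul,
      smul_add, smul_sub]

end Ihara

/-! ### The Lie algebra `t_n` of infinitesimal braids -/

section Braids

variable (k : Type u) [CommRing k] (n : ℕ)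

/-- The generator with index `(i, j)` of the free Lie algebra on pairs of indices. -/
def pairGen {n : ℕ} (i j : Fin n) : FreeLieAlgebra k (Fin n × Fin n) :=
  FreeLieAlgebra.of k (i, j)

/-- The defining relations of `t_n`. The first two say that there is one generator
`t^{i,j} = t^{j,i}` for each pair of distinct indices. -/
inductive BraidRel : FreeLieAlgebra k (Fin n × Fin n) → Prop
  | diag (i : Fin n) : BraidRel (pairGen k i i)
  | symm (i j : Fin n) : BraidRel (pairGen k i j - pairGen k j i)
  | comm (i j p q : Fin n) (h₁ : p ≠ i) (h₂ : p ≠ j) (h₃ : q ≠ i) (h₄ : q ≠ j) :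
      BraidRel ⁅pairGen k i j, pairGen k p q⁆
  | triple (i j l : Fin n) (h₁ : i ≠ j) (h₂ : i ≠ l) (h₃ : j ≠ l) :
      BraidRel ⁅pairGen k i j + pairGen k i l, pairGen k j l⁆

/-- The ideal generated by the defining relations of `t_n`. -/
def braidIdeal : LieIdeal k (FreeLieAlgebra k (Fin n × Fin n)) :=
  LieSubmodule.lieSpan k _ {a | BraidRel k n a}

/-- The Lie algebra `t_n`, with generators `t^{i,j} = t^{j,i}` for `i ≠ j` and relations
`[t^{i,j}, t^{p,q}] = 0` for `p, q ≠ i, j` and `[t^{i,j} + t^{i,l}, t^{j,l}] = 0` for distinct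
`i, j, l`. -/
abbrev Braid : Type u := FreeLieAlgebra k (Fin n × Fin n) ⧸ braidIdeal k n

variable {n}

/-- The generator `t^{i,j}` of `t_n` (and `0` for `i = j`). -/
def braidGen (i j : Fin n) : Braid k n := LieSubmodule.Quotient.mk (pairGen k i j)

variable (n) in
/-- The set of generators of `t_n`. -/
def braidGens : Set (Braid k n) := {a | ∃ i j : Fin n, i ≠ j ∧ a = braidGen k i j}

/-- The element `t^{i,j}`, for distinct `i` and `j`, in the degree one part of `t_n`. -/
def tGen {n : ℕ} (i j : Fin n) (h : i ≠ j := by decide) : lieDeg k (braidGens k n) 1 :=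
  ⟨braidGen k i j, Submodule.subset_span (IsLieWord.letter ⟨i, j, h, rfl⟩)⟩

/-- The generator `t^{i,j}` of `t_4`. -/
abbrev t4 (i j : Fin 4) (h : i ≠ j := by decide) : lieDeg k (braidGens k 4) 1 := tGen k i j h

/-- The degree completion of `t_n`. -/
abbrev braidHat (n : ℕ) : LieSubalgebra k (LieSeries (Braid k n)) := lieHat k (braidGens k n)

/-- `ψ(a, b)` for elements `a`, `b` of degree one. -/
def ev {k : Type u} [CommRing k] {L : Type v} [LieRing L] [LieAlgebra k L] {S : Set L}
    (ψ : lie k 2) (a b : lieDeg k S 1) : lieHat k S := subst ![a, b] ψ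

/-- The generator `x` of the free Lie algebra in two generators. -/
abbrev degX : lieDeg k (letters k 2) 1 := X k 0

/-- The generator `y` of the free Lie algebra in two generators. -/
abbrev degY : lieDeg k (letters k 2) 1 := X k 1

/-- The defining equations of the Grothendieck-Teichmueller Lie algebra: antisymmetry, the
hexagon equation in `lie_2` and the pentagon equation in the completion of `t_4` (where the
indices `1, 2, 3, 4` are written `0, 1, 2, 3`). -/
structure IsGRT {k : Type u} [CommRing k] (ψ : lie k 2) : Prop where
  antisymm : ψ = -ev ψ (degY k) (degX k)
  hexagon : ev ψ (degX k) (degY k) + ev ψ (degY k) (-degX k - degY k) +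
    ev ψ (-degX k - degY k) (degX k) = 0
  pentagon : ev ψ (t4 k 0 1) (t4 k 1 2 + t4 k 1 3) + ev ψ (t4 k 0 2 + t4 k 1 2) (t4 k 2 3) =
    ev ψ (t4 k 1 2) (t4 k 2 3) + ev ψ (t4 k 0 1 + t4 k 0 2) (t4 k 1 3 + t4 k 2 3) +
      ev ψ (t4 k 0 1) (t4 k 1 2)

/-- The tangential derivation `ν(ψ) = (ψ(-x-y, x), ψ(-x-y, y))` of `lie_2`. -/
def nu {k : Type u} [CommRing k] (ψ : lie k 2) : Der k 2 :=
  tder ![ev ψ (-degX k - degY k) (degX k), ev ψ (-degX k - degY k) (degY k)]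

end Braids

/-! ### The completed free associative algebra -/

section Ass

variable (k : Type u) [CommRing k] (n : ℕ)

/-- The span of the words with `m` letters in the free associative algebra. -/
def assDeg (m : ℕ) : Submodule k (FreeAlgebra k (Fin n)) :=
  Submodule.span k {w | ∃ l : List (Fin n), l.length = m ∧ w = (l.map (FreeAlgebra.ι k)).prod}

variable {k n} in
theorem mul_mem_assDeg {p q : ℕ} {a b : FreeAlgebra k (Fin n)} (ha : a ∈ assDeg k n p)
    (hb : b ∈ assDeg k n q) : a * b ∈ assDeg k n (p + q) := by
  induction ha using Submodule.span_induction with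
  | mem a ha =>
    induction hb using Submodule.span_induction with
    | mem b hb =>
      obtain ⟨l, rfl, rfl⟩ := ha
      obtain ⟨l', rfl, rfl⟩ := hb
      exact Submodule.subset_span ⟨l ++ l', by simp, by simp⟩
    | zero => simp
    | add x y _ _ hx hy => rw [mul_add]; exact add_mem hx hy
    | smul c x _ hx => rw [mul_smul_comm]; exact Submodule.smul_mem _ _ hx
  | zero => simp
  | add x y _ _ hx hy => rw [add_mul]; exact add_mem hx hy
  | smul c x _ hx => rw [smul_mul_assoc]; exact Submodule.smul_mem _ _ hx

/-- The completed free associative algebra `Ass_n = ∏_m Ass^m(x_1, …, x_n)`. -/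
def assHat : Submodule k (ℕ → FreeAlgebra k (Fin n)) where
  carrier := {f | ∀ m, f m ∈ assDeg k n m}
  add_mem' hf hg m := add_mem (hf m) (hg m)
  zero_mem' _ := zero_mem _
  smul_mem' c _ hf m := Submodule.smul_mem _ c (hf m)

variable {k n}

/-- The product of `Ass_n`. -/
def assMul (f g : assHat k n) : assHat k n :=
  ⟨fun m => ∑ p ∈ antidiagonal m, f.1 p.1 * g.1 p.2, fun m => Submodule.sum_mem _ fun p hp => by
    rw [← HasAntidiagonal.mem_antidiagonal.1 hp]
    exact mul_mem_assDeg (f.2 _) (g.2 _)⟩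

variable (k) in
/-- The generator `x_i`, in the degree one part of the free associative algebra. -/
def assX (i : Fin n) : assDeg k n 1 :=
  ⟨FreeAlgebra.ι k i, Submodule.subset_span ⟨[i], rfl, by simp⟩⟩

variable (k) in
/-- The generator `x_i` of `Ass_n`. -/
def assGen (i : Fin n) : assHat k n :=
  ⟨Pi.single 1 (FreeAlgebra.ι k i), fun m => by
    by_cases h : m = 1
    · subst h; rw [Pi.single_eq_same]; exact (assX k i).2
    · rw [Pi.single_eq_of_ne h]; exact zero_mem _⟩

section ToAss

attribute [local instance 100] LieRing.ofAssociativeRing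

/-- The Lie homomorphism from the free Lie algebra to the free associative algebra with
`x_i ↦ x_i`. -/
def toAss : FreeLieAlgebra k (Fin n) →ₗ⁅k⁆ FreeAlgebra k (Fin n) :=
  FreeLieAlgebra.lift k (FreeAlgebra.ι k)

theorem toAss_mem {m : ℕ} {a : FreeLieAlgebra k (Fin n)} (ha : a ∈ lieDeg k (letters k n) m) :
    toAss a ∈ assDeg k n m := by
  refine free_induction (P := fun m a => toAss a ∈ assDeg k n m) ?_ ?_ ?_ ?_ ?_ ha
  · intro i; rw [toAss, FreeLieAlgebra.lift_of_apply]; exact (assX k i).2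
  · intro p q a b _ _ h₁ h₂
    rw [LieHom.map_lie, LieRing.of_associative_ring_bracket]
    refine sub_mem (mul_mem_assDeg h₁ h₂) ?_
    rw [add_comm]
    exact mul_mem_assDeg h₂ h₁
  · intro m; rw [map_zero]; exact zero_mem _
  · intro m a b h₁ h₂; rw [map_add]; exact add_mem h₁ h₂
  · intro m c a h; rw [map_smul]; exact Submodule.smul_mem _ _ h

/-- The coefficient of `x_i` in an element of the free Lie algebra. -/
def linCoeff (i : Fin n) : FreeLieAlgebra k (Fin n) →ₗ⁅k⁆ k :=
  FreeLieAlgebra.lift k (Pi.single i 1 : Fin n → k)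

end ToAss

/-- The embedding of `lie_n` into `Ass_n = U(lie_n)`. -/
def toAssHat : lie k n →ₗ[k] assHat k n where
  toFun f := ⟨fun m => toAss (f.1 m), fun m => toAss_mem (f.2 m)⟩
  map_add' f g := Subtype.ext (funext fun m => map_add toAss (f.1 m) (g.1 m))
  map_smul' c f := Subtype.ext (funext fun m => map_smul toAss c (f.1 m))

/-- The projection `p_i : lie_n → k` sending `∑ λ_j x_j + (multibrackets)` to `λ_i`. -/
def proj (i : Fin n) (f : lie k n) : k := linCoeff i (f.1 1)

/-- The value of `∂_i` on a word: `∂_i (w x_i) = w`, and `∂_i` vanishes on the empty word and on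
the words that end in another letter. -/
def partialWord (i : Fin n) (w : List (Fin n)) : FreeAlgebra k (Fin n) :=
  if w.getLast? = some i then (w.dropLast.map (FreeAlgebra.ι k)).prod else 0

/-- The operator `∂_i` on the free associative algebra. -/
def partialOp (i : Fin n) : FreeAlgebra k (Fin n) →ₗ[k] FreeAlgebra k (Fin n) :=
  (FreeAlgebra.basisFreeMonoid k (Fin n)).constr k fun w => partialWord i w.toList

theorem basis_eq (w : List (Fin n)) :
    FreeAlgebra.basisFreeMonoid k (Fin n) (FreeMonoid.ofList w) =
      (w.map (FreeAlgebra.ι k)).prod := by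
  apply FreeAlgebra.equivMonoidAlgebraFreeMonoid.injective
  rw [show FreeAlgebra.equivMonoidAlgebraFreeMonoid (FreeAlgebra.basisFreeMonoid k (Fin n)
    (FreeMonoid.ofList w)) = MonoidAlgebra.single (FreeMonoid.ofList w) 1 by
      simp [FreeAlgebra.basisFreeMonoid]]
  induction w with
  | nil => simp [MonoidAlgebra.one_def]
  | cons i w ih =>
    rw [List.map_cons, List.prod_cons, map_mul, ← ih, FreeMonoid.ofList_cons,
      FreeAlgebra.equivMonoidAlgebraFreeMonoid]
    simp [MonoidAlgebra.single_mul_single]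

theorem partialOp_word (i : Fin n) (w : List (Fin n)) :
    partialOp i (w.map (FreeAlgebra.ι k)).prod = partialWord i w := by
  rw [← basis_eq, partialOp, Module.Basis.constr_basis]
  rfl

theorem partialOp_mem (i : Fin n) {m : ℕ} {a : FreeAlgebra k (Fin n)}
    (ha : a ∈ assDeg k n (m + 1)) : partialOp i a ∈ assDeg k n m := by
  induction ha using Submodule.span_induction with
  | mem a ha =>
    obtain ⟨l, hl, rfl⟩ := ha
    rw [partialOp_word, partialWord]
    split_ifs
    · exact Submodule.subset_span ⟨l.dropLast, by simp [hl], rfl⟩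
    · exact zero_mem _
  | zero => simp
  | add x y _ _ hx hy => rw [map_add]; exact add_mem hx hy
  | smul c x _ hx => rw [map_smul]; exact Submodule.smul_mem _ _ hx

/-- The operators `∂_i` give the unique decomposition `a = a_0 + ∑_i (∂_i a) x_i`. -/
theorem partialOp_decomp (a : FreeAlgebra k (Fin n)) :
    a = algebraMap k _ (FreeAlgebra.algebraMapInv a) +
      ∑ i, partialOp i a * FreeAlgebra.ι k i := by
  let A : FreeAlgebra k (Fin n) →ₗ[k] FreeAlgebra k (Fin n) :=
    (Algebra.linearMap k _) ∘ₗ (FreeAlgebra.algebraMapInv (R := k) (X := Fin n)).toLinearMap +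
      ∑ i, (LinearMap.mulRight k (FreeAlgebra.ι k i)) ∘ₗ partialOp i
  have h : LinearMap.id = A := by
    refine (FreeAlgebra.basisFreeMonoid k (Fin n)).ext fun w => ?_
    obtain ⟨w, rfl⟩ := FreeMonoid.ofList.surjective w
    rw [basis_eq]
    simp only [A, LinearMap.add_apply, LinearMap.sum_apply, LinearMap.comp_apply,
      LinearMap.mulRight_apply, partialOp_word, LinearMap.id_apply]
    induction w using List.reverseRecOn with
    | nil => simp [partialWord]
    | append_singleton w i _ => simp [partialWord, FreeAlgebra.algebraMapInv, ite_mul]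
  have := LinearMap.congr_fun h a
  simpa [A, LinearMap.sum_apply] using this

/-- The operator `∂_i` on `Ass_n`. -/
def assPartial (i : Fin n) (f : assHat k n) : assHat k n :=
  ⟨fun m => partialOp i (f.1 (m + 1)), fun m => partialOp_mem i (f.2 (m + 1))⟩

/-! ### The space `tr_n` -/

variable (k n) in
/-- `Ass_n^+ = ∏_{m ≥ 1} Ass^m(x_1, …, x_n)`, the series without constant term. -/
def assPlus : Submodule k (ℕ → FreeAlgebra k (Fin n)) where
  carrier := {f | f 0 = 0 ∧ ∀ m, f m ∈ assDeg k n m}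
  add_mem' {f g} hf hg := ⟨by rw [Pi.add_apply, hf.1, hg.1, add_zero],
    fun m => add_mem (hf.2 m) (hg.2 m)⟩
  zero_mem' := ⟨rfl, fun _ => zero_mem _⟩
  smul_mem' c f hf := ⟨by rw [Pi.smul_apply, hf.1, smul_zero],
    fun m => Submodule.smul_mem _ c (hf.2 m)⟩

variable (k n) in
/-- The subspace of `Ass_n^+` spanned by the commutators `ab - ba` with `a, b ∈ Ass_n`. -/
def commSpan : Submodule k (assPlus k n) :=
  Submodule.span k {c | ∃ a b : assHat k n, c.1 = (assMul a b).1 - (assMul b a).1}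

variable (k n) in
/-- The space `tr_n = Ass_n^+ / ⟨ab - ba⟩`. -/
abbrev tr : Type u := assPlus k n ⧸ commSpan k n

/-- The projection `Ass_n → Ass_n^+` that drops the constant term. -/
def dropConst : assHat k n →ₗ[k] assPlus k n where
  toFun f := ⟨fun m => if m = 0 then 0 else f.1 m, if_pos rfl, fun m => by
    dsimp only
    split_ifs
    · exact zero_mem _
    · exact f.2 m⟩
  map_add' f g := Subtype.ext <| funext fun m => by
    change (if m = 0 then 0 else f.1 m + g.1 m) =
      (if m = 0 then 0 else f.1 m) + (if m = 0 then 0 else g.1 m)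
    split_ifs <;> simp
  map_smul' c f := Subtype.ext <| funext fun m => by
    change (if m = 0 then 0 else c • f.1 m) = c • (if m = 0 then 0 else f.1 m)
    split_ifs <;> simp

/-- The natural projection `Tr : Ass_n → tr_n`. -/
def Tr : assHat k n →ₗ[k] tr k n := (commSpan k n).mkQ ∘ₗ dropConst

/-- The divergence `∑_i Tr(x_i (∂_i a_i))` of a tuple `(a_1, …, a_n)`. -/
def div (a : Fin n → lie k n) : tr k n :=
  ∑ i, Tr (assMul (assGen k i) (assPartial i (toAssHat (a i))))

variable {n' : ℕ}

theorem lift_mem_assDeg (c : Fin n → assDeg k n' 1) {m : ℕ} {a : FreeAlgebra k (Fin n)}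
    (ha : a ∈ assDeg k n m) :
    FreeAlgebra.lift k (fun i => (c i : FreeAlgebra k (Fin n'))) a ∈ assDeg k n' m := by
  induction ha using Submodule.span_induction with
  | mem a ha =>
    obtain ⟨l, rfl, rfl⟩ := ha
    induction l with
    | nil => exact Submodule.subset_span ⟨[], rfl, by simp⟩
    | cons i l ih =>
      rw [List.map_cons, List.prod_cons, map_mul, FreeAlgebra.lift_ι_apply, List.length_cons,
        add_comm]
      exact mul_mem_assDeg (c i).2 ih
  | zero => simp
  | add x y _ _ hx hy => rw [map_add]; exact add_mem hx hy
  | smul c x _ hx => rw [map_smul]; exact Submodule.smul_mem _ _ hx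

/-- Substitution `f(x_1, …, x_n) ↦ f(c_1, …, c_n)` in `Ass_n`, for `c_i` of degree one. -/
def assSubst (c : Fin n → assDeg k n' 1) : assHat k n →ₗ[k] assHat k n' where
  toFun f := ⟨fun m => FreeAlgebra.lift k (fun i => (c i : FreeAlgebra k (Fin n'))) (f.1 m),
    fun m => lift_mem_assDeg c (f.2 m)⟩
  map_add' f g := Subtype.ext <| funext fun m => map_add (FreeAlgebra.lift k _) (f.1 m) (g.1 m)
  map_smul' t f := Subtype.ext <| funext fun m => map_smul (FreeAlgebra.lift k _) t (f.1 m)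

theorem assSubst_mul (c : Fin n → assDeg k n' 1) (f g : assHat k n) :
    assSubst c (assMul f g) = assMul (assSubst c f) (assSubst c g) :=
  Subtype.ext <| funext fun m => by
    change FreeAlgebra.lift k _ (∑ p ∈ antidiagonal m, f.1 p.1 * g.1 p.2) = _
    rw [map_sum]
    exact Finset.sum_congr rfl fun p _ => map_mul _ _ _

/-- Substitution in `Ass_n^+`. -/
def assPlusSubst (c : Fin n → assDeg k n' 1) : assPlus k n →ₗ[k] assPlus k n' where
  toFun f := ⟨fun m => FreeAlgebra.lift k (fun i => (c i : FreeAlgebra k (Fin n'))) (f.1 m),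
    by dsimp only; rw [f.2.1, map_zero], fun m => lift_mem_assDeg c (f.2.2 m)⟩
  map_add' f g := Subtype.ext <| funext fun m => map_add (FreeAlgebra.lift k _) (f.1 m) (g.1 m)
  map_smul' t f := Subtype.ext <| funext fun m => map_smul (FreeAlgebra.lift k _) t (f.1 m)

/-- Substitution `f(x_1, …, x_n) ↦ f(c_1, …, c_n)` in `tr_n`, for `c_i` of degree one. -/
def trSubst (c : Fin n → assDeg k n' 1) : tr k n →ₗ[k] tr k n' :=
  (commSpan k n).mapQ (commSpan k n') (assPlusSubst c) (by
    rw [commSpan, Submodule.span_le]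
    rintro f ⟨a, b, h⟩
    refine Submodule.subset_span ⟨assSubst c a, assSubst c b, ?_⟩
    rw [← assSubst_mul, ← assSubst_mul]
    funext m
    have := congrArg (FreeAlgebra.lift k fun i => (c i : FreeAlgebra k (Fin n'))) (congrFun h m)
    rw [Pi.sub_apply, map_sub] at this
    exact this)

/-- The differential `δ : tr_2 → tr_3`,
`(δf)(x, y, z) = f(y, z) - f(x + y, z) + f(x, y + z) - f(x, y)`. -/
def delta (f : tr k 2) : tr k 3 :=
  trSubst ![assX k 1, assX k 2] f - trSubst ![assX k 0 + assX k 1, assX k 2] f +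
    trSubst ![assX k 0, assX k 1 + assX k 2] f - trSubst ![assX k 0, assX k 1] f

/-- A tuple `(a_1, …, a_n)` is normalized if `p_i(a_i) = 0` for all `i`. Every tangential
derivation is given by exactly one normalized tuple. -/
def IsNormalized (a : Fin n → lie k n) : Prop := ∀ i, proj i (a i) = 0

/-- The derivation `u` of `lie_n` is special: it is tangential and `u(x_1 + … + x_n) = 0`. -/
def IsSpecial (u : Der k n) : Prop :=
  (∃ a : Fin n → lie k n, ∀ i, u (gen k i) = ⁅gen k i, a i⁆) ∧ u (∑ i, gen k i) = 0

/-- The extended Kashiwara-Vergne Lie algebra: the special derivations of `lie_2` whose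
divergence lies in the kernel of `δ : tr_2 → tr_3`. -/
def IsHKV (u : Der k 2) : Prop :=
  IsSpecial u ∧ ∃ a : Fin 2 → lie k 2, IsNormalized a ∧ u = tder a ∧ delta (div a) = 0

end Ass

end

end KashiwaraVergne

namespace KashiwaraVergne

open Finset

noncomputable section

universe u v w

/-! ### Homomorphisms and derivations on the free Lie algebra -/

section Generalities

variable {k : Type u} [CommRing k] {n : ℕ} {L : Type v} [LieRing L] [LieAlgebra k L]

/-! All equations are homogeneous, so they are treated one degree at a time on Lie polynomials. A
solution ψ has no component of degree one (`eq_zero_of_pentagon`). In the other degrees a Lie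
polynomial that commutes with a generator vanishes (`eq_zero_of_lie_of_eq_zero`), so a tangential
derivation determines its tuple.

The pentagon is read through the action of t_4 on lie_3, where t^{i,4} acts as ad x_i and t^{i,j},
for i, j ≤ 3, as a tangential derivation of divergence zero. After the last strand is moved to the
front, the bracket of the pentagon with t^{1,4} involves only a Lie polynomial in the t^{i,4} and
ψ(t^{1,2}, t^{2,3}) (`lie_pentagon_rot`). The pentagon thus prescribes ψ(t^{1,2}, t^{2,3}) on x_1.
Permuting the strands and using antisymmetry and the hexagon gives its values on x_2 and x_3, and
the result for Ψ = ν(ψ) is Ψ^{2,3} + Ψ^{1,23} - Ψ^{1,2} - Ψ^{12,3} = ψ(t^{1,2}, t^{2,3})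
(`IsGRTPoly.tanDer_eq`). Conversely, the formula on x_1 alone implies the pentagon
(`pentagon_eq_zero_of_apply`).

The displayed identity has three consequences. (1) Both t^{1,2} and t^{2,3} kill x_1 + x_2 + x_3, so
Ψ(x + y) is a symmetric Lie 2-cocycle. Such cocycles vanish in degree at least two
(`smul_eq_zero_of_cocycle`), so Ψ is special. (2) Divergence is a 1-cocycle (`cyc_divPoly_lie`),
hence zero on ψ(t^{1,2}, t^{2,3}), and it is compatible with the substitutions on the left side.
Therefore δ(div Ψ) = 0. (3) Ψ^{1,2} + Ψ^{12,3} commutes with t^{1,2}, and Ψ^{2,3} + Ψ^{1,23} with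
t^{2,3}. So the former acts on Lie polynomials in t^{1,2}, t^{2,3} as the derivation (0, ψ).
Comparing commutators gives the identity for the Ihara bracket, and the converse above gives its
pentagon (`iharaPoly_pentagon`).

Since Ψ is special it kills -x-y, so it acts on ψ'(-x-y, x) as (0, ψ) acts on ψ'(x, y); this makes ν
a homomorphism. It is injective because [x, ψ(-x-y, x)] = 0 forces ψ = 0.

That the extended Kashiwara-Vergne elements are closed under commutators rests on the kernel of δ:
in each positive degree m it consists of multiples of Tr((x+y)^m - x^m - y^m)
(`exists_cyc_eq_of_deltaPoly`), and special derivations annihilate these. So the divergence of a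
commutator is even zero. -/

theorem free_top_induction {P : FreeLieAlgebra k (Fin n) → Prop}
    (of : ∀ i, P (FreeLieAlgebra.of k i)) (lie : ∀ a b, P a → P b → P ⁅a, b⁆) (zero : P 0)
    (add : ∀ a b, P a → P b → P (a + b)) (smul : ∀ (c : k) a, P a → P (c • a))
    (a : FreeLieAlgebra k (Fin n)) : P a := by
  have h : a ∈ LieSubalgebra.lieSpan k _ (letters k n) := by rw [lieSpan_letters]; trivial
  induction h using LieSubalgebra.lieSpan_induction with
  | mem x hx => obtain ⟨i, rfl⟩ := hx; exact of i
  | zero => exact zero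
  | add x y _ _ hx hy => exact add _ _ hx hy
  | smul c x _ hx => exact smul _ _ hx
  | lie x y _ _ hx hy => exact lie _ _ hx hy

theorem lie_hom_ext {f g : FreeLieAlgebra k (Fin n) →ₗ⁅k⁆ L}
    (h : ∀ i, f (FreeLieAlgebra.of k i) = g (FreeLieAlgebra.of k i))
    (a : FreeLieAlgebra k (Fin n)) : f a = g a := by
  have : f = g := FreeLieAlgebra.hom_ext h
  rw [this]

/-- A derivation of `L` and a derivation of a free Lie algebra that are intertwined by a
homomorphism on the generators are intertwined everywhere. -/
theorem der_hom (h : FreeLieAlgebra k (Fin n) →ₗ⁅k⁆ L) (D : LieDerivation k L L)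
    (E : LieDerivation k (FreeLieAlgebra k (Fin n)) (FreeLieAlgebra k (Fin n)))
    (H : ∀ i, D (h (FreeLieAlgebra.of k i)) = h (E (FreeLieAlgebra.of k i)))
    (f : FreeLieAlgebra k (Fin n)) : D (h f) = h (E f) := by
  induction f using free_top_induction with
  | of i => exact H i
  | lie a b ha hb =>
    rw [LieHom.map_lie, LieDerivation.apply_lie_eq_add, LieDerivation.apply_lie_eq_add, ha, hb,
      map_add, LieHom.map_lie, LieHom.map_lie]
  | zero => simp
  | add a b ha hb => simp only [map_add, ha, hb]
  | smul c a ha => simp only [map_smul, ha]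

/-- The substitution `f ↦ f(a, b)`. -/
def ev₂ (a b : L) : FreeLieAlgebra k (Fin 2) →ₗ⁅k⁆ L := FreeLieAlgebra.lift k ![a, b]

@[simp] theorem ev₂_x (a b : L) : ev₂ a b (FreeLieAlgebra.of k 0) = a := by
  simp [ev₂]

@[simp] theorem ev₂_y (a b : L) : ev₂ a b (FreeLieAlgebra.of k 1) = b := by
  simp [ev₂]

theorem map_ev₂ {L' : Type w} [LieRing L'] [LieAlgebra k L'] (h : L →ₗ⁅k⁆ L') (a b : L)
    (f : FreeLieAlgebra k (Fin 2)) : h (ev₂ a b f) = ev₂ (h a) (h b) f := by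
  refine lie_hom_ext (f := h.comp (ev₂ a b)) (g := ev₂ (h a) (h b)) (fun i => ?_) f
  fin_cases i <;> simp

theorem ev₂_of (f : FreeLieAlgebra k (Fin 2)) :
    ev₂ (FreeLieAlgebra.of k 0) (FreeLieAlgebra.of k 1) f = f := by
  refine lie_hom_ext (f := ev₂ _ _) (g := LieHom.id) (fun i => ?_) f
  fin_cases i <;> simp

theorem der_ev₂_of_eq (D : LieDerivation k L L) {a b : L}
    (E : LieDerivation k (FreeLieAlgebra k (Fin 2)) (FreeLieAlgebra k (Fin 2)))
    (ha : D a = ev₂ a b (E (FreeLieAlgebra.of k 0)))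
    (hb : D b = ev₂ a b (E (FreeLieAlgebra.of k 1)))
    (f : FreeLieAlgebra k (Fin 2)) : D (ev₂ a b f) = ev₂ a b (E f) := by
  refine der_hom (ev₂ a b) D E (fun i => ?_) f
  fin_cases i
  · simpa using ha
  · simpa using hb

theorem der_ev₂_zero (D : LieDerivation k L L) {a b : L} (ha : D a = 0) (hb : D b = 0)
    (f : FreeLieAlgebra k (Fin 2)) : D (ev₂ a b f) = 0 := by
  rw [der_ev₂_of_eq D 0] <;> simp [ha, hb]

theorem ad_apply' (c a : L) : LieDerivation.ad k L c a = ⁅c, a⁆ := by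
  rw [LieDerivation.ad_apply_apply]

/-- A derivation that acts on `a` and `b` as `[·, c]` acts in the same way on `f(a, b)`. -/
theorem der_ev₂_inner (D : LieDerivation k L L) {a b c : L} (ha : D a = ⁅a, c⁆) (hb : D b = ⁅b, c⁆)
    (f : FreeLieAlgebra k (Fin 2)) : D (ev₂ a b f) = ⁅ev₂ a b f, c⁆ := by
  have := der_ev₂_zero (D + LieDerivation.ad k L c) (a := a) (b := b)
    (by rw [LieDerivation.add_apply, ha, ad_apply', ← lie_skew a c, neg_add_cancel])
    (by rw [LieDerivation.add_apply, hb, ad_apply', ← lie_skew b c, neg_add_cancel]) f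
  rw [LieDerivation.add_apply, ad_apply'] at this
  rw [eq_neg_of_add_eq_zero_left this, lie_skew]

theorem lie_ev₂_zero {a b c : L} (ha : ⁅c, a⁆ = 0) (hb : ⁅c, b⁆ = 0)
    (f : FreeLieAlgebra k (Fin 2)) : ⁅c, ev₂ a b f⁆ = 0 := by
  simpa using der_ev₂_zero (LieDerivation.ad k L c) (by simpa using ha) (by simpa using hb) f

theorem ev₂_mem {S : Set L} {a b : L} (ha : a ∈ lieDeg k S 1) (hb : b ∈ lieDeg k S 1) {m : ℕ}
    {f : FreeLieAlgebra k (Fin 2)} (hf : f ∈ lieDeg k (letters k 2) m) :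
    ev₂ a b f ∈ lieDeg k S m := by
  have := lift_mem_lieDeg (k := k) (S := S) ![⟨a, ha⟩, ⟨b, hb⟩] hf
  convert this using 2
  rw [ev₂]
  congr 1
  funext i
  fin_cases i <;> rfl

theorem of_mem (i : Fin n) : FreeLieAlgebra.of k i ∈ lieDeg k (letters k n) 1 := (X k i).2

theorem lieDeg_zero (S : Set L) : lieDeg k S 0 = ⊥ := by
  rw [lieDeg, Submodule.span_eq_bot]
  intro a ha
  have key : ∀ (m : ℕ) (a : L), IsLieWord S m a → m ≠ 0 := by
    intro m a h
    induction h with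
    | letter _ => simp
    | bracket _ _ h₁ h₂ => omega
  exact absurd rfl (key 0 a ha)

/-- Moving the arguments by central elements does not change a Lie polynomial without linear
part. -/
theorem ev₂_add_central {a b c d : L} (hca : ⁅c, a⁆ = 0) (hcb : ⁅c, b⁆ = 0) (hda : ⁅d, a⁆ = 0)
    (hdb : ⁅d, b⁆ = 0) (hcd : ⁅c, d⁆ = 0) {m : ℕ} (hm : m ≠ 1) {f : FreeLieAlgebra k (Fin 2)}
    (hf : f ∈ lieDeg k (letters k 2) m) : ev₂ (a + c) (b + d) f = ev₂ a b f := by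
  -- The induction needs a statement in degree one as well, since the factors of a bracket may be
  -- linear: there the value changes by a central combination of c and d, which brackets then
  -- ignore.
  have key : (m ≠ 1 → ev₂ (a + c) (b + d) f = ev₂ a b f) ∧
      ∃ s t : k, ev₂ (a + c) (b + d) f = ev₂ a b f + (s • c + t • d) := by
    refine free_induction (P := fun m f => (m ≠ 1 → ev₂ (a + c) (b + d) f = ev₂ a b f) ∧
      ∃ s t : k, ev₂ (a + c) (b + d) f = ev₂ a b f + (s • c + t • d)) ?_ ?_ ?_ ?_ ?_ hf
    · intro i
      refine ⟨fun h => absurd rfl h, ?_⟩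
      fin_cases i
      · exact ⟨1, 0, by simp⟩
      · exact ⟨0, 1, by simp⟩
    · rintro p q f g - - ⟨-, s, t, h₁⟩ ⟨-, s', t', h₂⟩
      have h : ev₂ (a + c) (b + d) ⁅f, g⁆ = ev₂ a b ⁅f, g⁆ := by
        have e₁ := lie_ev₂_zero (k := k) hca hcb
        have e₂ := lie_ev₂_zero (k := k) hda hdb
        have e₃ : ∀ f, ⁅ev₂ a b f, c⁆ = 0 := fun f => by rw [← lie_skew, e₁, neg_zero]
        have e₄ : ∀ f, ⁅ev₂ a b f, d⁆ = 0 := fun f => by rw [← lie_skew, e₂, neg_zero]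
        have e₅ : ⁅d, c⁆ = 0 := by rw [← lie_skew, hcd, neg_zero]
        rw [LieHom.map_lie, LieHom.map_lie, h₁, h₂]
        simp [e₁, e₂, e₃, e₄, e₅, hcd]
      exact ⟨fun _ => h, 0, 0, by simp [h]⟩
    · intro m; exact ⟨fun _ => by simp, 0, 0, by simp⟩
    · rintro m f g ⟨h₁, s, t, h₂⟩ ⟨h₃, s', t', h₄⟩
      refine ⟨fun h => by rw [map_add, map_add, h₁ h, h₃ h], s + s', t + t', ?_⟩
      rw [map_add, map_add, h₂, h₄]
      module
    · rintro m r f ⟨h₁, s, t, h₂⟩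
      refine ⟨fun h => by rw [map_smul, map_smul, h₁ h], r * s, r * t, ?_⟩
      rw [map_smul, map_smul, h₂]
      module
  exact key.1 hm

/-- A Lie polynomial without linear part vanishes on commuting arguments. -/
theorem ev₂_eq_zero {a b : L} (hab : ⁅a, b⁆ = 0) {m : ℕ} (hm : m ≠ 1)
    {f : FreeLieAlgebra k (Fin 2)} (hf : f ∈ lieDeg k (letters k 2) m) : ev₂ a b f = 0 := by
  -- Commuting arguments are regarded as central displacements of the pair (0, 0).
  have h := ev₂_add_central (k := k) (a := (0 : L)) (b := 0) (c := a) (d := b) (by simp) (by simp)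
    (by simp) (by simp) hab hm hf
  rw [zero_add, zero_add] at h
  rw [h]
  have h0 : (0 : L) ∈ lieDeg k (∅ : Set L) 1 := zero_mem _
  have := map_ev₂ (0 : L →ₗ⁅k⁆ L) (0 : L) 0 f
  simpa using this.symm

end Generalities

/-! ### The embedding of the free Lie algebra and centralizers of the generators -/

section Dynkin

attribute [local instance 100] LieRing.ofAssociativeRing

variable {k : Type u} [CommRing k] {n : ℕ}

@[simp] theorem toAss_of (i : Fin n) : toAss (FreeLieAlgebra.of k i) = FreeAlgebra.ι k i := by
  rw [toAss, FreeLieAlgebra.lift_of_apply]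

theorem toAss_lie (a b : FreeLieAlgebra k (Fin n)) :
    toAss ⁅a, b⁆ = toAss a * toAss b - toAss b * toAss a := by
  rw [LieHom.map_lie, LieRing.of_associative_ring_bracket]

/-- The adjoint action of the free associative algebra on the free Lie algebra. -/
def assAd : FreeAlgebra k (Fin n) →ₐ[k] Module.End k (FreeLieAlgebra k (Fin n)) :=
  FreeAlgebra.lift k fun i => LieAlgebra.ad k _ (FreeLieAlgebra.of k i)

theorem assAd_toAss (a b : FreeLieAlgebra k (Fin n)) : assAd (toAss a) b = ⁅a, b⁆ := by
  have := lie_hom_ext (f := (assAd : FreeAlgebra k (Fin n) →ₐ[k] _).toLieHom.comp toAss)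
    (g := LieAlgebra.ad k _) (fun i => by simp [assAd]) a
  exact LinearMap.congr_fun this b

/-- The value of the right normed bracketing on a word. -/
def bracketWord : List (Fin n) → FreeLieAlgebra k (Fin n)
  | [] => 0
  | [i] => FreeLieAlgebra.of k i
  | i :: j :: l => ⁅FreeLieAlgebra.of k i, bracketWord (j :: l)⁆

/-- The right normed bracketing `x_1 x_2 ⋯ x_m ↦ [x_1, [x_2, [⋯, x_m]]]`. -/
def bracketing : FreeAlgebra k (Fin n) →ₗ[k] FreeLieAlgebra k (Fin n) :=
  (FreeAlgebra.basisFreeMonoid k (Fin n)).constr k fun w => bracketWord w.toList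

theorem bracketing_word (w : List (Fin n)) :
    bracketing (w.map (FreeAlgebra.ι k)).prod = bracketWord w := by
  rw [← basis_eq, bracketing, Module.Basis.constr_basis]
  rfl

theorem ass_word_induction {P : FreeAlgebra k (Fin n) → Prop}
    (word : ∀ w : List (Fin n), P (w.map (FreeAlgebra.ι k)).prod) (zero : P 0)
    (add : ∀ a b, P a → P b → P (a + b)) (smul : ∀ (c : k) a, P a → P (c • a))
    (a : FreeAlgebra k (Fin n)) : P a := by
  have h : a ∈ Submodule.span k (Set.range (FreeAlgebra.basisFreeMonoid k (Fin n))) := by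
    rw [Module.Basis.span_eq]; trivial
  induction h using Submodule.span_induction with
  | mem x hx =>
    obtain ⟨w, rfl⟩ := hx
    obtain ⟨w, rfl⟩ := FreeMonoid.ofList.surjective w
    rw [basis_eq]; exact word w
  | zero => exact zero
  | add x y _ _ hx hy => exact add _ _ hx hy
  | smul c x _ hx => exact smul _ _ hx

/-- The last letter of the right factor remains the innermost entry, so each letter put in front
just applies its adjoint operator. The right factor must be nonempty, because the bracketing of the
empty word is set to 0. -/
theorem bracketing_mul_word (a : FreeAlgebra k (Fin n)) (i : Fin n) (w : List (Fin n)) :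
    bracketing (a * ((i :: w).map (FreeAlgebra.ι k)).prod) =
      assAd a (bracketing ((i :: w).map (FreeAlgebra.ι k)).prod) := by
  induction a using ass_word_induction with
  | word v =>
    rw [← List.prod_append, ← List.map_append, bracketing_word, bracketing_word]
    induction v with
    | nil => simp
    | cons j v ih =>
      rw [List.map_cons, List.prod_cons, map_mul, Module.End.mul_apply, ← ih, assAd,
        FreeAlgebra.lift_ι_apply, LieAlgebra.ad_apply]
      cases v <;> rfl
  | zero => simp
  | add a b ha hb => simp only [add_mul, map_add, ha, hb, LinearMap.add_apply]
  | smul c a ha => simp only [smul_mul_assoc, map_smul, ha, LinearMap.smul_apply]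

theorem bracketing_mul (a : FreeAlgebra k (Fin n)) {m : ℕ} {b : FreeAlgebra k (Fin n)}
    (hb : b ∈ assDeg k n (m + 1)) : bracketing (a * b) = assAd a (bracketing b) := by
  induction hb using Submodule.span_induction with
  | mem b hb =>
    obtain ⟨l, hl, rfl⟩ := hb
    cases l with
    | nil => simp at hl
    | cons i w => exact bracketing_mul_word a i w
  | zero => simp
  | add x y _ _ hx hy => simp only [mul_add, map_add, hx, hy]
  | smul c x _ hx => simp only [mul_smul_comm, map_smul, hx]

/-- The Dynkin-Specht-Wever identity. -/
theorem bracketing_toAss {m : ℕ} {a : FreeLieAlgebra k (Fin n)}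
    (ha : a ∈ lieDeg k (letters k n) m) : bracketing (toAss a) = (m : k) • a := by
  refine free_induction (P := fun m a => bracketing (toAss a) = (m : k) • a) ?_ ?_ ?_ ?_ ?_ ha
  · intro i
    have := bracketing_word (k := k) [i]
    simpa [bracketWord] using this
  · intro p q a b ha hb h₁ h₂
    rcases p with _ | p
    · rw [lieDeg_zero, Submodule.mem_bot] at ha
      simp [ha]
    rcases q with _ | q
    · rw [lieDeg_zero, Submodule.mem_bot] at hb
      simp [hb]
    -- For β the bracketing, β(ab - ba) = ad(a) β(b) - ad(b) β(a) = q[a, b] - p[b, a] = (p + q)[a,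
    -- b].
    rw [toAss_lie, map_sub, bracketing_mul _ (toAss_mem ha), bracketing_mul _ (toAss_mem hb), h₁,
      h₂, map_smul, map_smul, assAd_toAss, assAd_toAss, ← lie_skew a b]
    push_cast
    module
  · intro m; simp
  · intro m a b h₁ h₂; rw [map_add, map_add, h₁, h₂, smul_add]
  · intro m c a h; rw [map_smul, map_smul, h, smul_comm]

theorem partialOp_mul_ι (i : Fin n) (a : FreeAlgebra k (Fin n)) :
    partialOp i (a * FreeAlgebra.ι k i) = a := by
  induction a using ass_word_induction with
  | word w =>
    have := partialOp_word (k := k) i (w ++ [i])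
    simpa [partialWord] using this
  | zero => simp
  | add a b ha hb => rw [add_mul, map_add, ha, hb]
  | smul c a ha => rw [smul_mul_assoc, map_smul, ha]

/-- Positive degree guarantees that the last letter of each word belongs to a and not to the new
factor. -/
theorem partialOp_ι_mul (i j : Fin n) {m : ℕ} {a : FreeAlgebra k (Fin n)}
    (ha : a ∈ assDeg k n (m + 1)) :
    partialOp i (FreeAlgebra.ι k j * a) = FreeAlgebra.ι k j * partialOp i a := by
  induction ha using Submodule.span_induction with
  | mem b hb =>
    obtain ⟨l, hl, rfl⟩ := hb
    obtain ⟨l, s, rfl⟩ := List.eq_nil_or_concat l |>.resolve_left (by rintro rfl; simp at hl)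
    rw [List.concat_eq_append, ← List.prod_cons, ← List.map_cons, partialOp_word, partialOp_word,
      ← List.cons_append]
    simp only [partialWord, List.getLast?_concat, List.dropLast_concat]
    split_ifs <;> simp
  | zero => simp
  | add x y _ _ hx hy => simp only [mul_add, map_add, hx, hy]
  | smul c x _ hx => simp only [mul_smul_comm, map_smul, hx]

theorem mem_assDeg_zero {a : FreeAlgebra k (Fin n)} (ha : a ∈ assDeg k n 0) :
    ∃ c : k, a = c • 1 := by
  induction ha using Submodule.span_induction with
  | mem b hb =>
    obtain ⟨l, hl, rfl⟩ := hb
    rw [List.length_eq_zero_iff] at hl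
    subst hl
    exact ⟨1, by simp⟩
  | zero => exact ⟨0, by simp⟩
  | add x y _ _ hx hy =>
    obtain ⟨c, rfl⟩ := hx
    obtain ⟨d, rfl⟩ := hy
    exact ⟨c + d, by rw [add_smul]⟩
  | smul c x _ hx =>
    obtain ⟨d, rfl⟩ := hx
    exact ⟨c * d, by rw [mul_smul]⟩

end Dynkin

section Centralizer

attribute [local instance 100] LieRing.ofAssociativeRing

variable {k : Type u} [Field k] {n : ℕ}

/-- A homogeneous element that commutes with `x_i` is a multiple of a power of `x_i`. -/
theorem eq_smul_pow_of_commute (i : Fin n) {m : ℕ} {a : FreeAlgebra k (Fin n)}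
    (ha : a ∈ assDeg k n m) (h : FreeAlgebra.ι k i * a = a * FreeAlgebra.ι k i) :
    ∃ c : k, a = c • FreeAlgebra.ι k i ^ m := by
  induction m generalizing a with
  | zero =>
    obtain ⟨c, rfl⟩ := mem_assDeg_zero ha
    exact ⟨c, by simp⟩
  | succ m ih =>
    -- Removing the last letter x_i from both sides of x_i a = a x_i exhibits a as x_i times ∂_i a.
    -- Cancelling x_i shows that ∂_i a commutes with x_i again.
    have e : a = FreeAlgebra.ι k i * partialOp i a := by
      rw [← partialOp_ι_mul i i ha, h, partialOp_mul_ι]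
    have hx : FreeAlgebra.ι k i ≠ 0 := FreeAlgebra.ι_ne_zero i
    obtain ⟨c, hc⟩ := ih (partialOp_mem i ha) (by
      apply mul_left_cancel₀ hx
      rw [← e, ← mul_assoc, ← e, h])
    exact ⟨c, by rw [e, hc, mul_smul_comm, pow_succ']⟩

variable [CharZero k]

/-- In the associative algebra the element is a multiple of x_i^m. The right normed bracketing kills
x_i^m for m ≥ 2 but multiplies a Lie element of degree m by m, which is invertible. Degree one must
be excluded because of x_i itself. -/
theorem eq_zero_of_lie_of_eq_zero (i : Fin n) {m : ℕ} (hm : m ≠ 1) {a : FreeLieAlgebra k (Fin n)}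
    (ha : a ∈ lieDeg k (letters k n) m) (h : ⁅FreeLieAlgebra.of k i, a⁆ = 0) : a = 0 := by
  rcases m with _ | _ | m
  · rwa [lieDeg_zero, Submodule.mem_bot] at ha
  · exact absurd rfl hm
  have h' := congrArg toAss h
  rw [toAss_lie, map_zero, sub_eq_zero, toAss_of] at h'
  obtain ⟨c, hc⟩ := eq_smul_pow_of_commute i (toAss_mem ha) h'
  have hd := bracketing_toAss ha
  have hp : bracketing (FreeAlgebra.ι k i ^ (m + 2)) = 0 := by
    have h₁ : FreeAlgebra.ι k i ^ 1 ∈ assDeg k n (0 + 1) := by rw [pow_one]; exact (assX k i).2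
    have h₂ := bracketing_mul (FreeAlgebra.ι k i ^ m * FreeAlgebra.ι k i) h₁
    have h₃ : bracketing (FreeAlgebra.ι k i) = FreeLieAlgebra.of k i := by
      simpa [bracketWord] using bracketing_word (k := k) [i]
    rw [pow_one, h₃, map_mul assAd, Module.End.mul_apply, ← pow_succ, ← pow_succ] at h₂
    rw [h₂]
    simp [assAd]
  rw [hc, map_smul, hp, smul_zero] at hd
  exact (smul_eq_zero.1 hd.symm).resolve_left (Nat.cast_ne_zero.2 (Nat.succ_ne_zero _))

theorem eq_of_lie_of_eq (i : Fin n) {m : ℕ} (hm : m ≠ 1) {a b : FreeLieAlgebra k (Fin n)}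
    (ha : a ∈ lieDeg k (letters k n) m) (hb : b ∈ lieDeg k (letters k n) m)
    (h : ⁅FreeLieAlgebra.of k i, a⁆ = ⁅FreeLieAlgebra.of k i, b⁆) : a = b := by
  rw [← sub_eq_zero]
  exact eq_zero_of_lie_of_eq_zero i hm (sub_mem ha hb) (by rw [lie_sub, h, sub_self])

end Centralizer

/-! ### Families that satisfy the relations of `t_n` -/

section BraidFamily

variable {k : Type u} [CommRing k] {n : ℕ} {L : Type v} [LieRing L] [LieAlgebra k L]

/-- A family of elements of a Lie algebra that satisfies the defining relations of `t_n`. -/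
structure BraidFamily (T : Fin n → Fin n → L) : Prop where
  diag (i : Fin n) : T i i = 0
  symm (i j : Fin n) : T i j = T j i
  comm (i j p q : Fin n) (h₁ : p ≠ i) (h₂ : p ≠ j) (h₃ : q ≠ i) (h₄ : q ≠ j) : ⁅T i j, T p q⁆ = 0
  triple (i j l : Fin n) (h₁ : i ≠ j) (h₂ : i ≠ l) (h₃ : j ≠ l) : ⁅T i j + T i l, T j l⁆ = 0

theorem BraidFamily.comp {m : ℕ} {T : Fin n → Fin n → L} (hT : BraidFamily T) {σ : Fin m → Fin n}
    (hσ : Function.Injective σ) : BraidFamily fun i j => T (σ i) (σ j) where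
  diag _ := hT.diag _
  symm _ _ := hT.symm _ _
  comm _ _ _ _ h₁ h₂ h₃ h₄ := hT.comm _ _ _ _ (hσ.ne h₁) (hσ.ne h₂) (hσ.ne h₃) (hσ.ne h₄)
  triple _ _ _ h₁ h₂ h₃ := hT.triple _ _ _ (hσ.ne h₁) (hσ.ne h₂) (hσ.ne h₃)

variable (k n) in
theorem braidFamily_braidGen : BraidFamily (braidGen k (n := n)) := by
  have key : ∀ a, BraidRel k n a → (LieSubmodule.Quotient.mk a : Braid k n) = 0 := fun a ha =>
    (LieSubmodule.Quotient.mk_eq_zero').2 (LieSubmodule.subset_lieSpan ha)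
  refine ⟨fun i => key _ (.diag i), fun i j => ?_, fun i j p q h₁ h₂ h₃ h₄ => ?_,
    fun i j l h₁ h₂ h₃ => ?_⟩
  · rw [← sub_eq_zero]; exact key _ (.symm i j)
  · exact key _ (.comm i j p q h₁ h₂ h₃ h₄)
  · exact key _ (.triple i j l h₁ h₂ h₃)

/-- The homomorphism from `t_n` given by a family that satisfies the relations of `t_n`. -/
def braidLift {T : Fin n → Fin n → L} (hT : BraidFamily T) : Braid k n →ₗ⁅k⁆ L :=
  let φ : FreeLieAlgebra k (Fin n × Fin n) →ₗ⁅k⁆ L := FreeLieAlgebra.lift k fun p => T p.1 p.2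
  have hφ : braidIdeal k n ≤ φ.ker := by
    rw [braidIdeal, LieSubmodule.lieSpan_le]
    intro a ha
    change φ a = 0
    cases (show BraidRel k n a from ha) with
    | diag i => simpa [φ, pairGen] using hT.diag i
    | symm i j => simpa [φ, pairGen, sub_eq_zero] using hT.symm i j
    | comm i j p q h₁ h₂ h₃ h₄ =>
      simpa [φ, pairGen] using hT.comm i j p q h₁ h₂ h₃ h₄
    | triple i j l h₁ h₂ h₃ =>
      simpa [φ, pairGen] using hT.triple i j l h₁ h₂ h₃
  { (braidIdeal k n).toSubmodule.liftQ (φ : _ →ₗ[k] L)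
      (fun a ha => LinearMap.mem_ker.2 (LieHom.mem_ker.1 (hφ ha))) with
    map_lie' := by
      intro a b
      obtain ⟨a, rfl⟩ := LieSubmodule.Quotient.surjective_mk' _ a
      obtain ⟨b, rfl⟩ := LieSubmodule.Quotient.surjective_mk' _ b
      exact LieHom.map_lie φ a b }

@[simp] theorem braidLift_gen {T : Fin n → Fin n → L} (hT : BraidFamily T) (i j : Fin n) :
    braidLift (k := k) hT (braidGen k i j) = T i j := by
  change FreeLieAlgebra.lift k _ (pairGen k i j) = _
  rw [pairGen, FreeLieAlgebra.lift_of_apply]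

theorem braid_induction {P : Braid k n → Prop} (gen : ∀ i j, P (braidGen k i j))
    (lie : ∀ a b, P a → P b → P ⁅a, b⁆) (zero : P 0)
    (add : ∀ a b, P a → P b → P (a + b)) (smul : ∀ (c : k) a, P a → P (c • a))
    (a : Braid k n) : P a := by
  let K : LieSubalgebra k (Braid k n) :=
    { carrier := {a | P a}
      add_mem' := fun {a b} ha hb => add a b ha hb
      zero_mem' := zero
      smul_mem' := fun c {a} ha => smul c a ha
      lie_mem' := fun {a b} ha hb => lie a b ha hb }
  let φ : FreeLieAlgebra k (Fin n × Fin n) →ₗ⁅k⁆ K :=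
    FreeLieAlgebra.lift k fun p => ⟨braidGen k p.1 p.2, gen _ _⟩
  let q : FreeLieAlgebra k (Fin n × Fin n) →ₗ⁅k⁆ Braid k n :=
    { (LieSubmodule.Quotient.mk' (braidIdeal k n) : _ →ₗ[k] Braid k n) with
      map_lie' := fun {a b} => LieSubmodule.Quotient.mk_bracket _ a b }
  have h : K.incl.comp φ = q := by
    ext p
    change ((φ (FreeLieAlgebra.of k p) : K) : Braid k n) = braidGen k p.1 p.2
    simp only [φ, FreeLieAlgebra.lift_of_apply]
  obtain ⟨a, rfl⟩ := LieSubmodule.Quotient.surjective_mk' _ a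
  have h' : ((φ a : K) : Braid k n) = LieSubmodule.Quotient.mk' (braidIdeal k n) a :=
    LieHom.congr_fun h a
  rw [← h']
  exact (φ a).2

/-! ### The action of `t_{n+1}` on the free Lie algebra in `n` generators -/

/-- The tuple of the tangential derivation `t^{i,j}`: it has `x_j` in position `i` and `x_i` in
position `j`. -/
def tTuple (i j l : Fin n) : FreeLieAlgebra k (Fin n) :=
  (if l = i then FreeLieAlgebra.of k j else 0) + if l = j then FreeLieAlgebra.of k i else 0

variable (k) in
/-- The tangential derivation `t^{i,j}`, with `x_i ↦ [x_i, x_j]` and `x_j ↦ [x_j, x_i]`. -/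
def tDer (i j : Fin n) : LieDerivation k (FreeLieAlgebra k (Fin n)) (FreeLieAlgebra k (Fin n)) :=
  freeDer fun l => ⁅FreeLieAlgebra.of k l, tTuple i j l⁆

theorem tDer_of (i j l : Fin n) : tDer k i j (FreeLieAlgebra.of k l) =
    ⁅FreeLieAlgebra.of k l, (if l = i then FreeLieAlgebra.of k j else 0) +
      if l = j then FreeLieAlgebra.of k i else 0⁆ := freeDer_of _ _

theorem tDer_symm (i j : Fin n) : tDer k i j = tDer k j i := by
  refine free_der_ext fun l => ?_
  rw [tDer_of, tDer_of, add_comm]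

theorem tDer_of_ne {i j l : Fin n} (h₁ : l ≠ i) (h₂ : l ≠ j) :
    tDer k i j (FreeLieAlgebra.of k l) = 0 := by
  rw [tDer_of]; simp [h₁, h₂]

theorem tDer_of_left {i j : Fin n} (h : i ≠ j) :
    tDer k i j (FreeLieAlgebra.of k i) = ⁅FreeLieAlgebra.of k i, FreeLieAlgebra.of k j⁆ := by
  rw [tDer_of]; simp [h]

theorem tDer_of_right {i j : Fin n} (h : i ≠ j) :
    tDer k i j (FreeLieAlgebra.of k j) = ⁅FreeLieAlgebra.of k j, FreeLieAlgebra.of k i⁆ := by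
  rw [tDer_of]; simp [h.symm]

theorem braidFamily_tDer : BraidFamily (tDer k (n := n)) where
  diag i := free_der_ext fun l => by
    rw [tDer_of]
    split_ifs with h <;> simp [h]
  symm := tDer_symm
  comm i j p q h₁ h₂ h₃ h₄ := free_der_ext fun l => by
    rw [LieDerivation.lie_apply, LieDerivation.zero_apply, tDer_of, tDer_of]
    split_ifs <;> subst_vars <;>
      simp_all [tDer_of_ne, Ne.symm]
  triple i j l h₁ h₂ h₃ := free_der_ext fun m => by
    rw [LieDerivation.lie_apply, LieDerivation.zero_apply]
    by_cases e₁ : m = i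
    · subst e₁
      simp [tDer_of_ne h₁ h₂, tDer_of_left h₁, tDer_of_left h₂, tDer_of_left h₃, tDer_of_right h₃]
    by_cases e₂ : m = j
    · subst e₂
      simp [tDer_of_ne h₁.symm h₃, tDer_of_ne h₂.symm h₃.symm, tDer_of_right h₁, tDer_of_right h₂,
        tDer_of_left h₃, tDer_of_ne h₁ h₂]
    by_cases e₃ : m = l
    · subst e₃
      simp [tDer_of_ne h₁.symm h₃, tDer_of_ne h₂.symm h₃.symm, tDer_of_right h₁, tDer_of_right h₂,
        tDer_of_right h₃, tDer_of_ne h₁ h₂]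
    · simp [tDer_of_ne e₁ e₂, tDer_of_ne e₁ e₃, tDer_of_ne e₂ e₃]

theorem tDer_sum (i j : Fin n) : tDer k i j (FreeLieAlgebra.of k i + FreeLieAlgebra.of k j) = 0 := by
  by_cases h : i = j
  · subst h; simp [tDer_of]
  · rw [map_add, tDer_of_left h, tDer_of_right h, ← lie_skew, neg_add_cancel]

variable (k n) in
/-- The generators of `t_{n+1}`, acting on the free Lie algebra in `n` generators: `t^{i,j}` acts
as a tangential derivation for `i, j ≤ n`, and `t^{i,n+1}` acts as the inner derivation
`[x_i, ·]`. -/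
def braidAct (i j : Fin (n + 1)) :
    LieDerivation k (FreeLieAlgebra k (Fin n)) (FreeLieAlgebra k (Fin n)) :=
  Fin.lastCases (Fin.lastCases 0 (fun j => LieDerivation.ad k _ (FreeLieAlgebra.of k j)) j)
    (fun i => Fin.lastCases (LieDerivation.ad k _ (FreeLieAlgebra.of k i)) (tDer k i) j) i

@[simp] theorem braidAct_last_last : braidAct k n (Fin.last n) (Fin.last n) = 0 := by
  simp [braidAct]

@[simp] theorem braidAct_last_left (i : Fin n) : braidAct k n (Fin.last n) i.castSucc =
    LieDerivation.ad k _ (FreeLieAlgebra.of k i) := by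
  simp [braidAct]

@[simp] theorem braidAct_last_right (i : Fin n) : braidAct k n i.castSucc (Fin.last n) =
    LieDerivation.ad k _ (FreeLieAlgebra.of k i) := by
  simp [braidAct]

@[simp] theorem braidAct_castSucc (i j : Fin n) :
    braidAct k n i.castSucc j.castSucc = tDer k i j := by
  simp [braidAct]

theorem lie_der_ad (D : LieDerivation k L L) (a : L) :
    ⁅D, LieDerivation.ad k L a⁆ = LieDerivation.ad k L (D a) :=
  LieDerivation.lie_der_ad_eq_ad_der D a

theorem lie_ad_der (D : LieDerivation k L L) (a : L) :
    ⁅LieDerivation.ad k L a, D⁆ = -LieDerivation.ad k L (D a) := by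
  rw [← lie_skew, lie_der_ad]

/-- Relations that involve the last strand reduce, by [D, ad a] = ad(D a), to three facts: t^{i,j}
kills x_l for l different from i and j, it kills x_i + x_j, and it sends x_j to [x_j, x_i]. -/
theorem braidFamily_braidAct : BraidFamily (braidAct k n) where
  diag i := by
    induction i using Fin.lastCases with
    | last => simp
    | cast i => simpa using braidFamily_tDer.diag i
  symm i j := by
    induction i using Fin.lastCases with
    | last => induction j using Fin.lastCases <;> simp
    | cast i =>
      induction j using Fin.lastCases with
      | last => simp
      | cast j => simpa using tDer_symm i j
  comm i j p q h₁ h₂ h₃ h₄ := by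
    induction i using Fin.lastCases with
    | last =>
      induction p using Fin.lastCases with
      | last => exact absurd rfl h₁
      | cast p =>
      induction q using Fin.lastCases with
      | last => exact absurd rfl h₃
      | cast q =>
      induction j using Fin.lastCases with
      | last => simp
      | cast j =>
        have h₂ : j ≠ p := fun e => h₂ (by rw [e])
        have h₄ : j ≠ q := fun e => h₄ (by rw [e])
        rw [braidAct_last_left, braidAct_castSucc, lie_ad_der, tDer_of_ne h₂ h₄, map_zero, neg_zero]
    | cast i =>
    induction j using Fin.lastCases with
    | last =>
      induction p using Fin.lastCases with
      | last => exact absurd rfl h₂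
      | cast p =>
      induction q using Fin.lastCases with
      | last => exact absurd rfl h₄
      | cast q =>
        have h₁ : i ≠ p := fun e => h₁ (by rw [e])
        have h₃ : i ≠ q := fun e => h₃ (by rw [e])
        rw [braidAct_last_right, braidAct_castSucc, lie_ad_der, tDer_of_ne h₁ h₃, map_zero,
          neg_zero]
    | cast j =>
    induction p using Fin.lastCases with
    | last =>
      induction q using Fin.lastCases with
      | last => simp
      | cast q =>
        have h₃ : q ≠ i := fun e => h₃ (by rw [e])
        have h₄ : q ≠ j := fun e => h₄ (by rw [e])
        rw [braidAct_last_left, braidAct_castSucc, lie_der_ad, tDer_of_ne h₃ h₄, map_zero]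
    | cast p =>
      have h₁ : p ≠ i := fun e => h₁ (by rw [e])
      have h₂ : p ≠ j := fun e => h₂ (by rw [e])
      induction q using Fin.lastCases with
      | last => rw [braidAct_last_right, braidAct_castSucc, lie_der_ad, tDer_of_ne h₁ h₂, map_zero]
      | cast q =>
        have h₃ : q ≠ i := fun e => h₃ (by rw [e])
        have h₄ : q ≠ j := fun e => h₄ (by rw [e])
        simpa using braidFamily_tDer.comm i j p q h₁ h₂ h₃ h₄
  triple i j l h₁ h₂ h₃ := by
    induction i using Fin.lastCases with
    | last =>
      induction j using Fin.lastCases with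
      | last => exact absurd rfl h₁
      | cast j =>
      induction l using Fin.lastCases with
      | last => exact absurd rfl h₂
      | cast l =>
        rw [braidAct_last_left, braidAct_last_left, braidAct_castSucc, ← map_add, lie_ad_der,
          tDer_sum, map_zero, neg_zero]
    | cast i =>
    induction j using Fin.lastCases with
    | last =>
      induction l using Fin.lastCases with
      | last => exact absurd rfl h₃
      | cast l =>
        have h₂ : i ≠ l := fun e => h₂ (by rw [e])
        rw [braidAct_last_left, braidAct_last_right, braidAct_castSucc, add_lie, lie_der_ad,
          lie_der_ad, ad_apply', ← map_add, tDer_of_right h₂, ← lie_skew, neg_add_cancel, map_zero]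
    | cast j =>
      have h₁ : i ≠ j := fun e => h₁ (by rw [e])
      induction l using Fin.lastCases with
      | last =>
        rw [braidAct_castSucc, braidAct_last_right, braidAct_last_right, add_lie, lie_der_ad,
          lie_der_ad, ad_apply', ← map_add, tDer_of_right h₁, ← lie_skew, neg_add_cancel, map_zero]
      | cast l =>
        have h₂ : i ≠ l := fun e => h₂ (by rw [e])
        have h₃ : j ≠ l := fun e => h₃ (by rw [e])
        simpa using braidFamily_tDer.triple i j l h₁ h₂ h₃

variable (k n) in
/-- The action of `t_{n+1}` on the free Lie algebra in `n` generators. -/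
def braidActHom : Braid k (n + 1) →ₗ⁅k⁆
    LieDerivation k (FreeLieAlgebra k (Fin n)) (FreeLieAlgebra k (Fin n)) :=
  braidLift braidFamily_braidAct

variable (k n) in
/-- The homomorphism `x_i ↦ t^{i,n+1}`. -/
def strandHom : FreeLieAlgebra k (Fin n) →ₗ⁅k⁆ Braid k (n + 1) :=
  FreeLieAlgebra.lift k fun i => braidGen k (Fin.last n) i.castSucc

@[simp] theorem strandHom_of (i : Fin n) : strandHom k n (FreeLieAlgebra.of k i) =
    braidGen k (Fin.last n) i.castSucc := by
  rw [strandHom, FreeLieAlgebra.lift_of_apply]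

theorem braidActHom_strandHom (f : FreeLieAlgebra k (Fin n)) :
    braidActHom k n (strandHom k n f) = LieDerivation.ad k _ f :=
  lie_hom_ext (f := (braidActHom k n).comp (strandHom k n)) (g := LieDerivation.ad k _)
    (fun i => by simp [braidActHom]) f

/-- For a generator g both sides are derivations along `strandHom`, so only letters need checking,
and there the equality is a defining relation of the braid Lie algebra. Brackets of such g follow
from the Jacobi identity. -/
theorem lie_strandHom (g : Braid k (n + 1)) (f : FreeLieAlgebra k (Fin n)) :
    ⁅g, strandHom k n f⁆ = strandHom k n (braidActHom k n g f) := by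
  induction g using braid_induction generalizing f with
  | gen i j =>
    have hT := braidFamily_braidGen k (n + 1)
    rw [braidActHom, braidLift_gen, ← ad_apply' (k := k)]
    refine der_hom (strandHom k n) (LieDerivation.ad k _ (braidGen k i j)) (braidAct k n i j)
      (fun l => ?_) f
    rw [ad_apply', strandHom_of]
    induction i using Fin.lastCases with
    | last =>
      induction j using Fin.lastCases with
      | last => rw [hT.diag, braidAct_last_last]; simp
      | cast j => simp [LieHom.map_lie]
    | cast i =>
      induction j using Fin.lastCases with
      | last => rw [hT.symm i.castSucc]; simp [LieHom.map_lie]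
      | cast j =>
        rw [braidAct_castSucc]
        by_cases e : i = j
        · subst e; rw [hT.diag, (braidFamily_tDer (k := k)).diag]; simp
        by_cases h₁ : l = i
        · subst h₁
          rw [tDer_of_left e, LieHom.map_lie, strandHom_of, strandHom_of]
          have := hT.triple j.castSucc (Fin.last n) l.castSucc (Fin.castSucc_lt_last _).ne
            (fun h => e (Fin.castSucc_injective _ h.symm)) (Fin.castSucc_lt_last _).ne'
          rw [add_lie, hT.symm j.castSucc, hT.symm j.castSucc l.castSucc] at this
          rw [eq_neg_of_add_eq_zero_right this, lie_skew]
        by_cases h₂ : l = j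
        · subst h₂
          rw [tDer_of_right e, LieHom.map_lie, strandHom_of, strandHom_of]
          have := hT.triple i.castSucc (Fin.last n) l.castSucc (Fin.castSucc_lt_last _).ne
            (fun h => e (Fin.castSucc_injective _ h)) (Fin.castSucc_lt_last _).ne'
          rw [add_lie, hT.symm i.castSucc (Fin.last n)] at this
          rw [eq_neg_of_add_eq_zero_right this, lie_skew]
        · rw [tDer_of_ne h₁ h₂, map_zero]
          exact hT.comm _ _ _ _ (Fin.castSucc_lt_last _).ne' (Fin.castSucc_lt_last _).ne'
            (fun h => h₁ (Fin.castSucc_injective _ h)) (fun h => h₂ (Fin.castSucc_injective _ h))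
  | lie a b ha hb =>
    rw [lie_lie, ha, hb, hb, ha, LieHom.map_lie, LieDerivation.lie_apply, map_sub]
  | zero => simp
  | add a b ha hb => rw [add_lie, ha, hb, map_add, LieDerivation.add_apply, map_add]
  | smul c a ha => rw [smul_lie, ha, map_smul, LieDerivation.smul_apply, map_smul]

end BraidFamily

/-! ### The pentagon equation -/

section Pentagon

variable {k : Type u} [CommRing k] {L : Type v} [LieRing L] [LieAlgebra k L]

/-- The difference of the two sides of the pentagon equation. -/
def pentagon (T : Fin 4 → Fin 4 → L) (f : FreeLieAlgebra k (Fin 2)) : L :=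
  ev₂ (T 0 1) (T 1 2 + T 1 3) f + ev₂ (T 0 2 + T 1 2) (T 2 3) f -
    (ev₂ (T 1 2) (T 2 3) f + ev₂ (T 0 1 + T 0 2) (T 1 3 + T 2 3) f + ev₂ (T 0 1) (T 1 2) f)

theorem map_pentagon {L' : Type w} [LieRing L'] [LieAlgebra k L'] (h : L →ₗ⁅k⁆ L')
    (T : Fin 4 → Fin 4 → L) (f : FreeLieAlgebra k (Fin 2)) :
    h (pentagon T f) = pentagon (fun i j => h (T i j)) f := by
  simp only [pentagon, map_sub, map_add, map_ev₂]

/-- The generators of t_4 are the universal family, so one pentagon yields all of them, in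
particular those for permuted strands and for derivations of lie_3. -/
theorem pentagon_eq_zero_of_braid {f : FreeLieAlgebra k (Fin 2)}
    (h : pentagon (braidGen k (n := 4)) f = 0) {T : Fin 4 → Fin 4 → L} (hT : BraidFamily T) :
    pentagon T f = 0 := by
  have := map_pentagon (braidLift (k := k) hT) (braidGen k) f
  simpa [h] using this.symm

theorem pentagon_mem {S : Set L} {T : Fin 4 → Fin 4 → L} (hT : ∀ i j, T i j ∈ lieDeg k S 1) {m : ℕ}
    {f : FreeLieAlgebra k (Fin 2)} (hf : f ∈ lieDeg k (letters k 2) m) :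
    pentagon T f ∈ lieDeg k S m :=
  sub_mem (add_mem (ev₂_mem (hT _ _) (add_mem (hT _ _) (hT _ _)) hf)
    (ev₂_mem (add_mem (hT _ _) (hT _ _)) (hT _ _) hf))
    (add_mem (add_mem (ev₂_mem (hT _ _) (hT _ _) hf)
      (ev₂_mem (add_mem (hT _ _) (hT _ _)) (add_mem (hT _ _) (hT _ _)) hf))
      (ev₂_mem (hT _ _) (hT _ _) hf))

/-- The order of the strands in which the last strand comes first. -/
def rot : Fin 4 → Fin 4 := ![3, 0, 1, 2]

/-- The inverse of `rot`. -/
def rotInv : Fin 4 → Fin 4 := ![1, 2, 3, 0]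

theorem rot_injective : Function.Injective rot := by decide

theorem rotInv_injective : Function.Injective rotInv := by decide

/-- The part of the rotated pentagon that lies in the free Lie algebra generated by
`t^{1,4}`, `t^{2,4}`, `t^{3,4}`. -/
def strandPart (x y z : L) (f : FreeLieAlgebra k (Fin 2)) : L :=
  ev₂ x (-x - y - z) f - ev₂ (x + y) (-x - y - z) f - ev₂ x (-x - y) f

theorem map_strandPart {L' : Type w} [LieRing L'] [LieAlgebra k L'] (h : L →ₗ⁅k⁆ L') (x y z : L)
    (f : FreeLieAlgebra k (Fin 2)) :
    h (strandPart x y z f) = strandPart (h x) (h y) (h z) f := by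
  simp only [strandPart, map_sub, map_add, map_neg, map_ev₂]

theorem strandPart_mem {S : Set L} {x y z : L} (hx : x ∈ lieDeg k S 1) (hy : y ∈ lieDeg k S 1)
    (hz : z ∈ lieDeg k S 1) {m : ℕ} {f : FreeLieAlgebra k (Fin 2)}
    (hf : f ∈ lieDeg k (letters k 2) m) : strandPart x y z f ∈ lieDeg k S m :=
  sub_mem (sub_mem (ev₂_mem hx (sub_mem (sub_mem (neg_mem hx) hy) hz) hf)
    (ev₂_mem (add_mem hx hy) (sub_mem (sub_mem (neg_mem hx) hy) hz) hf))
    (ev₂_mem hx (sub_mem (neg_mem hx) hy) hf)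

variable {m : ℕ} (hm : m ≠ 1) {f : FreeLieAlgebra k (Fin 2)} (hf : f ∈ lieDeg k (letters k 2) m)

include hm hf

theorem ev₂_add_right {a b d : L} (hda : ⁅d, a⁆ = 0) (hdb : ⁅d, b⁆ = 0) :
    ev₂ a (b + d) f = ev₂ a b f := by
  have := ev₂_add_central (k := k) (a := a) (b := b) (c := 0) (d := d) (by simp) (by simp) hda hdb
    (by simp) hm hf
  rwa [add_zero] at this

/-- Each sum of generators t^{i,j} with i, j ≤ 3 in the second slot next to t^{1,4} or t^{1,4} +
t^{2,4} differs from minus a sum of t^{i,4}'s by an element d that commutes with both arguments.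
Such a displacement is invisible to f outside degree one. -/
theorem pentagon_rot {T : Fin 4 → Fin 4 → L} (hT : BraidFamily T) :
    pentagon (fun i j => T (rot i) (rot j)) f = strandPart (T 3 0) (T 3 1) (T 3 2) f +
      ev₂ (T 3 1 + T 0 1) (T 1 2) f - ev₂ (T 0 1) (T 1 2) f := by
  have a₁ : ⁅T 3 1 + T 0 1, T 3 0⁆ = 0 := by
    have := hT.triple 1 3 0 (by decide) (by decide) (by decide)
    rwa [hT.symm 1 3, hT.symm 1 0] at this
  have a₂ : ⁅T 3 2 + T 0 2, T 3 0⁆ = 0 := by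
    have := hT.triple 2 3 0 (by decide) (by decide) (by decide)
    rwa [hT.symm 2 3, hT.symm 2 0] at this
  have a₃ : ⁅T 3 2 + T 1 2, T 3 1⁆ = 0 := by
    have := hT.triple 2 3 1 (by decide) (by decide) (by decide)
    rwa [hT.symm 2 3, hT.symm 2 1] at this
  have b₁ : ⁅T 0 1, T 3 0 + T 3 1⁆ = 0 := by
    rw [← lie_skew, hT.triple 3 0 1 (by decide) (by decide) (by decide), neg_zero]
  have b₂ : ⁅T 0 2, T 3 0 + T 3 2⁆ = 0 := by
    rw [← lie_skew, hT.triple 3 0 2 (by decide) (by decide) (by decide), neg_zero]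
  have b₃ : ⁅T 1 2, T 3 1 + T 3 2⁆ = 0 := by
    rw [← lie_skew, hT.triple 3 1 2 (by decide) (by decide) (by decide), neg_zero]
  have c₁ : ⁅T 0 1, T 3 2⁆ = 0 := hT.comm _ _ _ _ (by decide) (by decide) (by decide) (by decide)
  have c₂ : ⁅T 0 2, T 3 1⁆ = 0 := hT.comm _ _ _ _ (by decide) (by decide) (by decide) (by decide)
  have c₃ : ⁅T 1 2, T 3 0⁆ = 0 := hT.comm _ _ _ _ (by decide) (by decide) (by decide) (by decide)
  have e₁ : ev₂ (T 3 0) (T 0 1 + T 0 2) f = ev₂ (T 3 0) (-T 3 0 - T 3 1 - T 3 2) f := by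
    rw [← ev₂_add_right hm hf (a := T 3 0) (b := -T 3 0 - T 3 1 - T 3 2)
      (d := T 3 0 + T 3 1 + T 3 2 + T 0 1 + T 0 2)]
    · congr 2; abel
    · calc ⁅T 3 0 + T 3 1 + T 3 2 + T 0 1 + T 0 2, T 3 0⁆ =
          ⁅T 3 0, T 3 0⁆ + ⁅T 3 1 + T 0 1, T 3 0⁆ + ⁅T 3 2 + T 0 2, T 3 0⁆ := by
            simp only [add_lie]; abel
        _ = 0 := by rw [a₁, a₂, lie_self]; simp
    · calc ⁅T 3 0 + T 3 1 + T 3 2 + T 0 1 + T 0 2, -T 3 0 - T 3 1 - T 3 2⁆ =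
          -(⁅T 3 0 + T 3 1 + T 3 2, T 3 0 + T 3 1 + T 3 2⁆ + (⁅T 0 1, T 3 0 + T 3 1⁆ +
            ⁅T 0 1, T 3 2⁆) + (⁅T 0 2, T 3 0 + T 3 2⁆ + ⁅T 0 2, T 3 1⁆)) := by
            simp only [add_lie, lie_add, lie_sub, lie_neg]; abel
        _ = 0 := by rw [b₁, b₂, c₁, c₂, lie_self]; simp
  have e₂ : ev₂ (T 3 0 + T 3 1) (T 0 2 + T 1 2) f =
      ev₂ (T 3 0 + T 3 1) (-T 3 0 - T 3 1 - T 3 2) f := by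
    rw [← ev₂_add_right hm hf (a := T 3 0 + T 3 1) (b := -T 3 0 - T 3 1 - T 3 2)
      (d := T 3 0 + T 3 1 + T 3 2 + T 0 2 + T 1 2)]
    · congr 2; abel
    · calc ⁅T 3 0 + T 3 1 + T 3 2 + T 0 2 + T 1 2, T 3 0 + T 3 1⁆ =
          ⁅T 3 0 + T 3 1, T 3 0 + T 3 1⁆ + ⁅T 3 2 + T 0 2, T 3 0⁆ + ⁅T 3 2 + T 1 2, T 3 1⁆ +
            ⁅T 0 2, T 3 1⁆ + ⁅T 1 2, T 3 0⁆ := by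
            simp only [add_lie, lie_add]; abel
        _ = 0 := by rw [a₂, a₃, c₂, c₃, lie_self]; simp
    · calc ⁅T 3 0 + T 3 1 + T 3 2 + T 0 2 + T 1 2, -T 3 0 - T 3 1 - T 3 2⁆ =
          -(⁅T 3 0 + T 3 1 + T 3 2, T 3 0 + T 3 1 + T 3 2⁆ + (⁅T 0 2, T 3 0 + T 3 2⁆ +
            ⁅T 0 2, T 3 1⁆) + (⁅T 1 2, T 3 1 + T 3 2⁆ + ⁅T 1 2, T 3 0⁆)) := by
            simp only [add_lie, lie_add, lie_sub, lie_neg]; abel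
        _ = 0 := by rw [b₂, b₃, c₂, c₃, lie_self]; simp
  have e₃ : ev₂ (T 3 0) (T 0 1) f = ev₂ (T 3 0) (-T 3 0 - T 3 1) f := by
    rw [← ev₂_add_right hm hf (a := T 3 0) (b := -T 3 0 - T 3 1) (d := T 3 0 + T 3 1 + T 0 1)]
    · congr 2; abel
    · calc ⁅T 3 0 + T 3 1 + T 0 1, T 3 0⁆ = ⁅T 3 0, T 3 0⁆ + ⁅T 3 1 + T 0 1, T 3 0⁆ := by
            simp only [add_lie]; abel
        _ = 0 := by rw [a₁, lie_self]; simp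
    · calc ⁅T 3 0 + T 3 1 + T 0 1, -T 3 0 - T 3 1⁆ =
          -(⁅T 3 0 + T 3 1, T 3 0 + T 3 1⁆ + ⁅T 0 1, T 3 0 + T 3 1⁆) := by
            simp only [add_lie, lie_add, lie_sub, lie_neg]; abel
        _ = 0 := by rw [b₁, lie_self]; simp
  change ev₂ (T 3 0) (T 0 1 + T 0 2) f + ev₂ (T 3 1 + T 0 1) (T 1 2) f -
    (ev₂ (T 0 1) (T 1 2) f + ev₂ (T 3 0 + T 3 1) (T 0 2 + T 1 2) f + ev₂ (T 3 0) (T 0 1) f) = _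
  rw [e₁, e₂, e₃, strandPart]
  abel

/-- The arguments t^{2,4} + t^{1,2} and t^{2,3} of the middle term both commute with t^{1,4}, so
that term disappears. -/
theorem lie_pentagon_rot {T : Fin 4 → Fin 4 → L} (hT : BraidFamily T) :
    ⁅pentagon (fun i j => T (rot i) (rot j)) f, T 3 0⁆ =
      ⁅strandPart (T 3 0) (T 3 1) (T 3 2) f, T 3 0⁆ - ⁅ev₂ (T 0 1) (T 1 2) f, T 3 0⁆ := by
  have h : ⁅T 3 0, ev₂ (T 3 1 + T 0 1) (T 1 2) f⁆ = 0 := by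
    refine lie_ev₂_zero ?_ ?_ f
    · have := hT.triple 1 3 0 (by decide) (by decide) (by decide)
      rw [hT.symm 1 3, hT.symm 1 0] at this
      rw [← lie_skew, this, neg_zero]
    · exact hT.comm _ _ _ _ (by decide) (by decide) (by decide) (by decide)
  rw [pentagon_rot hm hf hT, sub_lie, add_lie, ← lie_skew (ev₂ (T 3 1 + T 0 1) (T 1 2) f), h]
  abel

omit hm hf

/-- A derivation `D` of degree `d`. -/
def IsHomDer {n : ℕ} (d : ℕ)
    (D : LieDerivation k (FreeLieAlgebra k (Fin n)) (FreeLieAlgebra k (Fin n))) : Prop :=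
  ∀ m, ∀ a ∈ lieDeg k (letters k n) m, D a ∈ lieDeg k (letters k n) (d + m)

theorem isHomDer_tDer {n : ℕ} (i j : Fin n) : IsHomDer 1 (tDer k i j) := fun m a ha =>
  freeDer_mem (fun l => lie_mem_lieDeg k (of_mem l) (add_mem (by split_ifs <;> simp [of_mem])
    (by split_ifs <;> simp [of_mem]))) ha

theorem isHomDer_ev₂ {n : ℕ}
    {D E : LieDerivation k (FreeLieAlgebra k (Fin n)) (FreeLieAlgebra k (Fin n))}
    (hD : IsHomDer 1 D) (hE : IsHomDer 1 E) {m : ℕ} {f : FreeLieAlgebra k (Fin 2)}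
    (hf : f ∈ lieDeg k (letters k 2) m) : IsHomDer m (ev₂ D E f) := by
  refine free_induction (P := fun m f => IsHomDer m (ev₂ D E f)) ?_ ?_ ?_ ?_ ?_ hf
  · intro i; fin_cases i <;> simp [hD, hE]
  · intro p q a b _ _ h₁ h₂ m c hc
    rw [LieHom.map_lie, LieDerivation.lie_apply]
    refine sub_mem ?_ ?_
    · rw [add_assoc]; exact h₁ _ _ (h₂ _ _ hc)
    · rw [add_comm p, add_assoc]; exact h₂ _ _ (h₁ _ _ hc)
  · intro m p a _; simp
  · intro m a b h₁ h₂ p c hc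
    rw [map_add]; exact add_mem (h₁ _ _ hc) (h₂ _ _ hc)
  · intro m r a h p c hc
    rw [map_smul]; exact Submodule.smul_mem _ _ (h _ _ hc)

/-- Here τ forgets the last strand, so a - τ a lies in the ideal generated by the t^{i,4}, and by
`lie_strandHom` that ideal is the image of the free Lie algebra. The degree of the action of a is
carried along to control the degree of the preimage. -/
theorem sub_mem_range_strandHom {τ : Braid k 4 →ₗ⁅k⁆ Braid k 4}
    (h₀ : ∀ i : Fin 3, τ (braidGen k 3 i.castSucc) = 0)
    (h₁ : ∀ i j : Fin 3, τ (braidGen k i.castSucc j.castSucc) = braidGen k i.castSucc j.castSucc)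
    {m : ℕ} {a : Braid k 4} (ha : a ∈ lieDeg k (braidGens k 4) m) :
    (∃ l ∈ lieDeg k (letters k 3) m, a - τ a = strandHom k 3 l) ∧
      IsHomDer m (braidActHom k 3 a) := by
  induction ha using Submodule.span_induction with
  | mem a ha =>
    induction (show IsLieWord _ _ _ from ha) with
    | letter hs =>
      obtain ⟨i, j, -, rfl⟩ := hs
      have hT := braidFamily_braidGen k 4
      have hd : ∀ i : Fin 3, IsHomDer 1 (LieDerivation.ad k _ (FreeLieAlgebra.of k i)) :=
        fun i m a ha => by rw [ad_apply']; exact lie_mem_lieDeg k (of_mem i) ha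
      rw [braidActHom, braidLift_gen]
      induction i using Fin.lastCases with
      | last =>
        induction j using Fin.lastCases with
        | last =>
          rw [hT.diag, braidAct_last_last]
          exact ⟨⟨0, zero_mem _, by simp⟩, fun m a _ => by simp⟩
        | cast j =>
          rw [braidAct_last_left]
          exact ⟨⟨_, of_mem j, by rw [strandHom_of]; exact (congrArg _ (h₀ j)).trans (sub_zero _)⟩,
            hd j⟩
      | cast i =>
        induction j using Fin.lastCases with
        | last =>
          rw [braidAct_last_right, hT.symm]
          exact ⟨⟨_, of_mem i, by rw [strandHom_of]; exact (congrArg _ (h₀ i)).trans (sub_zero _)⟩,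
            hd i⟩
        | cast j =>
          rw [braidAct_castSucc, h₁]
          exact ⟨⟨0, zero_mem _, by simp⟩, isHomDer_tDer i j⟩
    | @bracket p q a b ha hb iha ihb =>
      obtain ⟨⟨l, hl, e⟩, hda⟩ := iha ‹_›
      obtain ⟨⟨l', hl', e'⟩, hdb⟩ := ihb ‹_›
      -- This preimage comes from [a, b] - [τa, τb] = [a, b - τb] - [b, a - τa] + [b - τb, a - τa].
      refine ⟨⟨braidActHom k 3 a l' - braidActHom k 3 b l + ⁅l', l⁆, ?_, ?_⟩, ?_⟩
      · refine add_mem (sub_mem (hda _ _ hl') ?_) ?_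
        · rw [add_comm]; exact hdb _ _ hl
        · rw [add_comm]; exact lie_mem_lieDeg k hl' hl
      · rw [map_add, map_sub, ← lie_strandHom, ← lie_strandHom, LieHom.map_lie, LieHom.map_lie,
          ← e, ← e']
        simp only [lie_sub, sub_lie]
        rw [← lie_skew b a, ← lie_skew b (τ a), ← lie_skew (τ b) a, ← lie_skew (τ b) (τ a)]
        abel
      · rw [LieHom.map_lie]
        intro r c hc
        rw [LieDerivation.lie_apply]
        refine sub_mem ?_ ?_
        · rw [add_assoc]; exact hda _ _ (hdb _ _ hc)
        · rw [add_comm p, add_assoc]; exact hdb _ _ (hda _ _ hc)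
  | zero => exact ⟨⟨0, zero_mem _, by simp⟩, fun r c _ => by simp⟩
  | add a b _ _ iha ihb =>
    obtain ⟨⟨l, hl, e⟩, hda⟩ := iha
    obtain ⟨⟨l', hl', e'⟩, hdb⟩ := ihb
    refine ⟨⟨l + l', add_mem hl hl', by rw [map_add, map_add, ← e, ← e']; abel⟩,
      fun r c hc => ?_⟩
    rw [map_add]; exact add_mem (hda _ _ hc) (hdb _ _ hc)
  | smul t a _ iha =>
    obtain ⟨⟨l, hl, e⟩, hda⟩ := iha
    refine ⟨⟨t • l, Submodule.smul_mem _ _ hl, by rw [map_smul, map_smul, ← e, smul_sub]⟩,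
      fun r c hc => ?_⟩
    rw [map_smul]; exact Submodule.smul_mem _ _ (hda _ _ hc)

/-- The generators of `t_4`, with those that involve the last strand replaced by zero. -/
def forgetLast (i j : Fin 4) : Braid k 4 := if i = 3 ∨ j = 3 then 0 else braidGen k i j

theorem braidFamily_forgetLast : BraidFamily (forgetLast (k := k)) := by
  have hT := braidFamily_braidGen k 4
  refine ⟨fun i => ?_, fun i j => ?_, fun i j p q h₁ h₂ h₃ h₄ => ?_, fun i j l h₁ h₂ h₃ => ?_⟩
  · simp [forgetLast, hT.diag]
  · simp only [forgetLast, or_comm, hT.symm i j]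
  · simp only [forgetLast]
    split_ifs <;> first | simp | exact hT.comm _ _ _ _ h₁ h₂ h₃ h₄
  · have h₄ := hT.triple i j l h₁ h₂ h₃
    have h₅ : ∀ i j l : Fin 4, i ≠ j → i ≠ l → j ≠ l →
        (j = 3 ∨ l = 3) ∨ (i ≠ 3 ∧ j ≠ 3 ∧ l ≠ 3) ∨ i = 3 := by
      intro i j l _ _ _; tauto
    rcases h₅ i j l h₁ h₂ h₃ with h | ⟨e₁, e₂, e₃⟩ | h
    · simp [forgetLast, h]
    · simpa [forgetLast, e₁, e₂, e₃] using h₄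
    · simp [forgetLast, h]

end Pentagon

/-! ### The pentagon as a formula for the action on a generator -/

section PentagonField

variable {k : Type u} [Field k]

local notation "x₁" => FreeLieAlgebra.of k (0 : Fin 3)
local notation "x₂" => FreeLieAlgebra.of k (1 : Fin 3)
local notation "x₃" => FreeLieAlgebra.of k (2 : Fin 3)

/-- The permutation of the strands of `t_4` that is given by `s` on the first three strands. -/
def extendPerm (s : Fin 3 → Fin 3) : Fin 4 → Fin 4 :=
  ![(s 0).castSucc, (s 1).castSucc, (s 2).castSucc, Fin.last 3]

theorem extendPerm_injective {s : Fin 3 → Fin 3} (hs : Function.Injective s) :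
    Function.Injective (extendPerm s) := by
  revert s; decide

theorem extendPerm_id (i : Fin 4) : extendPerm id i = i := by revert i; decide

/-- This is `lie_pentagon_rot` inside the derivations of lie_3, where the t^{i,4} become inner and
every bracket with an inner derivation is inner again. The map s relabels the first three strands,
so that one computation serves all generators. -/
theorem lie_pentagon_braidAct {s : Fin 3 → Fin 3} (hs : Function.Injective s) {m : ℕ} (hm : m ≠ 1)
    {f : FreeLieAlgebra k (Fin 2)} (hf : f ∈ lieDeg k (letters k 2) m) :
    ⁅pentagon (fun i j => braidAct k 3 (extendPerm s (rot i)) (extendPerm s (rot j))) f,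
        LieDerivation.ad k _ (FreeLieAlgebra.of k (s 0))⁆ =
      LieDerivation.ad k _ (⁅strandPart (FreeLieAlgebra.of k (s 0)) (FreeLieAlgebra.of k (s 1))
        (FreeLieAlgebra.of k (s 2)) f, FreeLieAlgebra.of k (s 0)⁆ -
        ev₂ (tDer k (s 0) (s 1)) (tDer k (s 1) (s 2)) f (FreeLieAlgebra.of k (s 0))) := by
  have h := lie_pentagon_rot hm hf
    ((braidFamily_braidAct (k := k) (n := 3)).comp (extendPerm_injective hs))
  have e₀ : braidAct k 3 (extendPerm s 3) (extendPerm s 0) =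
    LieDerivation.ad k _ (FreeLieAlgebra.of k (s 0)) := braidAct_last_left _
  have e₁ : braidAct k 3 (extendPerm s 3) (extendPerm s 1) =
    LieDerivation.ad k _ (FreeLieAlgebra.of k (s 1)) := braidAct_last_left _
  have e₂ : braidAct k 3 (extendPerm s 3) (extendPerm s 2) =
    LieDerivation.ad k _ (FreeLieAlgebra.of k (s 2)) := braidAct_last_left _
  have e₃ : braidAct k 3 (extendPerm s 0) (extendPerm s 1) = tDer k (s 0) (s 1) :=
    braidAct_castSucc _ _
  have e₄ : braidAct k 3 (extendPerm s 1) (extendPerm s 2) = tDer k (s 1) (s 2) :=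
    braidAct_castSucc _ _
  rw [e₀, e₁, e₂, e₃, e₄, lie_der_ad, ← map_strandPart,
    lie_der_ad (LieDerivation.ad k _ _), ad_apply', lie_der_ad (ev₂ _ _ f), ← map_sub] at h
  rw [lie_der_ad]
  exact h

variable [CharZero k]

theorem ad_eq_zero {n m : ℕ} [NeZero n] (hm : m ≠ 1) {a : FreeLieAlgebra k (Fin n)}
    (ha : a ∈ lieDeg k (letters k n) m) (h : LieDerivation.ad k _ a = 0) : a = 0 := by
  refine eq_zero_of_lie_of_eq_zero 0 hm ha ?_
  rw [← lie_skew, ← ad_apply' (k := k), h, LieDerivation.zero_apply, neg_zero]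

/-- The pentagon equation determines the action of `ψ(t^{i,j}, t^{j,l})` on `x_i`. -/
theorem tDer_apply_of_pentagon {s : Fin 3 → Fin 3} (hs : Function.Injective s) {m : ℕ} (hm : m ≠ 1)
    {f : FreeLieAlgebra k (Fin 2)} (hf : f ∈ lieDeg k (letters k 2) m)
    (h : pentagon (braidGen k) f = 0) :
    ev₂ (tDer k (s 0) (s 1)) (tDer k (s 1) (s 2)) f (FreeLieAlgebra.of k (s 0)) =
      ⁅strandPart (FreeLieAlgebra.of k (s 0)) (FreeLieAlgebra.of k (s 1))
        (FreeLieAlgebra.of k (s 2)) f, FreeLieAlgebra.of k (s 0)⁆ := by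
  -- The compared elements have degree m + 1, and ad is only known to be injective away from degree
  -- one; so m = 0 is treated apart.
  rcases m with _ | m
  · rw [lieDeg_zero, Submodule.mem_bot] at hf
    simp [hf, strandPart]
  have := lie_pentagon_braidAct hs hm hf
  rw [pentagon_eq_zero_of_braid h ((braidFamily_braidAct.comp (extendPerm_injective hs)).comp
    rot_injective), zero_lie] at this
  refine (sub_eq_zero.1 (ad_eq_zero (m := m + 1 + 1) (by omega) (sub_mem ?_ ?_) this.symm)).symm
  · exact lie_mem_lieDeg k (strandPart_mem (of_mem _) (of_mem _) (of_mem _) hf) (of_mem _)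
  · exact isHomDer_ev₂ (isHomDer_tDer _ _) (isHomDer_tDer _ _) hf _ _ (of_mem _)

/-- The rotated pentagon vanishes when the last strand is forgotten, so it is the image of some l in
lie_3, and it acts on lie_3 as ad l. The hypothesis says that l commutes with x_1, hence l = 0.
Faithfulness of the action of the whole of t_4 is not needed. -/
theorem pentagon_eq_zero_of_apply {m : ℕ} (hm : m ≠ 1) {f : FreeLieAlgebra k (Fin 2)}
    (hf : f ∈ lieDeg k (letters k 2) m)
    (h : ev₂ (tDer k 0 1) (tDer k 1 2) f x₁ = ⁅strandPart x₁ x₂ x₃ f, x₁⁆) :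
    pentagon (braidGen k) f = 0 := by
  have hT := braidFamily_braidGen k 4
  suffices hp : pentagon (fun i j => braidGen k (rot i) (rot j)) f = 0 by
    let T := fun i j => braidGen k (rotInv i) (rotInv j)
    have h₁ := map_pentagon (braidLift (k := k) (hT.comp rotInv_injective))
      (fun i j => braidGen k (rot i) (rot j)) f
    rw [hp, map_zero] at h₁
    have h₂ : ∀ i, rotInv (rot i) = i := by decide
    simpa [h₂] using h₁.symm
  have hmem : ∀ i j : Fin 4, braidGen k i j ∈ lieDeg k (braidGens k 4) 1 := fun i j => by
    by_cases e : i = j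
    · subst e; rw [hT.diag]; exact zero_mem _
    · exact Submodule.subset_span (.letter ⟨i, j, e, rfl⟩)
  have hpm := pentagon_mem (fun i j => hmem (rot i) (rot j)) hf
  obtain ⟨⟨l, hl, e⟩, -⟩ := sub_mem_range_strandHom (τ := braidLift (k := k) (braidFamily_forgetLast (k := k)))
    (fun i => by simp [forgetLast])
    (fun i j => by rw [braidLift_gen, forgetLast, if_neg]; revert i j; decide) hpm
  -- Without the last strand the first arguments of the strand part are 0, and the two remaining
  -- terms of the rotated pentagon coincide.
  have hτ : braidLift (k := k) (braidFamily_forgetLast (k := k))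
      (pentagon (fun i j => braidGen k (rot i) (rot j)) f) = 0 := by
    rw [map_pentagon]
    simp only [braidLift_gen]
    have h₀ : ∀ a : Braid k 4, ev₂ 0 a f = 0 := fun a => ev₂_eq_zero (by simp) hm hf
    rw [pentagon_rot hm hf braidFamily_forgetLast, strandPart]
    have e₀ : forgetLast (k := k) 3 0 = 0 := by simp [forgetLast]
    have e₁ : forgetLast (k := k) 3 1 = 0 := by simp [forgetLast]
    rw [e₀, e₁, zero_add, zero_add, h₀, h₀]
    simp
  rw [hτ, sub_zero] at e
  have h₄ := lie_pentagon_braidAct (s := id) Function.injective_id hm hf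
  simp only [extendPerm_id, id_eq] at h₄
  have h₅ : ∀ i j, braidActHom k 3 (braidGen k i j) = braidAct k 3 i j := fun i j => by
    rw [braidActHom, braidLift_gen]
  have h₆ := map_pentagon (braidActHom k 3) (fun i j => braidGen k (rot i) (rot j)) f
  simp only [h₅] at h₆
  rw [← h₆, e, braidActHom_strandHom, h, sub_self, map_zero,
    lie_der_ad, ad_apply'] at h₄
  rcases m with _ | m
  · rw [lieDeg_zero, Submodule.mem_bot] at hf
    simp [hf, pentagon]
  have h₇ := ad_eq_zero (k := k) (m := m + 1 + 1) (by omega) (lie_mem_lieDeg k hl (of_mem _)) h₄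
  have h₈ : l = 0 := eq_zero_of_lie_of_eq_zero 0 hm hl (by rw [← lie_skew, h₇, neg_zero])
  rw [e, h₈, map_zero]

end PentagonField

/-! ### Solutions of the antisymmetry, hexagon and pentagon equations -/

section GRT

variable {k : Type u} [CommRing k] {L : Type v} [LieRing L] [LieAlgebra k L]

local notation "x" => FreeLieAlgebra.of k (0 : Fin 2)
local notation "y" => FreeLieAlgebra.of k (1 : Fin 2)
local notation "x₁" => FreeLieAlgebra.of k (0 : Fin 3)
local notation "x₂" => FreeLieAlgebra.of k (1 : Fin 3)
local notation "x₃" => FreeLieAlgebra.of k (2 : Fin 3)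

/-- The defining equations of `grt` for a Lie polynomial. -/
structure IsGRTPoly (f : FreeLieAlgebra k (Fin 2)) : Prop where
  antisymm : f = -ev₂ y x f
  hexagon : ev₂ x y f + ev₂ y (-x - y) f + ev₂ (-x - y) x f = 0
  pentagon : pentagon (braidGen k) f = 0

theorem ev₂_antisymm {f : FreeLieAlgebra k (Fin 2)} (hf : f = -ev₂ y x f) (a b : L) :
    ev₂ a b f = -ev₂ b a f := by
  have := congrArg (ev₂ a b) hf
  rwa [map_neg, map_ev₂, ev₂_x, ev₂_y] at this

theorem ev₂_hexagon {f : FreeLieAlgebra k (Fin 2)}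
    (hf : ev₂ x y f + ev₂ y (-x - y) f + ev₂ (-x - y) x f = 0) (a b : L) :
    ev₂ a b f + ev₂ b (-a - b) f + ev₂ (-a - b) a f = 0 := by
  have := congrArg (ev₂ a b) hf
  simpa only [map_add, map_sub, map_neg, map_ev₂, ev₂_x, ev₂_y, map_zero] using this

theorem mem_lieDeg_one {f : FreeLieAlgebra k (Fin 2)} (hf : f ∈ lieDeg k (letters k 2) 1) :
    ∃ s t : k, f = s • x + t • y := by
  refine free_induction (P := fun m f => m = 1 → ∃ s t : k, f = s • x + t • y)
    ?_ ?_ ?_ ?_ ?_ hf rfl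
  · intro i _
    fin_cases i
    · exact ⟨1, 0, by simp⟩
    · exact ⟨0, 1, by simp⟩
  · intro p q a b ha hb _ _ h
    refine ⟨0, 0, ?_⟩
    obtain rfl | rfl : p = 0 ∨ q = 0 := by omega
    · rw [lieDeg_zero, Submodule.mem_bot] at ha
      simp [ha]
    · rw [lieDeg_zero, Submodule.mem_bot] at hb
      simp [hb]
  · intro m _; exact ⟨0, 0, by simp⟩
  · intro m a b ha hb h
    obtain ⟨s, t, rfl⟩ := ha h
    obtain ⟨s', t', rfl⟩ := hb h
    exact ⟨s + s', t + t', by module⟩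
  · intro m c a ha h
    obtain ⟨s, t, rfl⟩ := ha h
    exact ⟨c * s, c * t, by module⟩

section Linear

attribute [local instance 100] LieRing.ofAssociativeRing

/-- The pentagon equation has no solutions of degree one. -/
theorem eq_zero_of_pentagon {f : FreeLieAlgebra k (Fin 2)} (hf : f ∈ lieDeg k (letters k 2) 1)
    (h : pentagon (braidGen k) f = 0) : f = 0 := by
  obtain ⟨s, t, rfl⟩ := mem_lieDeg_one hf
  -- Degree one is detected in the abelian Lie algebra k, where any symmetric matrix with zero
  -- diagonal satisfies the braid relations.
  have hT : ∀ T : Fin 4 → Fin 4 → k, (∀ i, T i i = 0) → (∀ i j, T i j = T j i) →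
      BraidFamily T := fun T h₁ h₂ =>
    ⟨h₁, h₂, fun _ _ _ _ _ _ _ _ => by rw [LieRing.of_associative_ring_bracket, mul_comm, sub_self],
      fun _ _ _ _ _ _ => by rw [LieRing.of_associative_ring_bracket, mul_comm, sub_self]⟩
  have e : ∀ T : Fin 4 → Fin 4 → k, (∀ i, T i i = 0) → (∀ i j, T i j = T j i) →
      s * T 0 1 + t * T 2 3 = 0 := fun T h₁ h₂ => by
    have := pentagon_eq_zero_of_braid h (hT T h₁ h₂)
    simp only [pentagon, map_add, map_smul, ev₂_x, ev₂_y, smul_eq_mul] at this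
    linear_combination -this
  -- With indices in {0, 1, 2, 3}, the only pair of distinct indices with sum 1 is {0, 1}, and the
  -- only one with sum 5 is {2, 3}. These two matrices isolate s and t.
  have hs := e (fun i j => if (i : ℕ) + j = 1 then 1 else 0) (fun i => if_neg (by omega))
    (fun i j => by simp only [add_comm])
  have ht := e (fun i j => if (i : ℕ) + j = 5 then 1 else 0) (fun i => if_neg (by omega))
    (fun i j => by simp only [add_comm])
  simp at hs ht
  simp [hs, ht]

end Linear

/-! ### The special derivation given by a solution -/

/-- The tangential derivation of the free Lie algebra given by a tuple. -/
def tanDer {n : ℕ} (a : Fin n → FreeLieAlgebra k (Fin n)) :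
    LieDerivation k (FreeLieAlgebra k (Fin n)) (FreeLieAlgebra k (Fin n)) :=
  freeDer fun i => ⁅FreeLieAlgebra.of k i, a i⁆

@[simp] theorem tanDer_of {n : ℕ} (a : Fin n → FreeLieAlgebra k (Fin n)) (i : Fin n) :
    tanDer a (FreeLieAlgebra.of k i) = ⁅FreeLieAlgebra.of k i, a i⁆ := freeDer_of _ _

theorem tanDer_add {n : ℕ} (a b : Fin n → FreeLieAlgebra k (Fin n)) :
    tanDer (a + b) = tanDer a + tanDer b :=
  free_der_ext fun i => by simp

theorem tanDer_sub {n : ℕ} (a b : Fin n → FreeLieAlgebra k (Fin n)) :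
    tanDer (a - b) = tanDer a - tanDer b :=
  free_der_ext fun i => by simp

/-- The element `ψ(-a-b, a)`. -/
def nuVal (f : FreeLieAlgebra k (Fin 2)) (a b : L) : L := ev₂ (-a - b) a f

theorem map_nuVal {L' : Type w} [LieRing L'] [LieAlgebra k L'] (h : L →ₗ⁅k⁆ L')
    (f : FreeLieAlgebra k (Fin 2)) (a b : L) : h (nuVal f a b) = nuVal f (h a) (h b) := by
  simp only [nuVal, map_ev₂, map_sub, map_neg]

theorem nuVal_mem {S : Set L} {a b : L} (ha : a ∈ lieDeg k S 1) (hb : b ∈ lieDeg k S 1) {m : ℕ}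
    {f : FreeLieAlgebra k (Fin 2)} (hf : f ∈ lieDeg k (letters k 2) m) :
    nuVal f a b ∈ lieDeg k S m :=
  ev₂_mem (sub_mem (neg_mem ha) hb) ha hf

/-- The tuple `(ψ(-x-y, x), ψ(-x-y, y))`. -/
def nuTuple (f : FreeLieAlgebra k (Fin 2)) : Fin 2 → FreeLieAlgebra k (Fin 2) :=
  ![nuVal f x y, nuVal f y x]

/-- The tuple of `Ψ^{2,3} + Ψ^{1,23}`, where `Ψ = (ψ(-x-y, x), ψ(-x-y, y))`. -/
def rightTuple (f : FreeLieAlgebra k (Fin 2)) : Fin 3 → FreeLieAlgebra k (Fin 3) :=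
  ![nuVal f x₁ (x₂ + x₃), nuVal f x₂ x₃ + nuVal f (x₂ + x₃) x₁,
    nuVal f x₃ x₂ + nuVal f (x₂ + x₃) x₁]

/-- The tuple of `Ψ^{1,2} + Ψ^{12,3}`, where `Ψ = (ψ(-x-y, x), ψ(-x-y, y))`. -/
def leftTuple (f : FreeLieAlgebra k (Fin 2)) : Fin 3 → FreeLieAlgebra k (Fin 3) :=
  ![nuVal f x₁ x₂ + nuVal f (x₁ + x₂) x₃, nuVal f x₂ x₁ + nuVal f (x₁ + x₂) x₃,
    nuVal f x₃ (x₁ + x₂)]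

/-- Antisymmetry exchanges the arguments in each of the three terms, which turns the strand part
into minus the first entry of `rightTuple f - leftTuple f`, evaluated at (a, b, c). -/
theorem lie_strandPart {f : FreeLieAlgebra k (Fin 2)} (hf : f = -ev₂ y x f) (a b c d : L) :
    ⁅strandPart a b c f, d⁆ = ⁅d, nuVal f a (b + c) - nuVal f (a + b) c - nuVal f a b⁆ := by
  have h : strandPart a b c f = -(nuVal f a (b + c) - nuVal f (a + b) c - nuVal f a b) := by
    rw [strandPart, nuVal, nuVal, nuVal, ev₂_antisymm hf a (-a - b - c),
      ev₂_antisymm hf (a + b) (-a - b - c), ev₂_antisymm hf a (-a - b), ← sub_sub (-a) b c,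
      neg_add' a b]
    abel
  rw [h, neg_lie, lie_skew]

end GRT

section GRTField

variable {k : Type u} [Field k] [CharZero k]

local notation "x" => FreeLieAlgebra.of k (0 : Fin 2)
local notation "y" => FreeLieAlgebra.of k (1 : Fin 2)
local notation "x₁" => FreeLieAlgebra.of k (0 : Fin 3)
local notation "x₂" => FreeLieAlgebra.of k (1 : Fin 3)
local notation "x₃" => FreeLieAlgebra.of k (2 : Fin 3)
local notation "ρ" => tDer k (n := 3)

/-- `Ψ^{2,3} + Ψ^{1,23} - Ψ^{1,2} - Ψ^{12,3} = ψ(t^{1,2}, t^{2,3})`. -/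
theorem IsGRTPoly.tanDer_eq {f : FreeLieAlgebra k (Fin 2)} (h : IsGRTPoly f) {m : ℕ} (hm : m ≠ 1)
    (hf : f ∈ lieDeg k (letters k 2) m) :
    tanDer (rightTuple f - leftTuple f) = ev₂ (ρ 0 1) (ρ 1 2) f := by
  have key : ∀ {i j l : Fin 3}, Function.Injective ![i, j, l] →
      ev₂ (ρ i j) (ρ j l) f (FreeLieAlgebra.of k i) =
        ⁅FreeLieAlgebra.of k i,
          nuVal f (FreeLieAlgebra.of k i) (FreeLieAlgebra.of k j + FreeLieAlgebra.of k l) -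
          nuVal f (FreeLieAlgebra.of k i + FreeLieAlgebra.of k j) (FreeLieAlgebra.of k l) -
          nuVal f (FreeLieAlgebra.of k i) (FreeLieAlgebra.of k j)⁆ := by
    intro i j l hs
    rw [← lie_strandPart h.antisymm]
    exact tDer_apply_of_pentagon hs hm hf h.pentagon
  have hT := braidFamily_tDer (k := k) (n := 3)
  refine free_der_ext fun i => ?_
  rw [tanDer_of]
  fin_cases i
  · refine Eq.trans ?_ (key (i := 0) (j := 1) (l := 2) (by decide)).symm
    congr 1
    simp only [rightTuple, leftTuple, Pi.sub_apply]
    change _ - (nuVal f x₁ x₂ + nuVal f (x₁ + x₂) x₃) = _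
    change nuVal f x₁ (x₂ + x₃) - _ = _
    abel
  · have e₁ := key (i := 1) (j := 2) (l := 0) (by decide)
    have e₂ := key (i := 1) (j := 0) (l := 2) (by decide)
    have a₁ : ⁅ρ 0 1 + ρ 0 2, ρ 1 2⁆ = 0 :=
      hT.triple 0 1 2 (by decide) (by decide) (by decide)
    have a₂ : ⁅ρ 1 2 + ρ 0 2, ρ 0 1⁆ = 0 := by
      have := hT.triple 2 0 1 (by decide) (by decide) (by decide)
      rwa [hT.symm 2 0, hT.symm 2 1, add_comm] at this
    have c₁ : ⁅ρ 0 1 + ρ 1 2 + ρ 0 2, ρ 1 2⁆ = 0 := by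
      rw [add_right_comm, add_lie, a₁, lie_self, add_zero]
    have c₂ : ⁅ρ 0 1 + ρ 1 2 + ρ 0 2, ρ 0 1⁆ = 0 := by
      rw [add_assoc, add_lie, a₂, lie_self, add_zero]
    have c₃ : ⁅ρ 0 1 + ρ 1 2 + ρ 0 2, -ρ 0 1 - ρ 1 2⁆ = 0 := by
      rw [lie_sub, lie_neg, c₁, c₂]; simp
    have hex := ev₂_hexagon h.hexagon (ρ 0 1) (ρ 1 2)
    have b₁ : ev₂ (ρ 1 2) (-ρ 0 1 - ρ 1 2) f =
        ev₂ (ρ 1 2) (ρ 2 0) f := by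
      rw [← ev₂_add_right hm hf c₁ c₃, hT.symm 2 0]
      congr 2; abel
    have b₂ : ev₂ (-ρ 0 1 - ρ 1 2) (ρ 0 1) f =
        -ev₂ (ρ 1 0) (ρ 0 2) f := by
      rw [ev₂_antisymm h.antisymm, ← ev₂_add_right hm hf c₂ c₃, hT.symm 1 0]
      congr 3; abel
    rw [b₁, b₂] at hex
    have hex' : ev₂ (ρ 0 1) (ρ 1 2) f =
        ev₂ (ρ 1 0) (ρ 0 2) f - ev₂ (ρ 1 2) (ρ 2 0) f := by
      rw [← sub_eq_zero, ← hex]; abel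
    rw [hex', LieDerivation.sub_apply]
    refine Eq.trans ?_ (congrArg₂ (· - ·) e₂ e₁).symm
    dsimp only
    rw [← lie_sub]
    congr 1
    simp only [rightTuple, leftTuple, Pi.sub_apply]
    change (nuVal f x₂ x₃ + nuVal f (x₂ + x₃) x₁) - (nuVal f x₂ x₁ + nuVal f (x₁ + x₂) x₃) = _
    rw [add_comm x₁ x₃, add_comm x₂ x₁]
    abel
  -- On the last generator antisymmetry suffices: ψ(t^{1,2}, t^{2,3}) = -ψ(t^{3,2}, t^{2,1}).
  · have e := key (i := 2) (j := 1) (l := 0) (by decide)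
    rw [ev₂_antisymm h.antisymm, LieDerivation.neg_apply, hT.symm 1 2, hT.symm 0 1]
    refine Eq.trans ?_ (congrArg Neg.neg e).symm
    rw [← lie_neg]
    congr 1
    simp only [rightTuple, leftTuple, Pi.sub_apply]
    change (nuVal f x₃ x₂ + nuVal f (x₂ + x₃) x₁) - nuVal f x₃ (x₁ + x₂) = _
    rw [add_comm x₃ x₂, add_comm x₂ x₁]
    abel

end GRTField

/-! ### Symmetric two-cocycles of the free Lie algebra -/

section Cocycle

variable {k : Type u} [CommRing k] {L : Type v} [LieRing L] [LieAlgebra k L]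

/-- The series `a + ε b`. -/
def epsElt (a b : L) : LieSeries L :=
  LieSeries.mk fun m => if m = 0 then a else if m = 1 then b else 0

theorem epsElt_add (a b c d : L) : epsElt a b + epsElt c d = epsElt (a + c) (b + d) := by
  ext m
  simp only [epsElt, LieSeries.add_apply, LieSeries.mk_apply]
  split_ifs <;> simp

theorem epsElt_lie_self (a : L) (s t s' t' : k) :
    ⁅epsElt (s • a) (t • a), epsElt (s' • a) (t' • a)⁆ = 0 := by
  ext m
  rw [LieSeries.lie_apply, LieSeries.zero_apply]
  refine Finset.sum_eq_zero fun p _ => ?_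
  simp only [epsElt, LieSeries.mk_apply]
  split_ifs <;> simp

/-- The part of `f(a, ε b)` that is linear in `ε`. -/
def linPart (a b : L) (f : FreeLieAlgebra k (Fin 2)) : L := ev₂ (epsElt a 0) (epsElt 0 b) f 1

theorem lieSeries_lie_zero (f g : LieSeries L) : ⁅f, g⁆ 0 = ⁅f 0, g 0⁆ := by
  simp [LieSeries.lie_apply]

theorem lieSeries_lie_one (f g : LieSeries L) : ⁅f, g⁆ 1 = ⁅f 0, g 1⁆ + ⁅f 1, g 0⁆ := by
  simp [LieSeries.lie_apply, Finset.Nat.antidiagonal_succ]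

theorem linPart_add (a b c : L) (f : FreeLieAlgebra k (Fin 2)) :
    linPart a (b + c) f = linPart a b f + linPart a c f := by
  -- The constant term in ε does not depend on the second argument, so the linear term of a bracket
  -- is additive in b.
  have h₀ : ∀ (f : FreeLieAlgebra k (Fin 2)) (b c : L), ev₂ (epsElt a 0) (epsElt 0 b) f 0 =
      ev₂ (epsElt a 0) (epsElt 0 c) f 0 := by
    intro f b c
    induction f using free_top_induction with
    | of i => fin_cases i <;> simp [epsElt]
    | lie f g hf hg =>
      rw [LieHom.map_lie, LieHom.map_lie, lieSeries_lie_zero, lieSeries_lie_zero, hf, hg]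
    | zero => simp
    | add f g hf hg => rw [map_add, map_add, LieSeries.add_apply, LieSeries.add_apply, hf, hg]
    | smul t f hf => rw [map_smul, map_smul, LieSeries.smul_apply, LieSeries.smul_apply, hf]
  induction f using free_top_induction with
  | of i => fin_cases i <;> simp [linPart, epsElt]
  | lie f g hf hg =>
    simp only [linPart] at hf hg ⊢
    rw [LieHom.map_lie, LieHom.map_lie, LieHom.map_lie, lieSeries_lie_one, lieSeries_lie_one,
      lieSeries_lie_one, hf, hg, h₀ f (b + c) c, h₀ f b c, h₀ g (b + c) c, h₀ g b c, lie_add,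
      add_lie]
    abel
  | zero => simp [linPart]
  | add f g hf hg =>
    simp only [linPart, map_add, LieSeries.add_apply] at hf hg ⊢
    rw [hf, hg]
    abel
  | smul t f hf =>
    simp only [linPart, map_smul, LieSeries.smul_apply] at hf ⊢
    rw [hf, smul_add]

theorem linPart_self {m : ℕ} (hm : m ≠ 1) {f : FreeLieAlgebra k (Fin 2)}
    (hf : f ∈ lieDeg k (letters k 2) m) (a : L) : linPart a a f = 0 := by
  have h := epsElt_lie_self (k := k) a 1 0 0 1
  simp only [one_smul, zero_smul] at h
  rw [linPart, ev₂_eq_zero h hm hf, LieSeries.zero_apply]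

local notation "x" => FreeLieAlgebra.of k (0 : Fin 2)
local notation "y" => FreeLieAlgebra.of k (1 : Fin 2)
local notation "x₁" => FreeLieAlgebra.of k (0 : Fin 3)
local notation "x₂" => FreeLieAlgebra.of k (1 : Fin 3)
local notation "x₃" => FreeLieAlgebra.of k (2 : Fin 3)

theorem freeDer_euler {n m : ℕ} {f : FreeLieAlgebra k (Fin n)} (hf : f ∈ lieDeg k (letters k n) m) :
    freeDer (FreeLieAlgebra.of k) f = (m : k) • f := by
  refine free_induction (P := fun m f => freeDer (FreeLieAlgebra.of k) f = (m : k) • f)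
    ?_ ?_ ?_ ?_ ?_ hf
  · intro i; simp
  · intro p q a b _ _ h₁ h₂
    rw [LieDerivation.apply_lie_eq_add, h₁, h₂, lie_smul, smul_lie, Nat.cast_add, add_smul, add_comm]
  · intro m; simp
  · intro m a b h₁ h₂; rw [map_add, h₁, h₂, smul_add]
  · intro m c a h; rw [map_smul, h, smul_comm]

theorem freeDer_two (a b : FreeLieAlgebra k (Fin 2)) (f : FreeLieAlgebra k (Fin 2)) :
    freeDer ![a, b] f = ev₂ (epsElt x a) (epsElt y b) f 1 := by
  change freeDerAux ![a, b] f 1 = _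
  refine congrArg (fun g : LieSeries _ => g 1)
    (lie_hom_ext (f := freeDerAux ![a, b]) (g := ev₂ _ _) (fun i => ?_) f)
  rw [freeDerAux, FreeLieAlgebra.lift_of_apply]
  fin_cases i <;> simp [epsElt]

theorem three_vars {f : FreeLieAlgebra k (Fin 2)}
    (h : ev₂ x₂ x₃ f - ev₂ (x₁ + x₂) x₃ f + ev₂ x₁ (x₂ + x₃) f - ev₂ x₁ x₂ f = 0) (a b c : L) :
    ev₂ b c f - ev₂ (a + b) c f + ev₂ a (b + c) f - ev₂ a b f = 0 := by
  have := congrArg (FreeLieAlgebra.lift k ![a, b, c]) h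
  simpa [map_ev₂] using this

/-- A symmetric Lie polynomial `f` of degree at least two with
`f(y, z) - f(x + y, z) + f(x, y + z) - f(x, y) = 0` vanishes. -/
theorem smul_eq_zero_of_cocycle {m : ℕ} (hm : m ≠ 1) {f : FreeLieAlgebra k (Fin 2)}
    (hf : f ∈ lieDeg k (letters k 2) m) (hs : ev₂ y x f = f)
    (h : ev₂ x₂ x₃ f - ev₂ (x₁ + x₂) x₃ f + ev₂ x₁ (x₂ + x₃) f - ev₂ x₁ x₂ f = 0) :
    (m : k) • f = 0 := by
  -- The cocycle equation at (a, b, εb), to first order in ε. The term f(b, εb) is zero because its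
  -- arguments commute.
  have key : ∀ a b : FreeLieAlgebra k (Fin 2),
      ev₂ (epsElt a 0) (epsElt b b) f 1 = linPart (a + b) b f + ev₂ (epsElt a 0) (epsElt b 0) f 1 := by
    intro a b
    have h₁ := three_vars h (epsElt a 0) (epsElt b 0) (epsElt 0 b)
    have h₂ := epsElt_lie_self (k := k) b 1 0 0 1
    simp only [one_smul, zero_smul] at h₂
    rw [ev₂_eq_zero h₂ hm hf, epsElt_add, epsElt_add] at h₁
    simp only [add_zero, zero_add] at h₁
    have h₃ := congrArg (fun g : LieSeries _ => g 1) h₁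
    simp only [LieSeries.add_apply, LieSeries.sub_apply, LieSeries.zero_apply] at h₃
    rw [zero_sub, neg_add_eq_sub, sub_sub, sub_eq_zero] at h₃
    exact h₃
  have hsymm : ∀ a b : LieSeries (FreeLieAlgebra k (Fin 2)), ev₂ b a f = ev₂ a b f := by
    intro a b
    have := congrArg (ev₂ a b) hs
    rwa [map_ev₂, ev₂_x, ev₂_y] at this
  have k₁ := key x y
  have k₂ := key y x
  rw [hsymm (epsElt x x), hsymm (epsElt x 0), ← freeDer_two] at k₂
  rw [← freeDer_two, ← freeDer_two] at k₁
  rw [← freeDer_two] at k₂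
  have e : ∀ a b, freeDer (k := k) ![a, b] f = freeDer ![a, 0] f + freeDer ![0, b] f := by
    intro a b
    have : freeDer (k := k) ![a, b] = freeDer ![a, 0] + freeDer ![0, b] :=
      free_der_ext fun i => by fin_cases i <;> simp
    rw [this, LieDerivation.add_apply]
  have e₀ : freeDer (k := k) ![(0 : FreeLieAlgebra k (Fin 2)), 0] f = 0 := by
    simpa using e 0 0
  rw [e₀, add_zero] at k₁ k₂
  have e₁ := freeDer_euler hf
  have e₂ : FreeLieAlgebra.of k = ![x, y] := by
    funext i; fin_cases i <;> rfl
  -- By Euler's formula m f is the sum of the partial derivatives along x and y. By `key` and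
  -- symmetry these are the ε-linear parts of f(x + y, εx) and f(x + y, εy). Their sum is that of
  -- f(x + y, ε(x + y)), whose arguments commute.
  rw [← e₁, e₂, e, k₁, k₂, add_comm y x, ← linPart_add, linPart_self hm hf]

/-- The value of `ν(ψ)` on `x + y`. -/
def specialDefect (f : FreeLieAlgebra k (Fin 2)) (a b : L) : L :=
  ⁅a, nuVal f a b⁆ + ⁅b, nuVal f b a⁆

theorem ev₂_specialDefect (f : FreeLieAlgebra k (Fin 2)) (a b : L) :
    ev₂ a b (specialDefect f x y) = specialDefect f a b := by
  simp only [specialDefect, map_add, LieHom.map_lie, map_nuVal, ev₂_x, ev₂_y]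

end Cocycle

/-! ### Specialness of ν(ψ) -/

section Special

variable {k : Type u} [Field k] [CharZero k] {L : Type v} [LieRing L] [LieAlgebra k L]

local notation "x" => FreeLieAlgebra.of k (0 : Fin 2)
local notation "y" => FreeLieAlgebra.of k (1 : Fin 2)
local notation "x₁" => FreeLieAlgebra.of k (0 : Fin 3)
local notation "x₂" => FreeLieAlgebra.of k (1 : Fin 3)
local notation "x₃" => FreeLieAlgebra.of k (2 : Fin 3)

/-- Evaluating `IsGRTPoly.tanDer_eq` on x_1 + x_2 + x_3, which t^{1,2} and t^{2,3} annihilate, gives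
the 2-cocycle equation for the defect. The defect is visibly symmetric, so it vanishes in degree at
least two. -/
theorem IsGRTPoly.specialDefect_eq_zero {f : FreeLieAlgebra k (Fin 2)} (h : IsGRTPoly f) {m : ℕ}
    (hf : f ∈ lieDeg k (letters k 2) m) (a b : L) : specialDefect f a b = 0 := by
  by_cases hm : m = 1
  · subst hm
    rw [eq_zero_of_pentagon hf h.pentagon]
    simp [specialDefect, nuVal]
  suffices hs : specialDefect f x y = 0 by rw [← ev₂_specialDefect, hs, map_zero]
  have hmem : specialDefect f x y ∈ lieDeg k (letters k 2) (1 + m) :=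
    add_mem (lie_mem_lieDeg k (of_mem _) (nuVal_mem (of_mem _) (of_mem _) hf))
      (lie_mem_lieDeg k (of_mem _) (nuVal_mem (of_mem _) (of_mem _) hf))
  rcases m with _ | m
  · rw [lieDeg_zero, Submodule.mem_bot] at hf
    simp [hf, specialDefect, nuVal]
  have e := h.tanDer_eq hm hf
  have hz : ∀ D : LieDerivation k (FreeLieAlgebra k (Fin 3)) (FreeLieAlgebra k (Fin 3)),
      D (x₁ + x₂ + x₃) = D x₁ + D x₂ + D x₃ := fun D => by rw [map_add, map_add]
  have hzero : ∀ (g : FreeLieAlgebra k (Fin 2)),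
      ev₂ (tDer k 0 1) (tDer k 1 2) g (x₁ + x₂ + x₃) = 0 := by
    intro g
    induction g using free_top_induction with
    | of i =>
      fin_cases i
      · change ev₂ (tDer k 0 1) (tDer k 1 2) x _ = 0
        rw [ev₂_x, map_add, tDer_sum, tDer_of_ne (by decide) (by decide), add_zero]
      · change ev₂ (tDer k 0 1) (tDer k 1 2) y _ = 0
        rw [ev₂_y, add_assoc, map_add, tDer_sum, tDer_of_ne (by decide) (by decide), add_zero]
    | lie a b ha hb => rw [LieHom.map_lie, LieDerivation.lie_apply, ha, hb]; simp
    | zero => simp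
    | add a b ha hb => rw [map_add (ev₂ _ _), LieDerivation.add_apply, ha, hb, add_zero]
    | smul c a ha => rw [map_smul (ev₂ _ _), LieDerivation.smul_apply, ha, smul_zero]
  have e₁ := hzero f
  rw [← e, hz, tanDer_of, tanDer_of, tanDer_of] at e₁
  simp only [Pi.sub_apply] at e₁
  change ⁅x₁, nuVal f x₁ (x₂ + x₃) - (nuVal f x₁ x₂ + nuVal f (x₁ + x₂) x₃)⁆ +
    ⁅x₂, (nuVal f x₂ x₃ + nuVal f (x₂ + x₃) x₁) - (nuVal f x₂ x₁ + nuVal f (x₁ + x₂) x₃)⁆ +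
    ⁅x₃, (nuVal f x₃ x₂ + nuVal f (x₂ + x₃) x₁) - nuVal f x₃ (x₁ + x₂)⁆ = 0 at e₁
  have h₁ := smul_eq_zero_of_cocycle (k := k) (m := 1 + (m + 1)) (by omega) hmem
    (by rw [ev₂_specialDefect, specialDefect, specialDefect, add_comm])
    (by
      simp only [ev₂_specialDefect]
      rw [← e₁]
      simp only [specialDefect, lie_add, add_lie, lie_sub]
      abel)
  exact (smul_eq_zero.1 h₁).resolve_left (Nat.cast_ne_zero.2 (by omega))

end Special

/-! ### The Ihara bracket of Lie polynomials -/

section IharaPoly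

variable {k : Type u} [CommRing k] {L : Type v} [LieRing L] [LieAlgebra k L]

local notation "x" => FreeLieAlgebra.of k (0 : Fin 2)
local notation "y" => FreeLieAlgebra.of k (1 : Fin 2)
local notation "x₁" => FreeLieAlgebra.of k (0 : Fin 3)
local notation "x₂" => FreeLieAlgebra.of k (1 : Fin 3)
local notation "x₃" => FreeLieAlgebra.of k (2 : Fin 3)

/-- The Ihara bracket of Lie polynomials. -/
def iharaPoly (f g : FreeLieAlgebra k (Fin 2)) : FreeLieAlgebra k (Fin 2) :=
  tanDer ![0, f] g - tanDer ![0, g] f + ⁅f, g⁆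

theorem isHomDer_tanDer {n m : ℕ} {a : Fin n → FreeLieAlgebra k (Fin n)}
    (ha : ∀ i, a i ∈ lieDeg k (letters k n) m) : IsHomDer m (tanDer a) := fun p b hb =>
  freeDer_mem (fun i => by rw [add_comm]; exact lie_mem_lieDeg k (of_mem i) (ha i)) hb

theorem iharaPoly_mem {p q : ℕ} {f g : FreeLieAlgebra k (Fin 2)}
    (hf : f ∈ lieDeg k (letters k 2) p) (hg : g ∈ lieDeg k (letters k 2) q) :
    iharaPoly f g ∈ lieDeg k (letters k 2) (p + q) := by
  have h : ∀ {p : ℕ} {f : FreeLieAlgebra k (Fin 2)}, f ∈ lieDeg k (letters k 2) p →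
      ∀ i, (![0, f] : Fin 2 → _) i ∈ lieDeg k (letters k 2) p := by
    intro p f hf i
    fin_cases i
    · exact zero_mem _
    · exact hf
  refine add_mem (sub_mem (isHomDer_tanDer (h hf) _ _ hg) ?_) (lie_mem_lieDeg k hf hg)
  rw [add_comm]
  exact isHomDer_tanDer (h hg) _ _ hf

theorem der_ev₂_ihara (D : LieDerivation k L L) {a b : L} {f : FreeLieAlgebra k (Fin 2)}
    (ha : D a = 0) (hb : D b = ⁅b, ev₂ a b f⁆) (g : FreeLieAlgebra k (Fin 2)) :
    D (ev₂ a b g) = ev₂ a b (tanDer ![0, f] g) :=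
  der_ev₂_of_eq D _ (by simp [ha]) (by simp [hb, LieHom.map_lie]) g

/-- Any derivations of the target that imitate (0, f) and (0, g) on the pair (a, b) may be used to
compute the bracket. The antisymmetry, hexagon and pentagon of the bracket all come from a good
choice of D and E. -/
theorem ev₂_iharaPoly (D E : LieDerivation k L L) {a b : L} {f g : FreeLieAlgebra k (Fin 2)}
    (hDa : D a = 0) (hDb : D b = ⁅b, ev₂ a b f⁆) (hEa : E a = 0) (hEb : E b = ⁅b, ev₂ a b g⁆) :
    ev₂ a b (iharaPoly f g) = D (ev₂ a b g) - E (ev₂ a b f) + ⁅ev₂ a b f, ev₂ a b g⁆ := by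
  rw [iharaPoly, map_add, map_sub, LieHom.map_lie, ← der_ev₂_ihara D hDa hDb,
    ← der_ev₂_ihara E hEa hEb]

/-- For the swapped pair (y, x) the imitating derivation is (0, f) + ad f: it kills y, and it sends
x to [f, x] = [x, f(y, x)]. -/
theorem iharaPoly_antisymm {f g : FreeLieAlgebra k (Fin 2)} (hf : f = -ev₂ y x f)
    (hg : g = -ev₂ y x g) : iharaPoly f g = -ev₂ y x (iharaPoly f g) := by
  have h : ∀ {f : FreeLieAlgebra k (Fin 2)}, f = -ev₂ y x f →
      (tanDer ![0, f] + LieDerivation.ad k _ f) y = 0 ∧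
      (tanDer ![0, f] + LieDerivation.ad k _ f) x = ⁅x, ev₂ y x f⁆ := by
    intro f hf
    constructor
    · rw [LieDerivation.add_apply, tanDer_of, ad_apply']
      change ⁅y, f⁆ + ⁅f, y⁆ = 0
      rw [← lie_skew, neg_add_cancel]
    · rw [LieDerivation.add_apply, tanDer_of, ad_apply']
      change ⁅x, (0 : FreeLieAlgebra k (Fin 2))⁆ + ⁅f, x⁆ = _
      rw [lie_zero, zero_add, ← lie_skew, ← lie_neg, eq_neg_iff_add_eq_zero.2
        (neg_eq_iff_add_eq_zero.1 hf.symm)]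
  have hf' : ev₂ y x f = -f := by rw [eq_neg_iff_add_eq_zero, ← neg_eq_iff_add_eq_zero, ← hf]
  have hg' : ev₂ y x g = -g := by rw [eq_neg_iff_add_eq_zero, ← neg_eq_iff_add_eq_zero, ← hg]
  rw [ev₂_iharaPoly _ _ (h hf).1 (h hf).2 (h hg).1 (h hg).2, hf', hg', iharaPoly]
  simp only [LieDerivation.add_apply, map_neg, ad_apply', lie_neg, neg_lie]
  rw [← lie_skew g f]
  abel

/-- Put z = -x-y. The derivation (0, f) is corrected by inner ones: adding ad f imitates it on (y,
z), and subtracting ad f(z, x) imitates it on (z, x). Specialness enters as [y, f(x, y)] = [z, f(z,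
x)], which gives the value of (0, f) on z. -/
theorem iharaPoly_hexagon {f g : FreeLieAlgebra k (Fin 2)} (hf : f = -ev₂ y x f)
    (hg : g = -ev₂ y x g)
    (hf' : ev₂ x y f + ev₂ y (-x - y) f + ev₂ (-x - y) x f = 0)
    (hg' : ev₂ x y g + ev₂ y (-x - y) g + ev₂ (-x - y) x g = 0)
    (hsf : specialDefect f y (-x - y) = 0) (hsg : specialDefect g y (-x - y) = 0) :
    ev₂ x y (iharaPoly f g) + ev₂ y (-x - y) (iharaPoly f g) +
      ev₂ (-x - y) x (iharaPoly f g) = 0 := by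
  have hxy : ∀ f : FreeLieAlgebra k (Fin 2), ev₂ x y f = f := ev₂_of
  rw [hxy] at hf' hg'
  have h : ∀ {f : FreeLieAlgebra k (Fin 2)}, f = -ev₂ y x f →
      f + ev₂ y (-x - y) f + ev₂ (-x - y) x f = 0 → specialDefect f y (-x - y) = 0 →
      ((tanDer ![0, f] + LieDerivation.ad k _ f) y = 0 ∧
      (tanDer ![0, f] + LieDerivation.ad k _ f) (-x - y) = ⁅-x - y, ev₂ y (-x - y) f⁆) ∧
      ((tanDer ![0, f] - LieDerivation.ad k _ (ev₂ (-x - y) x f)) (-x - y) = 0 ∧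
      (tanDer ![0, f] - LieDerivation.ad k _ (ev₂ (-x - y) x f)) x = ⁅x, ev₂ (-x - y) x f⁆) := by
    intro f hf hf' hs
    have ex : tanDer ![0, f] x = 0 := by
      rw [tanDer_of]; exact lie_zero _
    have ey : tanDer ![0, f] y = ⁅y, f⁆ := tanDer_of _ _
    have ez : tanDer ![0, f] (-x - y) = -⁅-x - y, ev₂ (-x - y) x f⁆ := by
      rw [specialDefect, nuVal, nuVal, show -y - (-x - y) = x by abel,
        show -(-x - y) - y = x by abel, hxy, ev₂_antisymm hf x (-x - y), lie_neg] at hs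
      rw [map_sub, map_neg, ex, ey, neg_zero, zero_sub, eq_neg_of_add_eq_zero_left hs, neg_neg]
    refine ⟨⟨?_, ?_⟩, ?_, ?_⟩
    · rw [LieDerivation.add_apply, ey, ad_apply', ← lie_skew, neg_add_cancel]
    · rw [LieDerivation.add_apply, ez, ad_apply', ← lie_skew f (-x - y), ← neg_add,
        ← lie_add, ← lie_neg]
      congr 1
      rw [neg_eq_iff_add_eq_zero, ← hf']
      abel
    · rw [LieDerivation.sub_apply, ez, ad_apply', ← lie_skew _ (-x - y), sub_self]
    · rw [LieDerivation.sub_apply, ex, ad_apply', zero_sub, lie_skew]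
  obtain ⟨⟨a₁, a₂⟩, a₃, a₄⟩ := h hf hf' hsf
  obtain ⟨⟨b₁, b₂⟩, b₃, b₄⟩ := h hg hg' hsg
  rw [ev₂_iharaPoly _ _ a₁ a₂ b₁ b₂, ev₂_iharaPoly _ _ a₃ a₄ b₃ b₄, hxy, iharaPoly]
  simp only [LieDerivation.add_apply, LieDerivation.sub_apply, ad_apply']
  -- The sum is the image of the hexagon of g under (0, f), minus the image of the hexagon of f
  -- under (0, g), plus the identity obtained by bracketing the two hexagons solved for their last
  -- terms.
  have c₁ := congrArg (tanDer ![0, f]) hg'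
  have c₂ := congrArg (tanDer ![0, g]) hf'
  simp only [map_add, map_zero] at c₁ c₂
  have c₃ : ⁅f + ev₂ y (-x - y) f, g + ev₂ y (-x - y) g⁆ =
      ⁅ev₂ (-x - y) x f, ev₂ (-x - y) x g⁆ := by
    rw [eq_neg_of_add_eq_zero_left hf', eq_neg_of_add_eq_zero_left hg', lie_neg, neg_lie, neg_neg]
  simp only [add_lie, lie_add] at c₃
  generalize ev₂ y (-x - y) f = f₂ at *
  generalize ev₂ (-x - y) x f = f₃ at *
  generalize ev₂ y (-x - y) g = g₂ at *
  generalize ev₂ (-x - y) x g = g₃ at *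
  rw [← lie_skew f₂ g, ← sub_eq_zero] at c₃
  rw [← lie_skew f₃ g₃]
  rw [← lie_skew f₃ g₃] at c₃
  have := congrArg₂ (· + ·) (congrArg₂ (· - ·) c₁ c₂) c₃
  simp only [sub_zero, add_zero] at this
  refine Eq.trans ?_ this
  abel

/-! ### The action on tuples -/

/-- The commutator of derivations that act on `a` by inner derivations. -/
theorem lie_der_apply {D E : LieDerivation k L L} {a s t : L} (hD : D a = ⁅a, s⁆)
    (hE : E a = ⁅a, t⁆) : ⁅D, E⁆ a = ⁅a, D t - E s + ⁅s, t⁆⁆ := by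
  rw [LieDerivation.lie_apply, hD, hE, LieDerivation.apply_lie_eq_add,
    LieDerivation.apply_lie_eq_add, hD, hE, lie_add, lie_sub, leibniz_lie a s t,
    ← lie_skew s ⁅a, t⁆]
  abel

/-- `D` acts on `a` and `b` as the derivation `ν(f)` acts on `x` and `y`. -/
structure IsNuAct (f : FreeLieAlgebra k (Fin 2)) (a b : L) (D : LieDerivation k L L) : Prop where
  left : D a = ⁅a, nuVal f a b⁆
  right : D b = ⁅b, nuVal f b a⁆

theorem IsNuAct.swap {f : FreeLieAlgebra k (Fin 2)} {a b : L} {D : LieDerivation k L L}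
    (h : IsNuAct f a b D) : IsNuAct f b a D := ⟨h.right, h.left⟩

/-- Specialness says that D kills -a-b; so on the pair (-a-b, a) it imitates the derivation (0, f).
-/
theorem IsNuAct.map_nuVal {f : FreeLieAlgebra k (Fin 2)} {a b : L} {D : LieDerivation k L L}
    (h : IsNuAct f a b D) (hs : specialDefect f a b = 0) (g : FreeLieAlgebra k (Fin 2)) :
    D (nuVal g a b) = nuVal (tanDer ![0, f] g) a b := by
  refine der_ev₂_ihara D ?_ h.left g
  rw [map_sub, map_neg, h.left, h.right, ← neg_add', ← specialDefect, hs, neg_zero]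

theorem IsNuAct.nuVal_iharaPoly {f g : FreeLieAlgebra k (Fin 2)} {a b : L}
    {D E : LieDerivation k L L} (hD : IsNuAct f a b D) (hE : IsNuAct g a b E)
    (hsf : specialDefect f a b = 0) (hsg : specialDefect g a b = 0) :
    D (nuVal g a b) - E (nuVal f a b) + ⁅nuVal f a b, nuVal g a b⁆ =
      nuVal (iharaPoly f g) a b := by
  rw [hD.map_nuVal hsf, hE.map_nuVal hsg, iharaPoly, nuVal, nuVal, nuVal, nuVal, nuVal, map_add,
    map_sub, LieHom.map_lie]

theorem specialDefect_comm (f : FreeLieAlgebra k (Fin 2)) (a b : L) :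
    specialDefect f b a = specialDefect f a b := add_comm _ _

theorem IsNuAct.lie {f g : FreeLieAlgebra k (Fin 2)} {a b : L}
    {D E : LieDerivation k L L} (hD : IsNuAct f a b D) (hE : IsNuAct g a b E)
    (hsf : specialDefect f a b = 0) (hsg : specialDefect g a b = 0) :
    IsNuAct (iharaPoly f g) a b ⁅D, E⁆ where
  left := by rw [lie_der_apply hD.left hE.left, hD.nuVal_iharaPoly hE hsf hsg]
  right := by
    rw [specialDefect_comm] at hsf hsg
    rw [lie_der_apply hD.right hE.right, hD.swap.nuVal_iharaPoly hE.swap hsf hsg]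

/-- `D` acts on `a`, `b`, `c` as `Ψ^{1,2} + Ψ^{12,3}` acts on the generators, where `Ψ = ν(f)`. -/
structure IsNuAct₃ (f : FreeLieAlgebra k (Fin 2)) (a b c : L) (D : LieDerivation k L L) :
    Prop where
  fst : D a = ⁅a, nuVal f a b + nuVal f (a + b) c⁆
  snd : D b = ⁅b, nuVal f b a + nuVal f (a + b) c⁆
  thd : D c = ⁅c, nuVal f c (a + b)⁆

theorem IsNuAct₃.outer {f : FreeLieAlgebra k (Fin 2)} {a b c : L} {D : LieDerivation k L L}
    (h : IsNuAct₃ f a b c D) (hs : specialDefect f a b = 0) : IsNuAct f (a + b) c D where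
  left := by
    rw [map_add, h.fst, h.snd, lie_add, lie_add, add_add_add_comm, ← specialDefect, hs, zero_add,
      add_lie]
  right := h.thd

/-- On a and b the entry coming from Ψ^{12,3} is the same, so an inner derivation removes it and
leaves the action of Ψ^{1,2}. -/
theorem IsNuAct₃.inner {f : FreeLieAlgebra k (Fin 2)} {a b c : L} {D : LieDerivation k L L}
    (h : IsNuAct₃ f a b c D) :
    IsNuAct f a b (D + LieDerivation.ad k L (nuVal f (a + b) c)) where
  left := by
    rw [LieDerivation.add_apply, h.fst, ad_apply', lie_add, ← lie_skew a (nuVal f (a + b) c)]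
    abel
  right := by
    rw [LieDerivation.add_apply, h.snd, ad_apply', lie_add, ← lie_skew b (nuVal f (a + b) c)]
    abel

theorem IsNuAct₃.swap {f : FreeLieAlgebra k (Fin 2)} {a b c : L} {D : LieDerivation k L L}
    (h : IsNuAct₃ f a b c D) : IsNuAct₃ f b a c D := by
  constructor <;> rw [add_comm b a]
  exacts [h.snd, h.fst, h.thd]

/-- The commutator splits into the one for Ψ^{12,3}, given by the action on (a + b, c), and the one
for Ψ^{1,2}, given by the action on (a, b) after the inner correction. The mixed brackets are
exactly what the corrections contribute. -/
theorem IsNuAct₃.lie_fst {f g : FreeLieAlgebra k (Fin 2)} {a b c : L}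
    {D E : LieDerivation k L L} (hD : IsNuAct₃ f a b c D) (hE : IsNuAct₃ g a b c E)
    (hsf : ∀ a b : L, specialDefect f a b = 0) (hsg : ∀ a b : L, specialDefect g a b = 0) :
    ⁅D, E⁆ a = ⁅a, nuVal (iharaPoly f g) a b + nuVal (iharaPoly f g) (a + b) c⁆ := by
  rw [lie_der_apply hD.fst hE.fst,
    ← (hD.outer (hsf _ _)).nuVal_iharaPoly (hE.outer (hsg _ _)) (hsf _ _) (hsg _ _),
    ← hD.inner.nuVal_iharaPoly hE.inner (hsf _ _) (hsg _ _)]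
  congr 1
  simp only [map_add, LieDerivation.add_apply, ad_apply', add_lie, lie_add]
  rw [← lie_skew (nuVal g (a + b) c) (nuVal f a b)]
  abel

theorem IsNuAct₃.lie {f g : FreeLieAlgebra k (Fin 2)} {a b c : L}
    {D E : LieDerivation k L L} (hD : IsNuAct₃ f a b c D) (hE : IsNuAct₃ g a b c E)
    (hsf : ∀ a b : L, specialDefect f a b = 0) (hsg : ∀ a b : L, specialDefect g a b = 0) :
    IsNuAct₃ (iharaPoly f g) a b c ⁅D, E⁆ where
  fst := hD.lie_fst hE hsf hsg
  snd := by rw [add_comm a b]; exact hD.swap.lie_fst hE.swap hsf hsg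
  thd := ((hD.outer (hsf _ _)).lie (hE.outer (hsg _ _)) (hsf _ _) (hsg _ _)).right

/-- `D` commutes with the derivation that acts on `a`, `b`, `c` as `t^{1,2}`. -/
theorem IsNuAct₃.lie_braid {f : FreeLieAlgebra k (Fin 2)} {a b c : L} {D T : LieDerivation k L L}
    (hD : IsNuAct₃ f a b c D) (hs : specialDefect f a b = 0) (ha : T a = ⁅a, b⁆)
    (hb : T b = ⁅b, a⁆) (hc : T c = 0) : ⁅D, T⁆ a = 0 ∧ ⁅D, T⁆ c = 0 := by
  have hab : T (a + b) = 0 := by rw [map_add, ha, hb, ← lie_skew, neg_add_cancel]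
  have hou : ∀ g : FreeLieAlgebra k (Fin 2), T (nuVal g (a + b) c) = 0 := fun g =>
    der_ev₂_zero T (by rw [map_sub, map_neg, hab, hc]; simp) hab g
  have hou' : ∀ g : FreeLieAlgebra k (Fin 2), T (nuVal g c (a + b)) = 0 := fun g =>
    der_ev₂_zero T (by rw [map_sub, map_neg, hab, hc]; simp) hc g
  -- On both a and b the derivation T is bracketing with a + b on the right, so it acts in the same
  -- way on every Lie polynomial in a and b.
  have ha' : T a = ⁅a, a + b⁆ := by rw [lie_add, lie_self, zero_add, ha]
  have hin : T (nuVal f a b) = ⁅nuVal f a b, a + b⁆ :=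
    der_ev₂_inner T (by
      rw [map_sub, map_neg, ha, hb, sub_lie, neg_lie, lie_add, lie_add, lie_self, lie_self]; abel)
      ha' f
  constructor
  · rw [lie_der_apply hD.fst ha', (hD.outer hs).left, map_add, hin, hou,
      add_lie (nuVal f a b), ← lie_skew (a + b) (nuVal f (a + b) c)]
    rw [show ∀ s t : L, -t - (s + 0) + (s + t) = 0 by intro s t; abel, lie_zero]
  · rw [lie_der_apply hD.thd (by rw [hc, lie_zero]), map_zero, hou', lie_zero]
    simp

end IharaPoly

/-! ### Closure of the grt equations under the Ihara bracket -/

section IharaField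

variable {k : Type u} [Field k]

local notation "x₁" => FreeLieAlgebra.of k (0 : Fin 3)
local notation "x₂" => FreeLieAlgebra.of k (1 : Fin 3)
local notation "x₃" => FreeLieAlgebra.of k (2 : Fin 3)
local notation "ρ" => tDer k (n := 3)

theorem isNuAct₃_leftTuple (f : FreeLieAlgebra k (Fin 2)) :
    IsNuAct₃ f x₁ x₂ x₃ (tanDer (leftTuple f)) :=
  ⟨tanDer_of _ _, tanDer_of _ _, tanDer_of _ _⟩

/-- After the cyclic relabelling (x_2, x_3, x_1) the right tuple has the shape of the left one, so
results about one side transfer to the other. -/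
theorem isNuAct₃_rightTuple (f : FreeLieAlgebra k (Fin 2)) :
    IsNuAct₃ f x₂ x₃ x₁ (tanDer (rightTuple f)) :=
  ⟨tanDer_of _ _, tanDer_of _ _, tanDer_of _ _⟩

theorem tanDer_leftTuple_iharaPoly {f g : FreeLieAlgebra k (Fin 2)}
    (hsf : ∀ a b : FreeLieAlgebra k (Fin 3), specialDefect f a b = 0)
    (hsg : ∀ a b : FreeLieAlgebra k (Fin 3), specialDefect g a b = 0) :
    tanDer (leftTuple (iharaPoly f g)) = ⁅tanDer (leftTuple f), tanDer (leftTuple g)⁆ := by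
  have h₁ := (isNuAct₃_leftTuple f).lie (isNuAct₃_leftTuple g) hsf hsg
  have h₂ := isNuAct₃_leftTuple (iharaPoly f g)
  refine free_der_ext fun i => ?_
  fin_cases i
  exacts [h₂.fst.trans h₁.fst.symm, h₂.snd.trans h₁.snd.symm, h₂.thd.trans h₁.thd.symm]

theorem tanDer_rightTuple_iharaPoly {f g : FreeLieAlgebra k (Fin 2)}
    (hsf : ∀ a b : FreeLieAlgebra k (Fin 3), specialDefect f a b = 0)
    (hsg : ∀ a b : FreeLieAlgebra k (Fin 3), specialDefect g a b = 0) :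
    tanDer (rightTuple (iharaPoly f g)) = ⁅tanDer (rightTuple f), tanDer (rightTuple g)⁆ := by
  have h₁ := (isNuAct₃_rightTuple f).lie (isNuAct₃_rightTuple g) hsf hsg
  have h₂ := isNuAct₃_rightTuple (iharaPoly f g)
  refine free_der_ext fun i => ?_
  fin_cases i
  exacts [h₂.thd.trans h₁.thd.symm, h₂.fst.trans h₁.fst.symm, h₂.snd.trans h₁.snd.symm]

theorem lie_leftTuple_tDer {f : FreeLieAlgebra k (Fin 2)}
    (hs : ∀ a b : FreeLieAlgebra k (Fin 3), specialDefect f a b = 0) :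
    ⁅tanDer (leftTuple f), ρ 0 1⁆ = 0 := by
  have h := isNuAct₃_leftTuple f
  have e₁ : ρ 0 1 x₁ = ⁅x₁, x₂⁆ := tDer_of_left (by decide)
  have e₂ : ρ 0 1 x₂ = ⁅x₂, x₁⁆ := tDer_of_right (by decide)
  have e₃ : ρ 0 1 x₃ = 0 := tDer_of_ne (by decide) (by decide)
  refine free_der_ext fun i => ?_
  fin_cases i
  exacts [(h.lie_braid (hs _ _) e₁ e₂ e₃).1, (h.swap.lie_braid (hs _ _) e₂ e₁ e₃).1,
    (h.lie_braid (hs _ _) e₁ e₂ e₃).2]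

theorem lie_rightTuple_tDer {f : FreeLieAlgebra k (Fin 2)}
    (hs : ∀ a b : FreeLieAlgebra k (Fin 3), specialDefect f a b = 0) :
    ⁅tanDer (rightTuple f), ρ 1 2⁆ = 0 := by
  have h := isNuAct₃_rightTuple f
  have e₁ : ρ 1 2 x₂ = ⁅x₂, x₃⁆ := tDer_of_left (by decide)
  have e₂ : ρ 1 2 x₃ = ⁅x₃, x₂⁆ := tDer_of_right (by decide)
  have e₃ : ρ 1 2 x₁ = 0 := tDer_of_ne (by decide) (by decide)
  refine free_der_ext fun i => ?_
  fin_cases i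
  exacts [(h.lie_braid (hs _ _) e₁ e₂ e₃).2, (h.lie_braid (hs _ _) e₁ e₂ e₃).1,
    (h.swap.lie_braid (hs _ _) e₂ e₁ e₃).1]

theorem IsGRTPoly.exists_deg {f : FreeLieAlgebra k (Fin 2)} (hf : IsGRTPoly f) {p : ℕ}
    (hfp : f ∈ lieDeg k (letters k 2) p) : ∃ m ≠ 1, f ∈ lieDeg k (letters k 2) m := by
  by_cases hp : p = 1
  · subst hp
    rw [eq_zero_of_pentagon hfp hf.pentagon]
    exact ⟨0, by decide, zero_mem _⟩
  · exact ⟨p, hp, hfp⟩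

variable [CharZero k]

/-- Let L_f and R_f be the left and right derivations, so R_f - L_f = f(t^{1,2}, t^{2,3}). Since
[L_f, t^{1,2}] = 0 and [R_f, t^{2,3}] = 0, ad L_f kills t^{1,2} and sends t^{2,3} to [t^{2,3},
f(t^{1,2}, t^{2,3})]: it imitates (0, f). The claim is then the expansion of [R_f, R_g] - [L_f,
L_g]. -/
theorem tanDer_eq_ev₂_iharaPoly {f g : FreeLieAlgebra k (Fin 2)} (hf : IsGRTPoly f)
    (hg : IsGRTPoly g) {p q : ℕ} (hp : p ≠ 1) (hq : q ≠ 1)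
    (hfp : f ∈ lieDeg k (letters k 2) p) (hgq : g ∈ lieDeg k (letters k 2) q) :
    tanDer (rightTuple (iharaPoly f g) - leftTuple (iharaPoly f g)) =
      ev₂ (ρ 0 1) (ρ 1 2) (iharaPoly f g) := by
  have hsf := fun a b : FreeLieAlgebra k (Fin 3) => hf.specialDefect_eq_zero hfp a b
  have hsg := fun a b : FreeLieAlgebra k (Fin 3) => hg.specialDefect_eq_zero hgq a b
  have ef := hf.tanDer_eq hp hfp
  have eg := hg.tanDer_eq hq hgq
  have h : ∀ {f : FreeLieAlgebra k (Fin 2)},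
      (∀ a b : FreeLieAlgebra k (Fin 3), specialDefect f a b = 0) →
      tanDer (rightTuple f - leftTuple f) = ev₂ (ρ 0 1) (ρ 1 2) f →
      LieDerivation.ad k _ (tanDer (leftTuple f)) (ρ 1 2) =
        ⁅ρ 1 2, ev₂ (ρ 0 1) (ρ 1 2) f⁆ := by
    intro f hs e
    rw [ad_apply', ← e, tanDer_sub, lie_sub,
      ← lie_skew (ρ 1 2) (tanDer (rightTuple f)), lie_rightTuple_tDer hs, neg_zero, zero_sub,
      lie_skew]
  rw [tanDer_sub, tanDer_leftTuple_iharaPoly hsf hsg,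
    tanDer_rightTuple_iharaPoly hsf hsg,
    ev₂_iharaPoly (LieDerivation.ad k _ (tanDer (leftTuple f)))
      (LieDerivation.ad k _ (tanDer (leftTuple g)))
      (by rw [ad_apply', lie_leftTuple_tDer hsf]) (h hsf ef)
      (by rw [ad_apply', lie_leftTuple_tDer hsg]) (h hsg eg),
    ← ef, ← eg, tanDer_sub, tanDer_sub]
  simp only [ad_apply', lie_sub, sub_lie]
  rw [← lie_skew (tanDer (leftTuple g)) (tanDer (rightTuple f)),
    ← lie_skew (tanDer (leftTuple g)) (tanDer (leftTuple f))]
  abel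

theorem iharaPoly_pentagon {f g : FreeLieAlgebra k (Fin 2)} (hf : IsGRTPoly f)
    (hg : IsGRTPoly g) {p q : ℕ} (hp : p ≠ 1) (hq : q ≠ 1)
    (hfp : f ∈ lieDeg k (letters k 2) p) (hgq : g ∈ lieDeg k (letters k 2) q) :
    pentagon (braidGen k) (iharaPoly f g) = 0 := by
  refine pentagon_eq_zero_of_apply (show p + q ≠ 1 by omega) (iharaPoly_mem hfp hgq) ?_
  rw [← tanDer_eq_ev₂_iharaPoly hf hg hp hq hfp hgq, tanDer_of,
    lie_strandPart (iharaPoly_antisymm hf.antisymm hg.antisymm)]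
  congr 1
  change nuVal _ x₁ (x₂ + x₃) - (nuVal _ x₁ x₂ + nuVal _ (x₁ + x₂) x₃) = _
  abel

theorem IsGRTPoly.iharaPoly {f g : FreeLieAlgebra k (Fin 2)} (hf : IsGRTPoly f)
    (hg : IsGRTPoly g) {p q : ℕ} (hfp : f ∈ lieDeg k (letters k 2) p)
    (hgq : g ∈ lieDeg k (letters k 2) q) : IsGRTPoly (iharaPoly f g) := by
  obtain ⟨p, hp, hfp⟩ := hf.exists_deg hfp
  obtain ⟨q, hq, hgq⟩ := hg.exists_deg hgq
  exact ⟨iharaPoly_antisymm hf.antisymm hg.antisymm,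
    iharaPoly_hexagon hf.antisymm hg.antisymm hf.hexagon hg.hexagon
      (hf.specialDefect_eq_zero hfp _ _) (hg.specialDefect_eq_zero hgq _ _),
    iharaPoly_pentagon hf hg hp hq hfp hgq⟩

end IharaField

/-! ### Commutators and derivations of free associative algebras -/

section Cyc

variable (k : Type u) [CommRing k] (B : Type v) [Ring B] [Algebra k B]

/-- The span of the commutators of an algebra. -/
def commutators : Submodule k B := Submodule.span k {c | ∃ a b : B, c = a * b - b * a}

variable {B}

/-- The projection to the quotient by the commutators. -/
def cyc : B →ₗ[k] B ⧸ commutators k B := (commutators k B).mkQ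

variable {k}

theorem cyc_eq_zero {a : B} : cyc k a = 0 ↔ a ∈ commutators k B :=
  Submodule.Quotient.mk_eq_zero _

theorem cyc_mul_comm (a b : B) : cyc k (a * b) = cyc k (b * a) := by
  rw [← sub_eq_zero, ← map_sub, cyc_eq_zero]
  exact Submodule.subset_span ⟨a, b, rfl⟩

theorem cyc_map_eq_zero {C : Type w} [Ring C] [Algebra k C] (φ : B →ₗ[k] C)
    (h : ∀ a b, cyc k (φ (a * b)) = cyc k (φ (b * a))) {a : B} (ha : cyc k a = 0) :
    cyc k (φ a) = 0 := by
  rw [cyc_eq_zero] at ha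
  induction ha using Submodule.span_induction with
  | mem a ha => obtain ⟨a, b, rfl⟩ := ha; rw [map_sub, map_sub, h, sub_self]
  | zero => rw [map_zero, map_zero]
  | add a b _ _ ha hb => rw [map_add, map_add, ha, hb, add_zero]
  | smul t a _ ha => rw [map_smul, map_smul, ha, smul_zero]

theorem cyc_algHom_eq_zero {C : Type w} [Ring C] [Algebra k C] (φ : B →ₐ[k] C) {a : B}
    (ha : cyc k a = 0) : cyc k (φ a) = 0 :=
  cyc_map_eq_zero φ.toLinearMap (fun a b => by
    simp only [AlgHom.toLinearMap_apply, map_mul]; exact cyc_mul_comm _ _) ha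

end Cyc

section AssDer

variable {k : Type u} [CommRing k] {n : ℕ} {B : Type v} [Ring B] [Algebra k B]

/-- The homomorphism `x_i ↦ a_i + ε c_i`, where `ε² = 0`. -/
def dualHom (a c : Fin n → B) : FreeAlgebra k (Fin n) →ₐ[k] TrivSqZeroExt B B :=
  FreeAlgebra.lift k fun i => TrivSqZeroExt.inl (a i) + TrivSqZeroExt.inr (c i)

theorem dualHom_fst (a c : Fin n → B) (v : FreeAlgebra k (Fin n)) :
    (dualHom a c v).fst = FreeAlgebra.lift k a v := by
  have h : (TrivSqZeroExt.fstHom k B B).comp (dualHom a c) = FreeAlgebra.lift k a := by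
    ext i
    simp [dualHom]
  exact DFunLike.congr_fun h v

/-- The derivation along the homomorphism `x_i ↦ a_i` with `x_i ↦ c_i`. -/
def assDer (a c : Fin n → B) : FreeAlgebra k (Fin n) →ₗ[k] B :=
  TrivSqZeroExt.sndHom B B ∘ₗ (dualHom a c).toLinearMap

theorem assDer_ι (a c : Fin n → B) (i : Fin n) : assDer a c (FreeAlgebra.ι k i) = c i := by
  change (dualHom a c (FreeAlgebra.ι k i)).snd = _
  simp [dualHom]

theorem assDer_mul (a c : Fin n → B) (v w : FreeAlgebra k (Fin n)) :
    assDer a c (v * w) =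
      FreeAlgebra.lift k a v * assDer a c w + assDer a c v * FreeAlgebra.lift k a w := by
  change (dualHom a c (v * w)).snd = _ * (dualHom a c w).snd + (dualHom a c v).snd * _
  rw [map_mul, TrivSqZeroExt.snd_mul, dualHom_fst, dualHom_fst]
  rfl

theorem assDer_algebraMap (a c : Fin n → B) (t : k) :
    assDer a c (algebraMap k (FreeAlgebra k (Fin n)) t) = 0 := by
  change (dualHom a c (algebraMap k _ t)).snd = 0
  rw [AlgHom.commutes]
  exact TrivSqZeroExt.snd_inl _ _

theorem assDer_one (a c : Fin n → B) : assDer a c (1 : FreeAlgebra k (Fin n)) = 0 := by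
  rw [← map_one (algebraMap k (FreeAlgebra k (Fin n))), assDer_algebraMap]

theorem ass_top_induction {P : FreeAlgebra k (Fin n) → Prop} (one : P 1)
    (mul : ∀ i a, P a → P (FreeAlgebra.ι k i * a)) (zero : P 0)
    (add : ∀ a b, P a → P b → P (a + b)) (smul : ∀ (c : k) a, P a → P (c • a))
    (a : FreeAlgebra k (Fin n)) : P a := by
  refine ass_word_induction (fun w => ?_) zero add smul a
  induction w with
  | nil => exact one
  | cons i w ih => rw [List.map_cons, List.prod_cons]; exact mul i _ ih

/-- The chain rule for derivations along homomorphisms. -/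
theorem assDer_lift {m : ℕ} (a c : Fin n → B) (s : Fin m → FreeAlgebra k (Fin n))
    (f : FreeAlgebra k (Fin m)) : assDer a c (FreeAlgebra.lift k s f) =
      assDer (fun i => FreeAlgebra.lift k a (s i)) (fun i => assDer a c (s i)) f := by
  have h : ∀ f : FreeAlgebra k (Fin m), FreeAlgebra.lift k a (FreeAlgebra.lift k s f) =
      FreeAlgebra.lift k (fun i => FreeAlgebra.lift k a (s i)) f := fun f => by
    have : (FreeAlgebra.lift k a).comp (FreeAlgebra.lift k s) =
        FreeAlgebra.lift k fun i => FreeAlgebra.lift k a (s i) := by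
      ext i; simp
    exact DFunLike.congr_fun this f
  induction f using ass_top_induction with
  | one => rw [map_one, assDer_one, assDer_one]
  | mul i f ih =>
    rw [map_mul, assDer_mul, assDer_mul, ih, h f, FreeAlgebra.lift_ι_apply,
      FreeAlgebra.lift_ι_apply, assDer_ι]
  | zero => simp only [map_zero]
  | add f g hf hg => simp only [map_add, hf, hg]
  | smul t f hf => simp only [map_smul, hf]

/-- By the Leibniz rule and cyclicity, the images of vw and wv agree modulo commutators. -/
theorem assDer_cyc (a c : Fin n → B) {f : FreeAlgebra k (Fin n)} (hf : cyc k f = 0) :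
    cyc k (assDer a c f) = 0 :=
  cyc_map_eq_zero _ (fun v w => by
    rw [assDer_mul, assDer_mul, map_add, map_add, cyc_mul_comm, cyc_mul_comm (assDer a c v),
      add_comm]) hf

/-- The derivation of the free associative algebra with `x_i ↦ [x_i, a_i]`. -/
def assTanDer (a : Fin n → FreeLieAlgebra k (Fin n)) :
    FreeAlgebra k (Fin n) →ₗ[k] FreeAlgebra k (Fin n) :=
  assDer (FreeAlgebra.ι k) fun i =>
    FreeAlgebra.ι k i * toAss (a i) - toAss (a i) * FreeAlgebra.ι k i

theorem lift_ι (f : FreeAlgebra k (Fin n)) : FreeAlgebra.lift k (FreeAlgebra.ι k) f = f := by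
  have : FreeAlgebra.lift k (FreeAlgebra.ι k) = AlgHom.id k (FreeAlgebra k (Fin n)) := by
    ext i; simp
  exact DFunLike.congr_fun this f

theorem assTanDer_mul (a : Fin n → FreeLieAlgebra k (Fin n)) (v w : FreeAlgebra k (Fin n)) :
    assTanDer a (v * w) = v * assTanDer a w + assTanDer a v * w := by
  rw [assTanDer, assDer_mul, lift_ι, lift_ι]

theorem assTanDer_ι (a : Fin n → FreeLieAlgebra k (Fin n)) (i : Fin n) :
    assTanDer a (FreeAlgebra.ι k i) =
      FreeAlgebra.ι k i * toAss (a i) - toAss (a i) * FreeAlgebra.ι k i := assDer_ι _ _ _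

theorem assTanDer_toAss (a : Fin n → FreeLieAlgebra k (Fin n)) (f : FreeLieAlgebra k (Fin n)) :
    assTanDer a (toAss f) = toAss (tanDer a f) := by
  induction f using free_top_induction with
  | of i => rw [tanDer_of, toAss_of, toAss_lie, assTanDer_ι, toAss_of]
  | lie f g hf hg =>
    rw [LieDerivation.apply_lie_eq_add, toAss_lie, map_sub, assTanDer_mul, assTanDer_mul, hf, hg,
      map_add, toAss_lie, toAss_lie]
    noncomm_ring
  | zero => simp only [map_zero]
  | add f g hf hg => simp only [map_add, hf, hg]
  | smul t f hf => simp only [map_smul, hf]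

/-! ### The operators `∂_i` and the divergence of Lie polynomials -/

theorem algebraMapInv_toAss (f : FreeLieAlgebra k (Fin n)) :
    FreeAlgebra.algebraMapInv (toAss f) = 0 := by
  induction f using free_top_induction with
  | of i => rw [toAss_of]; simp [FreeAlgebra.algebraMapInv]
  | lie f g hf hg => rw [toAss_lie, map_sub, map_mul, map_mul, hf, hg, sub_self]
  | zero => simp only [map_zero]
  | add f g hf hg => simp only [map_add, hf, hg, add_zero]
  | smul t f hf => simp only [map_smul, hf, smul_zero]

theorem partialOp_mul_ι_of_ne {i j : Fin n} (h : i ≠ j) (a : FreeAlgebra k (Fin n)) :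
    partialOp i (a * FreeAlgebra.ι k j) = 0 := by
  refine ass_word_induction (P := fun a => partialOp i (a * FreeAlgebra.ι k j) = 0)
    (fun w => ?_) ?_ ?_ ?_ a
  · rw [show (w.map (FreeAlgebra.ι k)).prod * FreeAlgebra.ι k j =
      ((w ++ [j]).map (FreeAlgebra.ι k)).prod by simp, partialOp_word, partialWord, if_neg]
    simpa using h.symm
  · rw [zero_mul, map_zero]
  · intro a b ha hb; rw [add_mul, map_add, ha, hb, add_zero]
  · intro t a ha; rw [smul_mul_assoc, map_smul, ha, smul_zero]

theorem partialOp_algebraMap (i : Fin n) (t : k) :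
    partialOp i (algebraMap k (FreeAlgebra k (Fin n)) t) = 0 := by
  rw [Algebra.algebraMap_eq_smul_one, map_smul]
  have := partialOp_word (k := k) i []
  rw [List.map_nil, List.prod_nil] at this
  rw [this]
  simp [partialWord]

theorem partialOp_sum (i : Fin n) (c : Fin n → FreeAlgebra k (Fin n)) :
    partialOp i (∑ j, c j * FreeAlgebra.ι k j) = c i := by
  rw [map_sum, Finset.sum_eq_single i (fun j _ h => partialOp_mul_ι_of_ne h.symm _) (by simp),
    partialOp_mul_ι]

theorem partialOp_mul (i : Fin n) (a : FreeAlgebra k (Fin n)) {b : FreeAlgebra k (Fin n)}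
    (hb : FreeAlgebra.algebraMapInv b = 0) : partialOp i (a * b) = a * partialOp i b := by
  conv_lhs => rw [partialOp_decomp b, hb, map_zero, zero_add, Finset.mul_sum]
  simp only [← mul_assoc]
  exact partialOp_sum i fun j => a * partialOp j b

theorem partialOp_mul_toAss (i : Fin n) (a : FreeAlgebra k (Fin n))
    (f : FreeLieAlgebra k (Fin n)) :
    partialOp i (a * toAss f) = a * partialOp i (toAss f) :=
  partialOp_mul i a (algebraMapInv_toAss f)

theorem partialOp_toAss_lie (i : Fin n) (f g : FreeLieAlgebra k (Fin n)) :
    partialOp i (toAss ⁅f, g⁆) =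
      toAss f * partialOp i (toAss g) - toAss g * partialOp i (toAss f) := by
  rw [toAss_lie, map_sub, partialOp_mul_toAss, partialOp_mul_toAss]

/-- The derivation is applied to f = f_0 + ∑ (∂_j f) x_j and the last letter is stripped off. In
[x_j, a_j] the summand x_j a_j ends in a letter of a_j, while a_j x_j ends in x_j. -/
theorem partialOp_assTanDer (a : Fin n → FreeLieAlgebra k (Fin n)) (i : Fin n)
    (f : FreeAlgebra k (Fin n)) : partialOp i (assTanDer a f) =
      assTanDer a (partialOp i f) +
        ∑ j, partialOp j f * FreeAlgebra.ι k j * partialOp i (toAss (a j)) -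
        partialOp i f * toAss (a i) := by
  conv_lhs => rw [partialOp_decomp f, map_add, map_sum, assTanDer, assDer_algebraMap, zero_add]
  have h : ∀ j, assTanDer a (partialOp j f * FreeAlgebra.ι k j) =
      partialOp j f * FreeAlgebra.ι k j * toAss (a j) +
        (assTanDer a (partialOp j f) - partialOp j f * toAss (a j)) * FreeAlgebra.ι k j := by
    intro j
    rw [assTanDer_mul, assTanDer_ι]
    noncomm_ring
  rw [← assTanDer]
  simp only [h]
  rw [Finset.sum_add_distrib, map_add, partialOp_sum, map_sum]
  simp only [partialOp_mul_toAss]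
  abel

/-- The divergence of a tuple of Lie polynomials, before taking it modulo commutators. -/
def divPoly (a : Fin n → FreeLieAlgebra k (Fin n)) : FreeAlgebra k (Fin n) :=
  ∑ i, FreeAlgebra.ι k i * partialOp i (toAss (a i))

theorem divPoly_add (a b : Fin n → FreeLieAlgebra k (Fin n)) :
    divPoly (a + b) = divPoly a + divPoly b := by
  simp only [divPoly, Pi.add_apply, map_add, mul_add, Finset.sum_add_distrib]

theorem divPoly_sub (a b : Fin n → FreeLieAlgebra k (Fin n)) :
    divPoly (a - b) = divPoly a - divPoly b := by
  simp only [divPoly, Pi.sub_apply, map_sub, mul_sub, Finset.sum_sub_distrib]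

theorem divPoly_smul (t : k) (a : Fin n → FreeLieAlgebra k (Fin n)) :
    divPoly (t • a) = t • divPoly a := by
  simp only [divPoly, Pi.smul_apply, map_smul, mul_smul_comm, Finset.smul_sum]

/-- The divergence is a cocycle. -/
theorem cyc_divPoly_lie (a b : Fin n → FreeLieAlgebra k (Fin n)) :
    cyc k (divPoly fun i => tanDer a (b i) - tanDer b (a i) + ⁅a i, b i⁆) =
      cyc k (assTanDer a (divPoly b)) - cyc k (assTanDer b (divPoly a)) := by
  have h : ∀ a b : Fin n → FreeLieAlgebra k (Fin n),
      cyc k (assTanDer a (divPoly b)) =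
      ∑ i, (cyc k (FreeAlgebra.ι k i * partialOp i (assTanDer a (toAss (b i)))) +
        cyc k (FreeAlgebra.ι k i * toAss (a i) * partialOp i (toAss (b i)))) -
      ∑ i, ∑ j, cyc k (FreeAlgebra.ι k i * partialOp j (toAss (b i)) * FreeAlgebra.ι k j *
        partialOp i (toAss (a j))) := by
    intro a b
    rw [divPoly, map_sum, map_sum, ← Finset.sum_sub_distrib]
    refine Finset.sum_congr rfl fun i _ => ?_
    have e := cyc_mul_comm (k := k) (FreeAlgebra.ι k i * partialOp i (toAss (b i))) (toAss (a i))
    rw [assTanDer_mul, assTanDer_ι, partialOp_assTanDer, ← map_sum, ← map_add, ← map_sub]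
    simp only [mul_add, mul_sub, sub_mul, Finset.mul_sum, map_add, map_sub, map_sum, mul_assoc]
      at e ⊢
    rw [e]
    abel
  -- Exchanging i and j and rotating cyclically shows that the double sum is symmetric in a and b,
  -- so it cancels in the difference.
  have hs : (∑ i, ∑ j, cyc k (FreeAlgebra.ι k i * partialOp j (toAss (b i)) * FreeAlgebra.ι k j *
        partialOp i (toAss (a j)))) =
      ∑ i, ∑ j, cyc k (FreeAlgebra.ι k i * partialOp j (toAss (a i)) * FreeAlgebra.ι k j *
        partialOp i (toAss (b j))) := by
    rw [Finset.sum_comm]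
    refine Finset.sum_congr rfl fun i _ => Finset.sum_congr rfl fun j _ => ?_
    rw [mul_assoc, cyc_mul_comm, ← mul_assoc]
  rw [h a b, h b a, hs, sub_sub_sub_cancel_right, ← Finset.sum_sub_distrib, divPoly, map_sum]
  refine Finset.sum_congr rfl fun i _ => ?_
  rw [assTanDer_toAss, assTanDer_toAss, map_add toAss, map_sub toAss, map_add, map_sub,
    partialOp_toAss_lie]
  simp only [mul_add, mul_sub, map_add, map_sub, mul_assoc]
  abel

end AssDer

/-! ### The divergence of `ν(ψ)` -/

section DivSubst

variable {k : Type u} [CommRing k] {n : ℕ} {B : Type v} [Ring B] [Algebra k B]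

local notation "x" => FreeLieAlgebra.of k (0 : Fin 2)
local notation "y" => FreeLieAlgebra.of k (1 : Fin 2)

/-- The value `f(a, b)` of a noncommutative polynomial. -/
def aev₂ (a b : B) : FreeAlgebra k (Fin 2) →ₐ[k] B := FreeAlgebra.lift k ![a, b]

@[simp] theorem aev₂_x (a b : B) : aev₂ a b (FreeAlgebra.ι k (0 : Fin 2)) = a := by
  simp [aev₂]

@[simp] theorem aev₂_y (a b : B) : aev₂ a b (FreeAlgebra.ι k (1 : Fin 2)) = b := by
  simp [aev₂]

theorem toAss_ev₂ (a b : FreeLieAlgebra k (Fin n)) (f : FreeLieAlgebra k (Fin 2)) :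
    toAss (ev₂ a b f) = aev₂ (toAss a) (toAss b) (toAss f) := by
  induction f using free_top_induction with
  | of i =>
    rw [toAss_of]
    fin_cases i
    · exact (congrArg toAss (ev₂_x a b)).trans (aev₂_x _ _).symm
    · exact (congrArg toAss (ev₂_y a b)).trans (aev₂_y _ _).symm
  | lie f g hf hg =>
    rw [LieHom.map_lie, toAss_lie, hf, hg, toAss_lie, map_sub, map_mul, map_mul]
  | zero => simp only [map_zero]
  | add f g hf hg => simp only [map_add, hf, hg]
  | smul t f hf => simp only [map_smul, hf]

theorem partialOp_aev₂ (i : Fin n) {a b : FreeAlgebra k (Fin n)}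
    (ha : FreeAlgebra.algebraMapInv a = 0) (hb : FreeAlgebra.algebraMapInv b = 0)
    (f : FreeAlgebra k (Fin 2)) : partialOp i (aev₂ a b f) =
      aev₂ a b (partialOp 0 f) * partialOp i a + aev₂ a b (partialOp 1 f) * partialOp i b := by
  conv_lhs => rw [partialOp_decomp f, Fin.sum_univ_two, map_add (aev₂ a b), map_add (aev₂ a b),
    map_mul, map_mul, aev₂_x, aev₂_y, AlgHom.commutes, map_add, map_add, partialOp_algebraMap,
    partialOp_mul _ _ ha, partialOp_mul _ _ hb, zero_add]

theorem partialOp_ι (i j : Fin n) :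
    partialOp i (FreeAlgebra.ι k j) = if i = j then 1 else 0 := by
  split_ifs with h
  · subst h
    simpa using partialOp_mul_ι (k := k) i 1
  · simpa using partialOp_mul_ι_of_ne (k := k) h 1

theorem partialOp_toAss_ev₂ (i : Fin n) (a b : FreeLieAlgebra k (Fin n))
    (f : FreeLieAlgebra k (Fin 2)) : partialOp i (toAss (ev₂ a b f)) =
      aev₂ (toAss a) (toAss b) (partialOp 0 (toAss f)) * partialOp i (toAss a) +
        aev₂ (toAss a) (toAss b) (partialOp 1 (toAss f)) * partialOp i (toAss b) := by
  rw [toAss_ev₂, partialOp_aev₂ i (algebraMapInv_toAss a) (algebraMapInv_toAss b)]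

variable (k) in
/-- The differential `f(x, y) ↦ f(y, z) - f(x + y, z) + f(x, y + z) - f(x, y)`. -/
def deltaPoly : FreeAlgebra k (Fin 2) →ₗ[k] FreeAlgebra k (Fin 3) :=
  (aev₂ (FreeAlgebra.ι k 1) (FreeAlgebra.ι k 2)).toLinearMap -
    (aev₂ (FreeAlgebra.ι k 0 + FreeAlgebra.ι k 1) (FreeAlgebra.ι k 2)).toLinearMap +
    (aev₂ (FreeAlgebra.ι k 0) (FreeAlgebra.ι k 1 + FreeAlgebra.ι k 2)).toLinearMap -
    (aev₂ (FreeAlgebra.ι k 0) (FreeAlgebra.ι k 1)).toLinearMap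

theorem deltaPoly_apply (f : FreeAlgebra k (Fin 2)) : deltaPoly k f =
    aev₂ (FreeAlgebra.ι k 1) (FreeAlgebra.ι k 2) f -
    aev₂ (FreeAlgebra.ι k 0 + FreeAlgebra.ι k 1) (FreeAlgebra.ι k 2) f +
    aev₂ (FreeAlgebra.ι k 0) (FreeAlgebra.ι k 1 + FreeAlgebra.ι k 2) f -
    aev₂ (FreeAlgebra.ι k 0) (FreeAlgebra.ι k 1) f := rfl

theorem nuVal_eq_ev₂ {L : Type w} [LieRing L] [LieAlgebra k L] (f : FreeLieAlgebra k (Fin 2))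
    (a b : L) : nuVal f a b = ev₂ a b (nuVal f x y) := by
  rw [map_nuVal, ev₂_x, ev₂_y]

theorem nuVal_eq_ev₂_swap {L : Type w} [LieRing L] [LieAlgebra k L]
    (f : FreeLieAlgebra k (Fin 2)) (a b : L) : nuVal f b a = ev₂ a b (nuVal f y x) := by
  rw [map_nuVal, ev₂_x, ev₂_y]

/-- By the chain rule for ∂_i, and because ∂_1 and ∂_2 both take x_1 + x_2 to 1, the divergence of
Ψ^{12,3} is that of Ψ at (x_1 + x_2, x_3); the other placements are similar. The equality holds
before passing to commutators. -/
theorem deltaPoly_divPoly (f : FreeLieAlgebra k (Fin 2)) :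
    deltaPoly k (divPoly (nuTuple f)) = divPoly (rightTuple f) - divPoly (leftTuple f) := by
  have h₂ : divPoly (nuTuple f) = FreeAlgebra.ι k 0 * partialOp 0 (toAss (nuVal f x y)) +
      FreeAlgebra.ι k 1 * partialOp 1 (toAss (nuVal f y x)) := Fin.sum_univ_two _
  have h₃ : ∀ a b c : FreeLieAlgebra k (Fin 3), divPoly ![a, b, c] =
      FreeAlgebra.ι k 0 * partialOp 0 (toAss a) + FreeAlgebra.ι k 1 * partialOp 1 (toAss b) +
      FreeAlgebra.ι k 2 * partialOp 2 (toAss c) := fun _ _ _ => Fin.sum_univ_three _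
  have e : ∀ (i : Fin 3) (a b : FreeLieAlgebra k (Fin 3)), _ :=
    fun i a b => (congrArg (fun t => partialOp i (toAss t)) (nuVal_eq_ev₂ f a b)).trans
      (partialOp_toAss_ev₂ i a b _)
  have e' : ∀ (i : Fin 3) (a b : FreeLieAlgebra k (Fin 3)), _ :=
    fun i a b => (congrArg (fun t => partialOp i (toAss t)) (nuVal_eq_ev₂_swap f a b)).trans
      (partialOp_toAss_ev₂ i a b _)
  rw [h₂, rightTuple, leftTuple, h₃, h₃, deltaPoly_apply]
  simp only [map_add toAss, map_add (partialOp _)]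
  rw [e 0 (.of k 0) (.of k 1), e' 1 (.of k 0) (.of k 1),
    e 0 (.of k 0 + .of k 1) (.of k 2), e 1 (.of k 0 + .of k 1) (.of k 2),
    e' 2 (.of k 0 + .of k 1) (.of k 2),
    e 0 (.of k 0) (.of k 1 + .of k 2), e' 1 (.of k 0) (.of k 1 + .of k 2),
    e' 2 (.of k 0) (.of k 1 + .of k 2),
    e 1 (.of k 1) (.of k 2), e' 2 (.of k 1) (.of k 2)]
  simp only [map_add toAss, map_add (partialOp _), toAss_of, partialOp_ι, map_add (aev₂ _ _),
    map_mul (aev₂ _ _), aev₂_x, aev₂_y]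
  simp only [show (0 : Fin 3) ≠ 1 by decide, show (0 : Fin 3) ≠ 2 by decide,
    show (1 : Fin 3) ≠ 2 by decide, show (1 : Fin 3) ≠ 0 by decide,
    show (2 : Fin 3) ≠ 1 by decide, show (2 : Fin 3) ≠ 0 by decide, if_true, if_false,
    mul_one, mul_zero, add_zero, zero_add, mul_add, add_mul]
  abel

theorem tanDer_smul (t : k) (a : Fin n → FreeLieAlgebra k (Fin n)) :
    tanDer (t • a) = t • tanDer a :=
  free_der_ext fun i => by
    rw [LieDerivation.smul_apply, tanDer_of, tanDer_of, ← lie_smul]; rfl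

theorem lie_tanDer (a b : Fin n → FreeLieAlgebra k (Fin n)) :
    ⁅tanDer a, tanDer b⁆ =
      tanDer fun i => tanDer a (b i) - tanDer b (a i) + ⁅a i, b i⁆ :=
  free_der_ext fun i => by
    rw [lie_der_apply (tanDer_of a i) (tanDer_of b i), tanDer_of]

theorem divPoly_tTuple {i j : Fin n} (h : i ≠ j) : divPoly (tTuple (k := k) i j) = 0 := by
  refine Finset.sum_eq_zero fun l _ => ?_
  rw [tTuple]
  split_ifs with h₁ h₂ h₂
  · exact absurd (h₁.symm.trans h₂) h
  · subst h₁; rw [add_zero, toAss_of, partialOp_ι, if_neg h, mul_zero]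
  · subst h₂; rw [zero_add, toAss_of, partialOp_ι, if_neg h.symm, mul_zero]
  · rw [add_zero, map_zero, map_zero, mul_zero]

theorem tTuple_mem (i j l : Fin n) : tTuple (k := k) i j l ∈ lieDeg k (letters k n) 1 := by
  rw [tTuple]
  refine add_mem ?_ ?_ <;> split_ifs
  exacts [of_mem _, zero_mem _, of_mem _, zero_mem _]

/-- The derivations in the image of the infinitesimal braids have tuples of divergence zero. -/
theorem exists_tuple_ev₂_tDer {i j i' j' : Fin n} (h : i ≠ j) (h' : i' ≠ j') {m : ℕ}
    {f : FreeLieAlgebra k (Fin 2)} (hf : f ∈ lieDeg k (letters k 2) m) :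
    ∃ c : Fin n → FreeLieAlgebra k (Fin n), (∀ l, c l ∈ lieDeg k (letters k n) m) ∧
      tanDer c = ev₂ (tDer k i j) (tDer k i' j') f ∧ cyc k (divPoly c) = 0 := by
  refine free_induction (P := fun m f => ∃ c : Fin n → FreeLieAlgebra k (Fin n),
    (∀ l, c l ∈ lieDeg k (letters k n) m) ∧ tanDer c = ev₂ (tDer k i j) (tDer k i' j') f ∧
    cyc k (divPoly c) = 0) ?_ ?_ ?_ ?_ ?_ hf
  · intro l
    fin_cases l
    · exact ⟨tTuple i j, tTuple_mem i j, (ev₂_x _ _).symm, by rw [divPoly_tTuple h, map_zero]⟩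
    · exact ⟨tTuple i' j', tTuple_mem i' j', (ev₂_y _ _).symm, by
        rw [divPoly_tTuple h', map_zero]⟩
  · rintro p q f g - - ⟨a, ha, ea, da⟩ ⟨b, hb, eb, db⟩
    refine ⟨fun i => tanDer a (b i) - tanDer b (a i) + ⁅a i, b i⁆, fun l => ?_, ?_, ?_⟩
    · refine add_mem (sub_mem (isHomDer_tanDer ha _ _ (hb l)) ?_) (lie_mem_lieDeg k (ha l) (hb l))
      rw [add_comm]
      exact isHomDer_tanDer hb _ _ (ha l)
    · rw [← lie_tanDer, LieHom.map_lie, ea, eb]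
    · rw [cyc_divPoly_lie, assTanDer, assTanDer, assDer_cyc _ _ da, assDer_cyc _ _ db, sub_zero]
  · intro m
    exact ⟨0, fun _ => zero_mem _, free_der_ext fun i => by
      rw [tanDer_of, map_zero]; exact lie_zero _, by
        rw [show divPoly (0 : Fin n → FreeLieAlgebra k (Fin n)) = 0 by
          simpa using divPoly_sub (0 : Fin n → FreeLieAlgebra k (Fin n)) 0, map_zero]⟩
  · rintro m f g ⟨a, ha, ea, da⟩ ⟨b, hb, eb, db⟩
    exact ⟨a + b, fun l => add_mem (ha l) (hb l), by rw [tanDer_add, ea, eb, map_add], by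
      rw [divPoly_add, map_add, da, db, add_zero]⟩
  · rintro m t f ⟨a, ha, ea, da⟩
    exact ⟨t • a, fun l => Submodule.smul_mem _ t (ha l), by rw [tanDer_smul, ea, map_smul], by
      rw [divPoly_smul, map_smul, da, smul_zero]⟩

theorem rightTuple_sub_leftTuple_mem {m : ℕ} {f : FreeLieAlgebra k (Fin 2)}
    (hf : f ∈ lieDeg k (letters k 2) m) (i : Fin 3) :
    (rightTuple f - leftTuple f) i ∈ lieDeg k (letters k 3) m := by
  have h₁ := fun i : Fin 3 => of_mem (k := k) i
  have h₂ := fun i j : Fin 3 => add_mem (h₁ i) (h₁ j)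
  refine sub_mem ?_ ?_ <;> fin_cases i
  exacts [nuVal_mem (h₁ _) (h₂ _ _) hf, add_mem (nuVal_mem (h₁ _) (h₁ _) hf)
    (nuVal_mem (h₂ _ _) (h₁ _) hf), add_mem (nuVal_mem (h₁ _) (h₁ _) hf)
    (nuVal_mem (h₂ _ _) (h₁ _) hf), add_mem (nuVal_mem (h₁ _) (h₁ _) hf)
    (nuVal_mem (h₂ _ _) (h₁ _) hf), add_mem (nuVal_mem (h₁ _) (h₁ _) hf)
    (nuVal_mem (h₂ _ _) (h₁ _) hf), nuVal_mem (h₁ _) (h₂ _ _) hf]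

end DivSubst

section DivNu

variable {k : Type u} [Field k] [CharZero k]

theorem eq_of_tanDer_eq {n m : ℕ} (hm : m ≠ 1) {a b : Fin n → FreeLieAlgebra k (Fin n)}
    (ha : ∀ i, a i ∈ lieDeg k (letters k n) m) (hb : ∀ i, b i ∈ lieDeg k (letters k n) m)
    (h : tanDer a = tanDer b) : a = b := by
  funext i
  refine eq_of_lie_of_eq i hm (ha i) (hb i) ?_
  rw [← tanDer_of, ← tanDer_of, h]

/-- The tuple of `rightTuple f - leftTuple f` must be the divergence-free one built from t^{1,2} and
t^{2,3}, because outside degree one a tangential derivation has only one tuple. -/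
theorem IsGRTPoly.deltaPoly_divPoly {f : FreeLieAlgebra k (Fin 2)} (h : IsGRTPoly f) {m : ℕ}
    (hf : f ∈ lieDeg k (letters k 2) m) :
    cyc k (deltaPoly k (divPoly (nuTuple f))) = 0 := by
  obtain ⟨m, hm, hf⟩ := h.exists_deg hf
  obtain ⟨c, hc, e, d⟩ := exists_tuple_ev₂_tDer (n := 3) (i := 0) (j := 1) (i' := 1) (j' := 2)
    (by decide) (by decide) hf
  rw [← h.tanDer_eq hm hf] at e
  rw [KashiwaraVergne.deltaPoly_divPoly, ← divPoly_sub,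
    ← eq_of_tanDer_eq hm hc (rightTuple_sub_leftTuple_mem hf) e, d]

end DivNu

/-! ### Cyclic words in the kernel of `δ` -/

section Kernel

variable {k : Type u} [CommRing k] {n : ℕ} {B : Type v} [Ring B] [Algebra k B]

local notation "xₐ" => FreeAlgebra.ι k (0 : Fin 2)
local notation "yₐ" => FreeAlgebra.ι k (1 : Fin 2)

theorem assDer_add_right (a c c' : Fin n → B) (f : FreeAlgebra k (Fin n)) :
    assDer a (c + c') f = assDer a c f + assDer a c' f := by
  induction f using ass_top_induction with
  | one => simp only [assDer_one, add_zero]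
  | mul i f ih =>
    simp only [assDer_mul, ih, assDer_ι, Pi.add_apply, mul_add, add_mul]
    abel
  | zero => simp only [map_zero, add_zero]
  | add f g hf hg => simp only [map_add, hf, hg]; abel
  | smul t f hf => simp only [map_smul, hf, smul_add]

theorem assDer_zero_right (a : Fin n → B) (f : FreeAlgebra k (Fin n)) : assDer a 0 f = 0 := by
  simpa using assDer_add_right a 0 0 f

theorem assDer_aev₂ (a c : Fin n → B) (s t : FreeAlgebra k (Fin n)) (f : FreeAlgebra k (Fin 2)) :
    assDer a c (aev₂ s t f) =
      assDer ![FreeAlgebra.lift k a s, FreeAlgebra.lift k a t] ![assDer a c s, assDer a c t] f := by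
  rw [aev₂, assDer_lift]
  congr 2 <;> (funext i; fin_cases i <;> rfl)

/-- Derivations along homomorphisms take powers to powers, up to commutators. -/
theorem cyc_assDer_pow (a c : Fin n → B) (p : FreeAlgebra k (Fin n)) (m j : ℕ) :
    cyc k (assDer a c (p ^ (m + 1)) * FreeAlgebra.lift k a p ^ j) =
      (m + 1) • cyc k (assDer a c p * FreeAlgebra.lift k a p ^ (m + j)) := by
  induction m generalizing j with
  | zero => simp
  | succ m ih =>
    rw [pow_succ, assDer_mul, add_mul, map_add, mul_assoc (assDer a c (p ^ (m + 1))), ← pow_succ',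
      ih, map_pow, mul_assoc, cyc_mul_comm, mul_assoc, ← pow_add, add_comm j, add_nsmul _ (m + 1),
      one_nsmul, add_comm, add_right_comm m 1 j, add_assoc m j 1]

theorem assDer_euler {m : ℕ} {f : FreeAlgebra k (Fin n)} (hf : f ∈ assDeg k n m) :
    assDer (FreeAlgebra.ι k) (FreeAlgebra.ι k) f = m • f := by
  induction hf using Submodule.span_induction with
  | mem f hf =>
    obtain ⟨l, rfl, rfl⟩ := hf
    induction l with
    | nil => simp [assDer_one]
    | cons i l ih =>
      rw [List.map_cons, List.prod_cons, assDer_mul, ih, assDer_ι, lift_ι, lift_ι, mul_smul_comm,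
        List.length_cons, add_nsmul, one_nsmul]
  | zero => simp
  | add f g _ _ hf hg => rw [map_add, hf, hg, nsmul_add]
  | smul t f _ hf => rw [map_smul, hf, smul_comm]

theorem exists_cyc_assDer_snd {m : ℕ} {f : FreeAlgebra k (Fin 2)} (hf : f ∈ assDeg k 2 m) :
    ∃ c : k, ∀ a b : B, cyc k (assDer ![a, 0] ![0, b] f) = c • cyc k (a ^ (m - 1) * b) := by
  -- The trailing power of a absorbs the letters that are rotated from the front to the back during
  -- the induction. Only words with exactly one second letter contribute, and cyclically these all
  -- become a^(m-1) b.
  have key : ∀ l : List (Fin 2), (∃ c : k, ∀ a : B,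
      FreeAlgebra.lift k ![a, 0] (l.map (FreeAlgebra.ι k)).prod = c • a ^ l.length) ∧
      ∃ c : k, ∀ (a b : B) (p : ℕ),
        cyc k (assDer ![a, 0] ![0, b] (l.map (FreeAlgebra.ι k)).prod * a ^ p) =
          c • cyc k (a ^ (l.length + p - 1) * b) := by
    intro l
    induction l with
    | nil => exact ⟨⟨1, fun a => by simp⟩, 0, fun a b p => by simp [assDer_one]⟩
    | cons i l ih =>
      obtain ⟨⟨c, hc⟩, d, hd⟩ := ih
      simp only [List.map_cons, List.prod_cons, map_mul, assDer_mul, hc, FreeAlgebra.lift_ι_apply,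
        assDer_ι, List.length_cons]
      fin_cases i
      · refine ⟨⟨c, fun a => ?_⟩, d, fun a b p => ?_⟩
        · change a * c • a ^ l.length = _
          rw [mul_smul_comm, pow_succ']
        · change cyc k ((a * assDer _ _ _ + 0 * _) * a ^ p) = _
          rw [zero_mul, add_zero, mul_assoc, cyc_mul_comm, mul_assoc, ← pow_succ, hd,
            add_right_comm, add_assoc]
      · refine ⟨⟨0, fun a => ?_⟩, c, fun a b p => ?_⟩
        · change 0 * _ = _
          rw [zero_mul, zero_smul]
        · change cyc k ((0 * assDer _ _ _ + b * c • a ^ l.length) * a ^ p) = _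
          rw [zero_mul, zero_add, mul_smul_comm, smul_mul_assoc, map_smul, mul_assoc, cyc_mul_comm,
            ← pow_add, add_right_comm, Nat.add_sub_cancel]
  induction hf using Submodule.span_induction with
  | mem f hf =>
    obtain ⟨l, rfl, rfl⟩ := hf
    obtain ⟨-, c, hc⟩ := key l
    exact ⟨c, fun a b => by simpa using hc a b 0⟩
  | zero => exact ⟨0, fun a b => by simp⟩
  | add f g _ _ hf hg =>
    obtain ⟨c, hc⟩ := hf
    obtain ⟨d, hd⟩ := hg
    exact ⟨c + d, fun a b => by rw [map_add, map_add, hc, hd, add_smul]⟩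
  | smul t f _ hf =>
    obtain ⟨c, hc⟩ := hf
    exact ⟨t * c, fun a b => by rw [map_smul, map_smul, hc, mul_smul]⟩

theorem exists_cyc_assDer_fst {m : ℕ} {f : FreeAlgebra k (Fin 2)} (hf : f ∈ assDeg k 2 m) :
    ∃ c : k, ∀ a b : FreeAlgebra k (Fin 2),
      cyc k (assDer ![0, a] ![b, 0] f) = c • cyc k (a ^ (m - 1) * b) := by
  have h : aev₂ yₐ xₐ f ∈ assDeg k 2 m := by
    have := lift_mem_assDeg ![assX k (1 : Fin 2), assX k 0] hf
    convert this using 2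
    rw [aev₂]
    congr 2
    funext i; fin_cases i <;> rfl
  obtain ⟨c, hc⟩ := exists_cyc_assDer_snd (B := FreeAlgebra k (Fin 2)) h
  refine ⟨c, fun a b => ?_⟩
  rw [← hc, assDer_aev₂, FreeAlgebra.lift_ι_apply, FreeAlgebra.lift_ι_apply, assDer_ι, assDer_ι]
  rfl

theorem cyc_assDer_of_deltaPoly {f : FreeAlgebra k (Fin 2)} (hf : cyc k (deltaPoly k f) = 0)
    (a c : Fin 3 → FreeAlgebra k (Fin 2)) :
    cyc k (assDer ![a 1, a 2] ![c 1, c 2] f) - cyc k (assDer ![a 0 + a 1, a 2] ![c 0 + c 1, c 2] f) +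
      cyc k (assDer ![a 0, a 1 + a 2] ![c 0, c 1 + c 2] f) - cyc k (assDer ![a 0, a 1] ![c 0, c 1] f)
      = 0 := by
  have h := assDer_cyc a c hf
  simpa only [deltaPoly_apply, map_sub, map_add, assDer_aev₂, FreeAlgebra.lift_ι_apply, assDer_ι]
    using h

theorem ι_eq : (FreeAlgebra.ι k : Fin 2 → FreeAlgebra k (Fin 2)) = ![xₐ, yₐ] := by
  funext i; fin_cases i <;> rfl

/-- The cocycle equation is differentiated at (x, y, 0) along z in direction y, and at (0, x, y)
along the first variable in direction x. This computes both partial derivatives of f, which add up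
to (m + 1) f by Euler's formula. -/
theorem cyc_eq_of_deltaPoly {m : ℕ} {f : FreeAlgebra k (Fin 2)} (hf : f ∈ assDeg k 2 (m + 1))
    (h : cyc k (deltaPoly k f) = 0) {c d : k}
    (hc : ∀ a b : FreeAlgebra k (Fin 2),
      cyc k (assDer ![a, 0] ![0, b] f) = c • cyc k (a ^ m * b))
    (hd : ∀ a b : FreeAlgebra k (Fin 2),
      cyc k (assDer ![0, a] ![b, 0] f) = d • cyc k (a ^ m * b)) :
    (m + 1) • cyc k f = c • cyc k ((xₐ + yₐ) ^ m * yₐ - yₐ ^ m * yₐ) +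
      d • cyc k ((xₐ + yₐ) ^ m * xₐ - xₐ ^ m * xₐ) := by
  have h₁ := cyc_assDer_of_deltaPoly h ![xₐ, yₐ, 0] ![0, 0, yₐ]
  have h₂ := cyc_assDer_of_deltaPoly h ![0, xₐ, yₐ] ![xₐ, 0, 0]
  have z : ∀ a : Fin 2 → FreeAlgebra k (Fin 2), assDer a ![0, 0] f = 0 := fun a => by
    rw [show (![0, 0] : Fin 2 → FreeAlgebra k (Fin 2)) = 0 by funext i; fin_cases i <;> rfl,
      assDer_zero_right]
  simp only [Matrix.cons_val_zero, Matrix.cons_val_one, Matrix.cons_val, add_zero, zero_add, hc, hd,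
    z, map_zero, sub_zero, zero_sub] at h₁ h₂
  have e : assDer ![xₐ, yₐ] ![0, yₐ] f + assDer ![xₐ, yₐ] ![xₐ, 0] f = (m + 1) • f := by
    rw [← assDer_add_right, show ![0, yₐ] + ![xₐ, 0] = FreeAlgebra.ι k by
      funext i; fin_cases i <;> simp, ← ι_eq, assDer_euler hf]
  rw [← map_nsmul, ← e, map_add, map_sub, map_sub, smul_sub, smul_sub]
  rw [← sub_eq_zero]
  have := congrArg₂ (· - ·) h₁ h₂
  simp only [sub_zero] at this
  rw [← this]
  abel

end Kernel

/-! ### The kernel of δ and special derivations -/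

section KernelField

variable {k : Type u} [Field k] [CharZero k]

local notation "xₐ" => FreeAlgebra.ι k (0 : Fin 2)
local notation "yₐ" => FreeAlgebra.ι k (1 : Fin 2)

/-- It remains to see that the constants c and d of `cyc_eq_of_deltaPoly` may be identified.
Differentiating that formula once more, at (0, y) in direction x, shows that (d - c) y^m x vanishes
modulo commutators for m ≥ 1. For m = 0 the two brackets multiplied by c and d are themselves zero.
-/
theorem exists_cyc_eq_of_deltaPoly {m : ℕ} {f : FreeAlgebra k (Fin 2)}
    (hf : f ∈ assDeg k 2 (m + 1)) (h : cyc k (deltaPoly k f) = 0) :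
    ∃ c : k, (m + 1) • cyc k f =
      c • cyc k ((xₐ + yₐ) ^ (m + 1) - xₐ ^ (m + 1) - yₐ ^ (m + 1)) := by
  obtain ⟨c, hc⟩ := exists_cyc_assDer_snd (B := FreeAlgebra k (Fin 2)) hf
  obtain ⟨d, hd⟩ := exists_cyc_assDer_fst hf
  rw [Nat.add_sub_cancel] at hc hd
  have e := cyc_eq_of_deltaPoly hf h hc hd
  refine ⟨c, ?_⟩
  have hs : (xₐ + yₐ) ^ (m + 1) - xₐ ^ (m + 1) - yₐ ^ (m + 1) =
      ((xₐ + yₐ) ^ m * yₐ - yₐ ^ m * yₐ) + ((xₐ + yₐ) ^ m * xₐ - xₐ ^ m * xₐ) := by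
    simp only [pow_succ, mul_add]; abel
  rw [e, hs, map_add, smul_add, add_right_inj]
  rcases m with _ | m
  · simp
  have t : (d - c) • cyc k (yₐ ^ (m + 1) * xₐ) = 0 := by
    have e' : cyc k ((m + 1 + 1) • f - (c • ((xₐ + yₐ) ^ (m + 1) * yₐ - yₐ ^ (m + 1) * yₐ) +
        d • ((xₐ + yₐ) ^ (m + 1) * xₐ - xₐ ^ (m + 1) * xₐ))) = 0 := by
      rw [map_sub, map_nsmul, e, map_add, map_smul, map_smul, sub_self]
    have e'' := assDer_cyc ![0, yₐ] ![xₐ, 0] e'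
    have a₁ : cyc k (assDer ![0, yₐ] ![xₐ, 0] ((xₐ + yₐ) ^ (m + 1) * yₐ)) =
        (m + 1) • cyc k (yₐ ^ (m + 1) * xₐ) := by
      have := cyc_assDer_pow ![0, yₐ] ![xₐ, 0] (xₐ + yₐ) m 1
      simp only [map_add, FreeAlgebra.lift_ι_apply, assDer_ι, Matrix.cons_val_zero,
        Matrix.cons_val_one, zero_add, add_zero, pow_one] at this
      rw [assDer_mul, assDer_ι, FreeAlgebra.lift_ι_apply]
      change cyc k (_ * 0 + _ * yₐ) = _
      rw [mul_zero, zero_add]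
      exact this.trans (congrArg _ (cyc_mul_comm _ _))
    have a₂ : cyc k (assDer ![0, yₐ] ![xₐ, 0] (yₐ ^ (m + 1) * yₐ)) = 0 := by
      have := cyc_assDer_pow ![0, yₐ] ![xₐ, 0] yₐ (m + 1) 0
      rw [pow_zero, mul_one, pow_succ, assDer_ι] at this
      rw [this]
      simp
    have a₃ : assDer ![0, yₐ] ![xₐ, 0] ((xₐ + yₐ) ^ (m + 1) * xₐ) = yₐ ^ (m + 1) * xₐ := by
      simp [assDer_mul, assDer_ι]
    have a₄ : assDer ![0, yₐ] ![xₐ, 0] (xₐ ^ (m + 1) * xₐ) = 0 := by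
      simp [assDer_mul, assDer_ι]
    simp only [map_sub, map_nsmul, map_add, map_smul, hd, a₁, a₂, a₃, a₄, sub_zero] at e''
    have e₃ : ((m + 1 : ℕ) : k) • (d - c) • cyc k (yₐ ^ (m + 1) * xₐ) = 0 := by
      rw [← e'']
      module
    exact (smul_eq_zero.1 e₃).resolve_left (Nat.cast_ne_zero.2 m.succ_ne_zero)
  -- Vanishing modulo commutators survives the substitution of p for y, so no case distinction on
  -- whether c = d is needed.
  have t' : ∀ p : FreeAlgebra k (Fin 2), (d - c) • cyc k (p ^ (m + 1) * xₐ) = 0 := by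
    intro p
    rw [← map_smul] at t
    have := cyc_algHom_eq_zero (aev₂ xₐ p) t
    simpa using this
  rw [← sub_eq_zero, ← sub_smul, map_sub, smul_sub, t', t', sub_zero]

/-- Special derivations annihilate the kernel of `δ`. -/
theorem cyc_assTanDer_eq_zero {m : ℕ} {f : FreeAlgebra k (Fin 2)} (hf : f ∈ assDeg k 2 m)
    (h : cyc k (deltaPoly k f) = 0) {a : Fin 2 → FreeLieAlgebra k (Fin 2)}
    (ha : tanDer a (FreeLieAlgebra.of k 0 + FreeLieAlgebra.of k 1) = 0) :
    cyc k (assTanDer a f) = 0 := by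
  rcases m with _ | m
  · obtain ⟨t, rfl⟩ := mem_assDeg_zero hf
    rw [map_smul, assTanDer, assDer_one, smul_zero, map_zero]
  obtain ⟨c, e⟩ := exists_cyc_eq_of_deltaPoly hf h
  have e' : cyc k ((m + 1) • f -
      c • ((xₐ + yₐ) ^ (m + 1) - xₐ ^ (m + 1) - yₐ ^ (m + 1))) = 0 := by
    rw [map_sub, map_nsmul, e, map_smul, sub_self]
  have e'' := assDer_cyc (FreeAlgebra.ι k)
    (fun i => FreeAlgebra.ι k i * toAss (a i) - toAss (a i) * FreeAlgebra.ι k i) e'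
  rw [← assTanDer] at e''
  -- For a power of p only u(p) p^m matters. It is zero for p = x + y by specialness, and [x_i, a_i]
  -- x_i^m is a commutator.
  have hp : ∀ p, cyc k (assTanDer a (p ^ (m + 1))) = (m + 1) • cyc k (assTanDer a p * p ^ m) := by
    intro p
    have := cyc_assDer_pow (FreeAlgebra.ι k)
      (fun i => FreeAlgebra.ι k i * toAss (a i) - toAss (a i) * FreeAlgebra.ι k i) p m 0
    rwa [lift_ι, pow_zero, mul_one, add_zero, ← assTanDer] at this
  have hs : assTanDer a (xₐ + yₐ) = 0 := by
    rw [← toAss_of, ← toAss_of, ← map_add, assTanDer_toAss, ha, map_zero]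
  have hx : ∀ i, cyc k (assTanDer a (FreeAlgebra.ι k i) * FreeAlgebra.ι k i ^ m) = 0 := by
    intro i
    rw [assTanDer_ι, sub_mul, map_sub, mul_assoc, cyc_mul_comm, mul_assoc, mul_assoc, ← pow_succ,
      ← pow_succ', sub_self]
  simp only [map_sub, map_nsmul, map_smul, hp, hs, hx, zero_mul, map_zero, smul_zero, sub_zero]
    at e''
  rw [← Nat.cast_smul_eq_nsmul k] at e''
  exact (smul_eq_zero.1 e'').resolve_left (Nat.cast_ne_zero.2 m.succ_ne_zero)

end KernelField

/-! ### The degree components of the divergence -/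

section Components

variable {k : Type u} [CommRing k] {n : ℕ}

/-- The homomorphism `x_i ↦ x_i t` to polynomials in a central variable `t`. -/
def gradingHom : FreeAlgebra k (Fin n) →ₐ[k] Polynomial (FreeAlgebra k (Fin n)) :=
  FreeAlgebra.lift k fun i => Polynomial.C (FreeAlgebra.ι k i) * Polynomial.X

/-- The component of degree `m`. -/
def homPart (m : ℕ) (a : FreeAlgebra k (Fin n)) : FreeAlgebra k (Fin n) := (gradingHom a).coeff m

theorem gradingHom_word (l : List (Fin n)) : gradingHom (l.map (FreeAlgebra.ι k)).prod =
    Polynomial.C (l.map (FreeAlgebra.ι k)).prod * Polynomial.X ^ l.length := by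
  induction l with
  | nil => simp
  | cons i l ih =>
    rw [List.map_cons, List.prod_cons, map_mul, ih, gradingHom, FreeAlgebra.lift_ι_apply,
      List.length_cons, Polynomial.C_mul, mul_assoc, ← mul_assoc Polynomial.X, Polynomial.X_mul_C,
      pow_succ', mul_assoc, mul_assoc]

theorem homPart_of_mem {m : ℕ} {a : FreeAlgebra k (Fin n)} (ha : a ∈ assDeg k n m) :
    homPart m a = a := by
  induction ha using Submodule.span_induction with
  | mem a ha =>
    obtain ⟨l, rfl, rfl⟩ := ha
    rw [homPart, gradingHom_word, Polynomial.coeff_C_mul, Polynomial.coeff_X_pow_self, mul_one]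
  | zero => simp [homPart]
  | add a b _ _ ha hb => rw [homPart, map_add, Polynomial.coeff_add, ← homPart, ← homPart, ha, hb]
  | smul t a _ ha => rw [homPart, map_smul, Polynomial.coeff_smul, ← homPart, ha]

theorem homPart_mem (m : ℕ) (a : FreeAlgebra k (Fin n)) : homPart m a ∈ assDeg k n m := by
  refine ass_word_induction (P := fun a => homPart m a ∈ assDeg k n m) (fun l => ?_) ?_ ?_ ?_ a
  · rw [homPart, gradingHom_word, Polynomial.coeff_C_mul, Polynomial.coeff_X_pow]
    split_ifs with h
    · rw [mul_one]; exact Submodule.subset_span ⟨l, h.symm, rfl⟩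
    · rw [mul_zero]; exact zero_mem _
  · simp [homPart]
  · intro a b ha hb
    rw [homPart, map_add, Polynomial.coeff_add]; exact add_mem ha hb
  · intro t a ha
    rw [homPart, map_smul, Polynomial.coeff_smul]; exact Submodule.smul_mem _ t ha

theorem homPart_ι_mul (m : ℕ) (i : Fin n) (a : FreeAlgebra k (Fin n)) :
    homPart (m + 1) (FreeAlgebra.ι k i * a) = FreeAlgebra.ι k i * homPart m a := by
  rw [homPart, map_mul, gradingHom, FreeAlgebra.lift_ι_apply, mul_assoc, Polynomial.coeff_C_mul,
    Polynomial.coeff_X_mul]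
  rfl

theorem homPart_mul_ι (m : ℕ) (i : Fin n) (a : FreeAlgebra k (Fin n)) :
    homPart (m + 1) (a * FreeAlgebra.ι k i) = homPart m a * FreeAlgebra.ι k i := by
  rw [homPart, map_mul, gradingHom, FreeAlgebra.lift_ι_apply, ← mul_assoc, Polynomial.coeff_mul_X,
    Polynomial.coeff_mul_C]
  rfl

variable (k n) in
/-- The map `(w_1, …, w_n) ↦ ∑ [x_i, w_i]`. -/
def sumComm : (Fin n → FreeAlgebra k (Fin n)) →ₗ[k] FreeAlgebra k (Fin n) :=
  ∑ i, (LinearMap.mulLeft k (FreeAlgebra.ι k i) - LinearMap.mulRight k (FreeAlgebra.ι k i)) ∘ₗ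
    LinearMap.proj i

theorem sumComm_apply (w : Fin n → FreeAlgebra k (Fin n)) :
    sumComm k n w = ∑ i, (FreeAlgebra.ι k i * w i - w i * FreeAlgebra.ι k i) := by
  simp [sumComm]

/-- Letters are peeled off by [x_i a, b] = [x_i, ab] + [a, b x_i]. -/
theorem commutators_le_range_sumComm :
    commutators k (FreeAlgebra k (Fin n)) ≤ LinearMap.range (sumComm k n) := by
  refine Submodule.span_le.2 ?_
  rintro _ ⟨a, b, rfl⟩
  induction a using ass_top_induction generalizing b with
  | one => rw [one_mul, mul_one, sub_self]; exact zero_mem _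
  | mul i a ih =>
    have h : FreeAlgebra.ι k i * (a * b) - a * b * FreeAlgebra.ι k i ∈
        LinearMap.range (sumComm k n) := by
      refine ⟨Pi.single i (a * b), ?_⟩
      rw [sumComm_apply, Finset.sum_eq_single i]
      · rw [Pi.single_eq_same]
      · intro j _ hj; rw [Pi.single_eq_of_ne hj, mul_zero, zero_mul, sub_self]
      · simp
    have e : FreeAlgebra.ι k i * a * b - b * (FreeAlgebra.ι k i * a) =
        FreeAlgebra.ι k i * (a * b) - a * b * FreeAlgebra.ι k i +
          (a * (b * FreeAlgebra.ι k i) - b * FreeAlgebra.ι k i * a) := by noncomm_ring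
    rw [e]
    exact add_mem h (ih (b * FreeAlgebra.ι k i))
  | zero => rw [zero_mul, mul_zero, sub_self]; exact zero_mem _
  | add a a' h h' =>
    rw [add_mul, mul_add, add_sub_add_comm]; exact add_mem (h b) (h' b)
  | smul t a h =>
    rw [smul_mul_assoc, mul_smul_comm, ← smul_sub]; exact Submodule.smul_mem _ t (h b)

theorem exists_sumComm {m : ℕ} {f : FreeAlgebra k (Fin n)} (hf : f ∈ assDeg k n (m + 1))
    (h : cyc k f = 0) : ∃ w : Fin n → FreeAlgebra k (Fin n), (∀ i, w i ∈ assDeg k n m) ∧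
      f = sumComm k n w := by
  obtain ⟨w, rfl⟩ := commutators_le_range_sumComm (cyc_eq_zero.1 h)
  refine ⟨fun i => homPart m (w i), fun i => homPart_mem m _, ?_⟩
  conv_lhs => rw [← homPart_of_mem hf]
  simp only [sumComm_apply, ← homPart_ι_mul, ← homPart_mul_ι]
  simp only [homPart, map_sum, map_sub, Polynomial.finsetSum_coeff, Polynomial.coeff_sub]

theorem assMul_assGen_succ (i : Fin n) (f : assHat k n) (m : ℕ) :
    (assMul (assGen k i) f).1 (m + 1) = FreeAlgebra.ι k i * f.1 m := by
  change ∑ p ∈ antidiagonal (m + 1), (Pi.single 1 (FreeAlgebra.ι k i) : ℕ → _) p.1 * f.1 p.2 = _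
  rw [Finset.sum_eq_single (1, m)]
  · rw [Pi.single_eq_same]
  · rintro ⟨p, q⟩ h hne
    rw [HasAntidiagonal.mem_antidiagonal] at h
    have : p ≠ 1 := by
      rintro rfl
      exact hne (by rw [Prod.mk.injEq]; exact ⟨rfl, by omega⟩)
    rw [Pi.single_eq_of_ne this, zero_mul]
  · intro h
    exact absurd (HasAntidiagonal.mem_antidiagonal.2 (add_comm 1 m)) h

theorem assMul_assGen_succ' (i : Fin n) (f : assHat k n) (m : ℕ) :
    (assMul f (assGen k i)).1 (m + 1) = f.1 m * FreeAlgebra.ι k i := by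
  change ∑ p ∈ antidiagonal (m + 1), f.1 p.1 * (Pi.single 1 (FreeAlgebra.ι k i) : ℕ → _) p.2 = _
  rw [Finset.sum_eq_single (m, 1)]
  · rw [Pi.single_eq_same]
  · rintro ⟨p, q⟩ h hne
    rw [HasAntidiagonal.mem_antidiagonal] at h
    have : q ≠ 1 := by
      rintro rfl
      exact hne (by rw [Prod.mk.injEq]; exact ⟨by omega, rfl⟩)
    rw [Pi.single_eq_of_ne this, mul_zero]
  · intro h
    exact (h (HasAntidiagonal.mem_antidiagonal.2 rfl)).elim

theorem assMul_assGen_zero (i : Fin n) (f : assHat k n) : (assMul (assGen k i) f).1 0 = 0 := by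
  change ∑ p ∈ antidiagonal 0, (Pi.single 1 (FreeAlgebra.ι k i) : ℕ → _) p.1 * f.1 p.2 = 0
  rw [Finset.Nat.antidiagonal_zero, sum_singleton, Pi.single_eq_of_ne (by decide), zero_mul]

theorem assMul_assGen_zero' (i : Fin n) (f : assHat k n) : (assMul f (assGen k i)).1 0 = 0 := by
  change ∑ p ∈ antidiagonal 0, f.1 p.1 * (Pi.single 1 (FreeAlgebra.ι k i) : ℕ → _) p.2 = 0
  rw [Finset.Nat.antidiagonal_zero, sum_singleton, Pi.single_eq_of_ne (by decide), mul_zero]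

/-- The span in the completion allows only finite sums, so the commutators needed in the different
degrees must be collected. This works because in every degree n commutators of the form [x_i, w_i]
suffice, and the w_i of all degrees assemble into n series. -/
theorem mem_commSpan {f : assPlus k n} : f ∈ commSpan k n ↔ ∀ m, cyc k (f.1 m) = 0 := by
  constructor
  · intro h m
    rw [commSpan] at h
    induction h using Submodule.span_induction with
    | mem f hf =>
      obtain ⟨a, b, h⟩ := hf
      rw [h]
      change cyc k ((∑ p ∈ antidiagonal m, a.1 p.1 * b.1 p.2) -
        ∑ p ∈ antidiagonal m, b.1 p.1 * a.1 p.2) = 0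
      rw [← sum_swap fun p => b.1 p.1 * a.1 p.2, ← Finset.sum_sub_distrib, map_sum]
      refine Finset.sum_eq_zero fun p _ => ?_
      rw [map_sub, sub_eq_zero]
      exact cyc_mul_comm _ _
    | zero => exact map_zero _
    | add f g _ _ hf hg =>
      change cyc k (f.1 m + g.1 m) = 0
      rw [map_add, hf, hg, add_zero]
    | smul t f _ hf =>
      change cyc k (t • f.1 m) = 0
      rw [map_smul, hf, smul_zero]
  · intro h
    choose w hw e using fun m => exists_sumComm (f.2.2 (m + 1)) (h (m + 1))
    let c : Fin n → assHat k n := fun i => ⟨fun m => w m i, fun m => hw m i⟩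
    let g : Fin n → assPlus k n := fun i =>
      ⟨(assMul (assGen k i) (c i)).1 - (assMul (c i) (assGen k i)).1, by
        rw [Pi.sub_apply, assMul_assGen_zero, assMul_assGen_zero', sub_zero],
        fun m => sub_mem ((assMul (assGen k i) (c i)).2 m) ((assMul (c i) (assGen k i)).2 m)⟩
    have hg : f = ∑ i, g i := by
      refine Subtype.ext (funext fun m => ?_)
      rw [Submodule.coe_sum, Finset.sum_apply]
      rcases m with _ | m
      · rw [f.2.1, Finset.sum_eq_zero fun i _ => (g i).2.1]
      · rw [e m, sumComm_apply]
        refine Finset.sum_congr rfl fun i _ => ?_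
        change _ = (assMul (assGen k i) (c i)).1 (m + 1) - (assMul (c i) (assGen k i)).1 (m + 1)
        rw [assMul_assGen_succ, assMul_assGen_succ']
    rw [hg]
    exact Submodule.sum_mem _ fun i _ => Submodule.subset_span ⟨_, _, rfl⟩

/-- The divergence of a tuple, before taking it modulo commutators. -/
def divHat (a : Fin n → lie k n) : assPlus k n :=
  ∑ i, dropConst (assMul (assGen k i) (assPartial i (toAssHat (a i))))

theorem div_eq_mk (a : Fin n → lie k n) : div a = Submodule.Quotient.mk (divHat a) :=
  (map_sum (commSpan k n).mkQ _ _).symm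

theorem divHat_apply (a : Fin n → lie k n) (m : ℕ) :
    (divHat a).1 m = divPoly fun i => (a i).1 m := by
  rw [divHat, Submodule.coe_sum, Finset.sum_apply, divPoly]
  refine Finset.sum_congr rfl fun i _ => ?_
  change (if m = 0 then 0 else (assMul (assGen k i) (assPartial i (toAssHat (a i)))).1 m) = _
  rcases m with _ | m
  · have := (a i).2 0
    rw [lieDeg_zero, Submodule.mem_bot] at this
    rw [if_pos rfl, this, map_zero, map_zero, mul_zero]
  · rw [if_neg m.succ_ne_zero, assMul_assGen_succ]
    rfl

theorem delta_div_eq_zero {a : Fin 2 → lie k 2} :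
    delta (div a) = 0 ↔ ∀ m, cyc k (deltaPoly k (divPoly fun i => (a i).1 m)) = 0 := by
  let g : assPlus k 3 :=
    assPlusSubst ![assX k 1, assX k 2] (divHat a) -
    assPlusSubst ![assX k 0 + assX k 1, assX k 2] (divHat a) +
    assPlusSubst ![assX k 0, assX k 1 + assX k 2] (divHat a) -
    assPlusSubst ![assX k 0, assX k 1] (divHat a)
  have hg : delta (div a) = Submodule.Quotient.mk g := by
    rw [div_eq_mk]; rfl
  have h : ∀ (p q : assDeg k 3 1) (m : ℕ), (assPlusSubst ![p, q] (divHat a)).1 m =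
      aev₂ (p : FreeAlgebra k (Fin 3)) (q : FreeAlgebra k (Fin 3)) ((divHat a).1 m) := by
    intro p q m
    change FreeAlgebra.lift k _ _ = FreeAlgebra.lift k _ _
    congr 2
    funext i
    fin_cases i <;> rfl
  have hm : ∀ m, g.1 m = deltaPoly k (divPoly fun i => (a i).1 m) := by
    intro m
    rw [← divHat_apply, deltaPoly_apply]
    change (assPlusSubst _ (divHat a)).1 m - (assPlusSubst _ (divHat a)).1 m +
      (assPlusSubst _ (divHat a)).1 m - (assPlusSubst _ (divHat a)).1 m = _
    rw [h, h, h, h]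
    rfl
  rw [hg, Submodule.Quotient.mk_eq_zero, mem_commSpan]
  simp only [hm]

theorem divPoly_mem {m : ℕ} {a : Fin n → FreeLieAlgebra k (Fin n)}
    (ha : ∀ i, a i ∈ lieDeg k (letters k n) m) : divPoly a ∈ assDeg k n m := by
  refine Submodule.sum_mem _ fun i _ => ?_
  rcases m with _ | m
  · have := ha i
    rw [lieDeg_zero, Submodule.mem_bot] at this
    rw [this, map_zero, map_zero, mul_zero]
    exact zero_mem _
  · rw [add_comm]
    exact mul_mem_assDeg (assX k i).2 (partialOp_mem i (toAss_mem (ha i)))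

end Components

/-! ### The degree components of the equations of `grt` -/

section GRTHat

variable {k : Type u} [CommRing k] {L : Type v} [LieRing L] [LieAlgebra k L] {S : Set L}

local notation "x" => FreeLieAlgebra.of k (0 : Fin 2)
local notation "y" => FreeLieAlgebra.of k (1 : Fin 2)

theorem ev_apply (ψ : lie k 2) (a b : lieDeg k S 1) (m : ℕ) :
    (ev ψ a b).1 m = ev₂ (a : L) (b : L) (ψ.1 m) := by
  change FreeLieAlgebra.lift k _ _ = FreeLieAlgebra.lift k _ _
  congr 2
  funext i
  fin_cases i <;> rfl

theorem coe_add_apply (f g : lieHat k S) (m : ℕ) : (f + g).1 m = f.1 m + g.1 m := rfl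

/-- Only elements of degree one are substituted, so each equation splits into its homogeneous
components. -/
theorem isGRT_iff {ψ : lie k 2} : IsGRT ψ ↔ ∀ m, IsGRTPoly (ψ.1 m) := by
  have hp : ∀ m, (ev ψ (t4 k 0 1) (t4 k 1 2 + t4 k 1 3) +
      ev ψ (t4 k 0 2 + t4 k 1 2) (t4 k 2 3)).1 m -
      (ev ψ (t4 k 1 2) (t4 k 2 3) + ev ψ (t4 k 0 1 + t4 k 0 2) (t4 k 1 3 + t4 k 2 3) +
      ev ψ (t4 k 0 1) (t4 k 1 2)).1 m = pentagon (braidGen k) (ψ.1 m) := by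
    intro m
    simp only [coe_add_apply, ev_apply]
    rfl
  have hh : ∀ m, (ev ψ (degX k) (degY k) + ev ψ (degY k) (-degX k - degY k) +
      ev ψ (-degX k - degY k) (degX k)).1 m =
      ev₂ x y (ψ.1 m) + ev₂ y (-x - y) (ψ.1 m) + ev₂ (-x - y) x (ψ.1 m) := by
    intro m
    simp only [coe_add_apply, ev_apply]
    rfl
  have ha : ∀ m, (-ev ψ (degY k) (degX k)).1 m = -ev₂ y x (ψ.1 m) := fun m =>
    congrArg Neg.neg (ev_apply ψ _ _ m)
  constructor
  · intro h m
    refine ⟨?_, ?_, ?_⟩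
    · rw [← ha, ← h.antisymm]
    · rw [← hh, h.hexagon]; rfl
    · rw [← hp, h.pentagon, sub_self]
  · intro h
    refine ⟨lieHat_ext fun m => ?_, lieHat_ext fun m => ?_, lieHat_ext fun m => ?_⟩
    · rw [ha, ← (h m).antisymm]
    · rw [hh, (h m).hexagon]; rfl
    · rw [← sub_eq_zero, hp, (h m).pentagon]

variable (k) in
/-- The solutions of the equations of `grt` among the Lie polynomials. -/
def grtPoly : Submodule k (FreeLieAlgebra k (Fin 2)) where
  carrier := {f | IsGRTPoly f}
  add_mem' {f g} hf hg := by
    refine ⟨?_, ?_, ?_⟩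
    · rw [map_add, neg_add, ← hf.antisymm, ← hg.antisymm]
    · have := congrArg₂ (· + ·) hf.hexagon hg.hexagon
      simp only [map_add, add_zero] at this ⊢
      rw [← this]; abel
    · have := congrArg₂ (· + ·) hf.pentagon hg.pentagon
      simp only [pentagon, map_add, add_zero] at this ⊢
      rw [← this]; abel
  zero_mem' := ⟨by simp, by simp, by simp [pentagon]⟩
  smul_mem' t f hf := by
    refine ⟨?_, ?_, ?_⟩
    · rw [map_smul, ← smul_neg, ← hf.antisymm]
    · have := congrArg (t • ·) hf.hexagon
      simpa only [map_smul, smul_add, smul_zero] using this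
    · have := congrArg (t • ·) hf.pentagon
      simpa only [pentagon, map_smul, smul_add, smul_sub, smul_zero] using this

theorem tderPart_eq {n : ℕ} (a : Fin n → lie k n) (d : ℕ) :
    tderPart a d = tanDer fun i => (a i).1 d := rfl

theorem iharaDer_apply (ψ φ : lie k 2) (m : ℕ) :
    (iharaDer ψ φ).1 m = ∑ p ∈ antidiagonal m, tanDer ![0, ψ.1 p.1] (φ.1 p.2) := by
  rw [iharaDer, tder_apply]
  refine Finset.sum_congr rfl fun p _ => ?_
  rw [tderPart_eq]
  congr 2
  funext i
  fin_cases i <;> rfl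

theorem iharaBracket_apply (ψ φ : lie k 2) (m : ℕ) :
    (iharaBracket ψ φ).1 m = ∑ p ∈ antidiagonal m, iharaPoly (ψ.1 p.1) (φ.1 p.2) := by
  change (iharaDer ψ φ).1 m - (iharaDer φ ψ).1 m + ⁅ψ.1, φ.1⁆ m = _
  rw [iharaDer_apply, iharaDer_apply, LieSeries.lie_apply,
    ← sum_swap fun p => tanDer ![0, φ.1 p.1] (ψ.1 p.2), ← Finset.sum_sub_distrib,
    ← Finset.sum_add_distrib]
  rfl

theorem apply_zero (f : lieHat k S) : f.1 0 = 0 := by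
  have := f.2 0
  rwa [lieDeg_zero, Submodule.mem_bot] at this

theorem tder_ofDegOne {n : ℕ} (a : Fin n → lie k n) (s : lieDeg k (letters k n) 1) (m : ℕ) :
    (tder a (ofDegOne s)).1 (m + 1) = tanDer (fun i => (a i).1 m) (s : FreeLieAlgebra k (Fin n)) := by
  rw [tder_apply]
  change ∑ p ∈ antidiagonal (m + 1),
    tderPart a p.1 ((Pi.single 1 (s : FreeLieAlgebra k (Fin n)) : ℕ → _) p.2) = _
  rw [Finset.sum_eq_single (m, 1)]
  · rw [Pi.single_eq_same]; rfl
  · rintro ⟨p, q⟩ h hne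
    rw [HasAntidiagonal.mem_antidiagonal] at h
    have : q ≠ 1 := by
      rintro rfl
      exact hne (by rw [Prod.mk.injEq]; exact ⟨by omega, rfl⟩)
    rw [Pi.single_eq_of_ne this, map_zero]
  · intro h
    exact (h (HasAntidiagonal.mem_antidiagonal.2 rfl)).elim

theorem tder_ofDegOne_eq_zero {n : ℕ} {a : Fin n → lie k n} {s : lieDeg k (letters k n) 1} :
    tder a (ofDegOne s) = 0 ↔
      ∀ m, tanDer (fun i => (a i).1 m) (s : FreeLieAlgebra k (Fin n)) = 0 := by
  constructor
  · intro h m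
    rw [← tder_ofDegOne, h]
    rfl
  · intro h
    refine lieHat_ext fun m => ?_
    rcases m with _ | m
    · exact apply_zero _
    · rw [tder_ofDegOne, h]; rfl

theorem sum_gen : ∑ i, gen k (n := 2) i = ofDegOne (X k 0 + X k 1) := by
  rw [Fin.sum_univ_two, map_add]; rfl

theorem tder_sum_gen_eq_zero {a : Fin 2 → lie k 2} :
    tder a (∑ i, gen k i) = 0 ↔ ∀ m, tanDer (fun i => (a i).1 m) (x + y) = 0 := by
  rw [sum_gen, tder_ofDegOne_eq_zero]; rfl

/-! ### The degree components of the equations of the Kashiwara-Vergne Lie algebra -/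

theorem isHKV_iff {u : Der k 2} : IsHKV u ↔ ∃ a : Fin 2 → lie k 2, u = tder a ∧ IsNormalized a ∧
    (∀ m, tanDer (fun i => (a i).1 m) (x + y) = 0) ∧
    ∀ m, cyc k (deltaPoly k (divPoly fun i => (a i).1 m)) = 0 := by
  constructor
  · rintro ⟨⟨-, h⟩, a, ha, rfl, hd⟩
    exact ⟨a, rfl, ha, tder_sum_gen_eq_zero.1 h, delta_div_eq_zero.1 hd⟩
  · rintro ⟨a, rfl, ha, h, hd⟩
    exact ⟨⟨⟨a, tder_gen a⟩, tder_sum_gen_eq_zero.2 h⟩, a, ha, rfl, delta_div_eq_zero.2 hd⟩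

theorem cyc_deltaPoly_eq_zero {f : FreeAlgebra k (Fin 2)} (hf : cyc k f = 0) :
    cyc k (deltaPoly k f) = 0 := by
  rw [deltaPoly_apply, map_sub, map_add, map_sub, cyc_algHom_eq_zero _ hf, cyc_algHom_eq_zero _ hf,
    cyc_algHom_eq_zero _ hf, cyc_algHom_eq_zero _ hf]
  simp

theorem divPoly_sum {n : ℕ} {ι : Type*} (s : Finset ι)
    (a : ι → Fin n → FreeLieAlgebra k (Fin n)) :
    divPoly (fun i => ∑ j ∈ s, a j i) = ∑ j ∈ s, divPoly (a j) := by
  simp only [divPoly, map_sum, Finset.mul_sum]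
  exact Finset.sum_comm

theorem tanDer_zero {n : ℕ} : tanDer (fun _ : Fin n => (0 : FreeLieAlgebra k (Fin n))) = 0 :=
  free_der_ext fun i => by rw [tanDer_of, lie_zero]; rfl

theorem lie_tder_tuple_apply {n : ℕ} (a b : Fin n → lie k n) (i : Fin n) (m : ℕ) :
    (tder a (b i) - tder b (a i) + ⁅a i, b i⁆).1 m = ∑ p ∈ antidiagonal m,
      (tanDer (fun i => (a i).1 p.1) ((b i).1 p.2) - tanDer (fun i => (b i).1 p.2) ((a i).1 p.1) +
        ⁅(a i).1 p.1, (b i).1 p.2⁆) := by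
  change (tder a (b i)).1 m - (tder b (a i)).1 m + ⁅(a i).1, (b i).1⁆ m = _
  rw [tder_apply, tder_apply, LieSeries.lie_apply,
    ← sum_swap fun p => tderPart b p.1 ((a i).1 p.2), ← Finset.sum_sub_distrib,
    ← Finset.sum_add_distrib]
  rfl

/-- The tuple `(ψ(-x-y, x), ψ(-x-y, y))`. -/
def nuHat (ψ : lie k 2) : Fin 2 → lie k 2 :=
  ![ev ψ (-degX k - degY k) (degX k), ev ψ (-degX k - degY k) (degY k)]

theorem nuHat_apply (ψ : lie k 2) (m : ℕ) :
    (fun i => (nuHat ψ i).1 m) = nuTuple (ψ.1 m) := by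
  funext i
  fin_cases i
  · exact ev_apply ψ _ _ m
  · refine (ev_apply ψ _ _ m).trans ?_
    change ev₂ (-x - y) y (ψ.1 m) = ev₂ (-y - x) y (ψ.1 m)
    rw [show -x - y = -y - x by abel]

theorem apply_one_eq_zero {ψ : lie k 2} (h : IsGRT ψ) : ψ.1 1 = 0 :=
  eq_zero_of_pentagon (ψ.2 1) (isGRT_iff.1 h 1).pentagon

theorem isNuAct_nuTuple (f : FreeLieAlgebra k (Fin 2)) : IsNuAct f x y (tanDer (nuTuple f)) :=
  ⟨tanDer_of _ _, tanDer_of _ _⟩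

theorem nuTuple_zero : nuTuple (0 : FreeLieAlgebra k (Fin 2)) = 0 := by
  funext i
  fin_cases i <;> exact map_zero _

end GRTHat

/-! ### The two Lie algebras and the homomorphism ν -/

section Main

variable {k : Type u} [Field k] [CharZero k]

local notation "x" => FreeLieAlgebra.of k (0 : Fin 2)
local notation "y" => FreeLieAlgebra.of k (1 : Fin 2)

variable (k) in
/-- The Grothendieck-Teichmueller Lie algebra. -/
def grt : LieSubalgebra k (Ihara k) where
  carrier := {ψ | IsGRT (Ihara.toLie ψ)}
  add_mem' {ψ φ} hψ hφ := isGRT_iff.2 fun m =>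
    (grtPoly k).add_mem (isGRT_iff.1 hψ m) (isGRT_iff.1 hφ m)
  zero_mem' := isGRT_iff.2 fun _ => (grtPoly k).zero_mem
  smul_mem' t ψ hψ := isGRT_iff.2 fun m => (grtPoly k).smul_mem t (isGRT_iff.1 hψ m)
  lie_mem' {ψ φ} hψ hφ := isGRT_iff.2 fun m => by
    rw [Ihara.toLie_lie, iharaBracket_apply]
    refine (grtPoly k).sum_mem fun p _ => ?_
    exact (isGRT_iff.1 hψ _).iharaPoly (isGRT_iff.1 hφ _) ((Ihara.toLie ψ).2 _)
      ((Ihara.toLie φ).2 _)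

variable (k) in
/-- The extended Kashiwara-Vergne Lie algebra. -/
def hkv : LieSubalgebra k (Der k 2) where
  carrier := {u | IsHKV u}
  add_mem' {u v} hu hv := by
    obtain ⟨a, rfl, ha, sa, da⟩ := isHKV_iff.1 hu
    obtain ⟨b, rfl, hb, sb, db⟩ := isHKV_iff.1 hv
    refine isHKV_iff.2 ⟨a + b, (map_add _ _ _).symm, fun i => ?_, fun m => ?_, fun m => ?_⟩
    · have : proj i ((a + b) i) = proj i (a i) + proj i (b i) := map_add (linCoeff i) _ _
      rw [this, ha, hb, add_zero]
    · have : (fun i => ((a + b) i).1 m) = (fun i => (a i).1 m) + fun i => (b i).1 m := rfl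
      rw [this, tanDer_add, LieDerivation.add_apply, sa, sb, add_zero]
    · have : (fun i => ((a + b) i).1 m) = (fun i => (a i).1 m) + fun i => (b i).1 m := rfl
      rw [this, divPoly_add, map_add, map_add, da, db, add_zero]
  zero_mem' := by
    refine isHKV_iff.2 ⟨0, (map_zero _).symm, fun i => map_zero (linCoeff i), fun m => ?_,
      fun m => ?_⟩
    · exact LieDerivation.congr_fun tanDer_zero _
    · have : (fun i => ((0 : Fin 2 → lie k 2) i).1 m) = (0 : k) • 0 := by rw [zero_smul]; rfl
      rw [this, divPoly_smul, zero_smul, map_zero, map_zero]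
  smul_mem' t u hu := by
    obtain ⟨a, rfl, ha, sa, da⟩ := isHKV_iff.1 hu
    refine isHKV_iff.2 ⟨t • a, (map_smul _ _ _).symm, fun i => ?_, fun m => ?_, fun m => ?_⟩
    · have : proj i ((t • a) i) = t • proj i (a i) := map_smul (linCoeff i) _ _
      rw [this, ha, smul_zero]
    · have : (fun i => ((t • a) i).1 m) = t • fun i => (a i).1 m := rfl
      rw [this, tanDer_smul, LieDerivation.smul_apply, sa, smul_zero]
    · have : (fun i => ((t • a) i).1 m) = t • fun i => (a i).1 m := rfl
      rw [this, divPoly_smul, map_smul, map_smul, da, smul_zero]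
  lie_mem' {u v} hu hv := by
    obtain ⟨a, rfl, ha, sa, da⟩ := isHKV_iff.1 hu
    obtain ⟨b, rfl, hb, sb, db⟩ := isHKV_iff.1 hv
    refine isHKV_iff.2 ⟨_, lie_tder a b, fun i => ?_, ?_, fun m => ?_⟩
    -- A bracket of tuples has no part of degree one, because tuples have no part of degree zero. So
    -- the tuple of the commutator is normalized.
    · have : (tder a (b i) - tder b (a i) + ⁅a i, b i⁆).1 1 = 0 := by
        rw [lie_tder_tuple_apply]
        refine Finset.sum_eq_zero fun p hp => ?_
        obtain ⟨p, q⟩ := p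
        rw [HasAntidiagonal.mem_antidiagonal] at hp
        obtain ⟨rfl, rfl⟩ | ⟨rfl, rfl⟩ : p = 0 ∧ q = 1 ∨ p = 1 ∧ q = 0 := by
          dsimp only at hp; omega
        all_goals simp [apply_zero, tanDer_zero]
      rw [proj, this, map_zero]
    · rw [← tder_sum_gen_eq_zero, ← lie_tder, LieDerivation.lie_apply, tder_sum_gen_eq_zero.2 sa,
        tder_sum_gen_eq_zero.2 sb, map_zero, map_zero, sub_zero]
    -- The divergence of the commutator itself vanishes: by the cocycle property it is a difference
    -- of images of elements of ker δ under special derivations.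
    · refine cyc_deltaPoly_eq_zero ?_
      simp only [lie_tder_tuple_apply]
      rw [divPoly_sum _ fun (p : ℕ × ℕ) i => tanDer (fun i => (a i).1 p.1) ((b i).1 p.2) -
        tanDer (fun i => (b i).1 p.2) ((a i).1 p.1) + ⁅(a i).1 p.1, (b i).1 p.2⁆, map_sum]
      refine Finset.sum_eq_zero fun p _ => ?_
      rw [cyc_divPoly_lie (fun i => (a i).1 p.1) fun i => (b i).1 p.2,
        cyc_assTanDer_eq_zero (divPoly_mem fun i => (b i).2 p.2) (db _) (sa _),
        cyc_assTanDer_eq_zero (divPoly_mem fun i => (a i).2 p.1) (da _) (sb _), sub_zero]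

theorem nu_mem_hkv {ψ : lie k 2} (h : IsGRT ψ) : nu ψ ∈ hkv k := by
  refine isHKV_iff.2 ⟨nuHat ψ, rfl, fun i => ?_, fun m => ?_, fun m => ?_⟩
  · rw [proj, show (nuHat ψ i).1 1 = 0 by
      rw [congrFun (nuHat_apply ψ 1) i, apply_one_eq_zero h, nuTuple_zero]; rfl, map_zero]
  · rw [nuHat_apply, map_add, (isNuAct_nuTuple _).left, (isNuAct_nuTuple _).right]
    exact (isGRT_iff.1 h m).specialDefect_eq_zero (ψ.2 m) x y
  · rw [nuHat_apply]
    exact (isGRT_iff.1 h m).deltaPoly_divPoly (ψ.2 m)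

theorem nu_iharaBracket {ψ φ : lie k 2} (hψ : IsGRT ψ) (hφ : IsGRT φ) :
    nu (iharaBracket ψ φ) = ⁅nu ψ, nu φ⁆ := by
  change tder (nuHat _) = ⁅tder (nuHat ψ), tder (nuHat φ)⁆
  rw [lie_tder]
  congr 1
  funext i
  refine lieHat_ext fun m => ?_
  rw [lie_tder_tuple_apply, congrFun (nuHat_apply _ m) i, iharaBracket_apply]
  have hs : ∀ (s : Finset (ℕ × ℕ)) (f : ℕ × ℕ → FreeLieAlgebra k (Fin 2)),
      nuTuple (∑ p ∈ s, f p) i = ∑ p ∈ s, nuTuple (f p) i := fun s f => by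
    fin_cases i <;> exact map_sum (ev₂ _ _) _ _
  rw [hs]
  refine Finset.sum_congr rfl fun p _ => ?_
  have dψ := fun a b : FreeLieAlgebra k (Fin 2) =>
    (isGRT_iff.1 hψ p.1).specialDefect_eq_zero (ψ.2 p.1) a b
  have dφ := fun a b : FreeLieAlgebra k (Fin 2) =>
    (isGRT_iff.1 hφ p.2).specialDefect_eq_zero (φ.2 p.2) a b
  have aψ := isNuAct_nuTuple (ψ.1 p.1)
  have aφ := isNuAct_nuTuple (φ.1 p.2)
  rw [nuHat_apply, nuHat_apply, congrFun (nuHat_apply ψ p.1) i, congrFun (nuHat_apply φ p.2) i]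
  fin_cases i
  · exact (aψ.nuVal_iharaPoly aφ (dψ _ _) (dφ _ _)).symm
  · exact (aψ.swap.nuVal_iharaPoly aφ.swap (dψ _ _) (dφ _ _)).symm

variable (k) in
/-- The homomorphism `ν`. -/
def nuHom : grt k →ₗ⁅k⁆ hkv k where
  toFun ψ := ⟨nu (Ihara.toLie ψ.1), nu_mem_hkv ψ.2⟩
  map_add' ψ φ := Subtype.ext <| by
    have h : nuHat (Ihara.toLie ψ.1 + Ihara.toLie φ.1) =
        nuHat (Ihara.toLie ψ.1) + nuHat (Ihara.toLie φ.1) := by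
      funext i; fin_cases i <;> exact map_add (subst _) _ _
    exact (congrArg tder h).trans (map_add _ _ _)
  map_smul' t ψ := Subtype.ext <| by
    have h : nuHat (t • Ihara.toLie ψ.1) = t • nuHat (Ihara.toLie ψ.1) := by
      funext i; fin_cases i <;> exact map_smul (subst _) _ _
    exact (congrArg tder h).trans (map_smul _ _ _)
  map_lie' {ψ φ} := Subtype.ext (nu_iharaBracket ψ.2 φ.2)

/-- The value of ν(ψ) at x is [x, ψ(-x-y, x)], so outside degree one ψ(-x-y, x) = 0. The
substitution x ↦ y, y ↦ -x-y turns the pair (-x-y, x) into (x, y). -/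
theorem nuHom_injective : Function.Injective (nuHom k) := by
  rw [injective_iff_map_eq_zero]
  intro ψ h
  have h' : tder (nuHat (Ihara.toLie ψ.1)) = 0 := congrArg Subtype.val h
  refine Subtype.ext (lieHat_ext fun m => ?_)
  change (Ihara.toLie ψ.1).1 m = 0
  by_cases hm : m = 1
  · subst hm
    exact apply_one_eq_zero ψ.2
  have e := tder_ofDegOne (nuHat (Ihara.toLie ψ.1)) (X k 0) m
  rw [h', nuHat_apply] at e
  have e' : ⁅x, nuVal ((Ihara.toLie ψ.1).1 m) x y⁆ = 0 := (tanDer_of _ _).symm.trans e.symm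
  have z := eq_zero_of_lie_of_eq_zero 0 hm
    (nuVal_mem (of_mem 0) (of_mem 1) ((Ihara.toLie ψ.1).2 m)) e'
  have z' := congrArg (ev₂ y (-x - y)) z
  rwa [map_nuVal, ev₂_x, ev₂_y, map_zero, nuVal, show -y - (-x - y) = x by abel, ev₂_of] at z'

end Main

end

end KashiwaraVergne

theorem mainTheorem4 {k : Type*} [Field k] [CharZero k] :
    ∃ grt : LieSubalgebra k (KashiwaraVergne.Ihara k),
      (∀ ψ, ψ ∈ grt ↔ KashiwaraVergne.IsGRT (KashiwaraVergne.Ihara.toLie ψ)) ∧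
    ∃ hkv : LieSubalgebra k (KashiwaraVergne.Der k 2),
      (∀ u, u ∈ hkv ↔ KashiwaraVergne.IsHKV u) ∧
    ∃ ν : grt →ₗ⁅k⁆ hkv, Function.Injective ν ∧
      ∀ ψ : grt, (ν ψ : KashiwaraVergne.Der k 2) =
        KashiwaraVergne.nu (KashiwaraVergne.Ihara.toLie (ψ : KashiwaraVergne.Ihara k)) :=
  ⟨KashiwaraVergne.grt k, fun _ => Iff.rfl, KashiwaraVergne.hkv k, fun _ => Iff.rfl,
    KashiwaraVergne.nuHom k, KashiwaraVergne.nuHom_injective, fun _ => rfl⟩
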